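/- **Setting.** Let $R$ be an irreducible reduced root system in a Euclidean space with Weyl group $W$, simple roots $\alpha_1,\dots,\alpha_n$, simple reflections $s_1,\dots,s_n$, positive roots $R_+$ and weight lattice $P$, with the $W$-invariant form $(\cdot,\cdot)$ normalized by $(\alpha,\alpha)=2$ for short roots. Put $\nu_\alpha=(\alpha,\alpha)/2$, $\alpha^\vee=\alpha/\nu_\alpha$, $\nu_R=\{\nu_\alpha:\alpha\in R\}$, $\rho_\nu^\vee=\frac12\sum_{\alpha\in R_+,\,\nu_\alpha=\nu}\alpha^\vee$, and $P_+=\{b\in P:(b,\alpha_i^\vee)\ge 0 \text{ for } 1\le i\le n\}$. *Affine roots* are the $\tilde\alpha=[\alpha,\nu_\alpha j]$, $\alpha\in R$, $j\in\mathbb Z$, with $\alpha=[\alpha,0]$; put $\alpha_0=[-\vartheta,1]$ for the maximal short root $\vartheta$, and $-[\alpha,\nu_\alpha j]=[-\alpha,-\nu_\alpha j]$. The extended affine Weyl group $\widehat W=P\rtimes W$ acts by $(bw)([z,\zeta])=[w(z),\zeta-(w(z),b)]$; $s_{\tilde\alpha}\in\widehat W$ is the reflection $[z,\zeta]\mapsto[z,\zeta]-(z,\alpha^\vee)\tilde\alpha$,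 and $s_0=s_{\alpha_0}$. Let $\Pi\subset\widehat W$ be the group of elements permuting $\{\alpha_0,\dots,\alpha_n\}$. A decomposition $\hat w=\pi s_{j_l}\cdots s_{j_1}$ with $\pi\in\Pi$, $0\le j_i\le n$ (for $\hat w\in W$: $\pi=1$ and $1\le j_i\le n$) is *reduced* if $\pi^{-1}\hat w$ is not a product of fewer than $l$ of these simple reflections. It defines $\tilde\alpha^i=s_{j_1}\cdots s_{j_{i-1}}(\alpha_{j_i})$, $1\le i\le l$; these lie in $R$ and are written $\alpha^i$ in the case of $W$. *Operators.* Let $m\ge 1$ be the integer with $(P,P)=\frac1m\mathbb Z$. Let $K$ be the field of rational functions, over $\mathbb Q$, in $q^{1/(2m)}$, $t_\nu^{1/2}$ ($\nu\in\nu_R$) and $X_b$ ($b\in P$, $X_{a+b}=X_aX_b$). Put $t_{\tilde\alpha}=t_{\nu_\alpha}$, $X_{\tilde\alpha}=q^{\nu_\alpha j}X_\alpha$. The group $\widehat W$ acts on $K$ by $(bw)(X_a)=q^{-(w(a),b)}X_{w(a)}$, fixing $q$ and the $t_\nu$; let $\Gamma_b$ be the action of $-b\in\widehat W$, so that $\Gamma_bX_a=q^{(a,b)}X_a\Gamma_b$.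 Let $\mathcal A$ be the algebra of the sums $\sum g_{b,w}\Gamma_bw$ with $g_{b,w}\in K$, $b\in P$, $w\in W$. In $\mathcal A$ put $$\ddot G^+_{\tilde\alpha}=t_{\tilde\alpha}+\frac{t_{\tilde\alpha}-1}{X_{\tilde\alpha}^{-1}-1}(1-s_{\tilde\alpha})=f_{\tilde\alpha}+g_{\tilde\alpha}s_{\tilde\alpha},\qquad \ddot G^-_{\tilde\alpha}=1+\frac{t_{\tilde\alpha}-1}{1-X_{\tilde\alpha}}(1-s_{\tilde\alpha})=f_{\tilde\alpha}-s_{\tilde\alpha}g_{\tilde\alpha},$$ $$f_{\tilde\alpha}=\frac{t_{\tilde\alpha}X_{\tilde\alpha}^{-1}-1}{X_{\tilde\alpha}^{-1}-1},\qquad g_{\tilde\alpha}=\frac{t_{\tilde\alpha}-1}{1-X_{\tilde\alpha}^{-1}}.$$ A *product in the expansion* of a product of operators $\ddot G^{\pm}$ is obtained by choosing, in each factor, one of its two terms ($f_{\tilde\alpha}$ or $g_{\tilde\alpha}s_{\tilde\alpha}$ for $\ddot G^+_{\tilde\alpha}$; $f_{\tilde\alpha}$ or $-s_{\tilde\alpha}g_{\tilde\alpha}$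 for $\ddot G^-_{\tilde\alpha}$). *Spinors.* A spinor is a function $W\to K$, with pointwise operations; its value at $w$ is its $w$-component, and $\zeta_w$ is the characteristic function of $w$. On spinors $\Gamma_b$ acts pointwise, and $(\delta(v)f)(u)=f(v^{-1}u)$. Let $\phi$ be the algebra homomorphism sending $g\,\Gamma_b\,v$ to $\varrho(g)\varrho(\Gamma_b)\delta(v)$, where $\varrho(g)=\sum_ww^{-1}(g)\zeta_w$ and $\varrho(\Gamma_b)=\sum_w\Gamma_{w^{-1}(b)}\zeta_w$. For $\mathcal L\in\mathcal A$ let $\text{æ}^\delta(\mathcal L)$ be the conjugate of $\phi(\mathcal L)$ by the operator $X_{\rho_k}\Gamma_{-\rho_k}$ acting pointwise, where $q^{(\rho_k,a)}=\prod_\nu t_\nu^{(\rho^\vee_\nu,a)}$. That is, the conjugation acts on each component by the automorphism $X_a\mapsto\prod_\nu t_\nu^{-(\rho_\nu^\vee,a)}X_a$ of $K$ fixing $q$ and the $t_\nu$; it sends $\Gamma_b$ to $\prod_\nu t_\nu^{-(\rho_\nu^\vee,b)}\Gamma_b$, and it fixes all $\delta(v)$. *Orders.* For $\nu\in\nu_R$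 and $w\in W$, let $\mathrm{ord}_w^\nu$ of a spinor be the order of its $w$-component at $t_\nu=0$ (normalized so that $t_\nu$ has order $1$; the order of $0$ is $+\infty$). For a spinor difference operator $A=\sum_bf_b\Gamma_b$ with spinors $f_b$ put $\mathrm{ord}_w^\nu(A)=\min_b\mathrm{ord}_w^\nu(f_b)$, and for $v\in W$ put $\mathrm{ord}_w^\nu(A\delta(v))=\mathrm{ord}^\nu_w(A)={}^\dagger\mathrm{ord}_w^\nu(\delta(v)A)$. **Proposition 5.1.** Let $w\in W$ and $\nu\in\nu_R$. **A.** Let $u=s_{j_l}\cdots s_{j_1}$ be a reduced decomposition of $u\in W$ and let $1\le r\le p\le l$. 1. The $\mathrm{ord}_w^\nu$ of $\text{æ}^\delta$ of any product in the expansion of $\ddot G^+_{\alpha^p}\cdots\ddot G^+_{\alpha^r}$ is at least $\mathrm{ord}_w^\nu(\text{æ}^\delta(f_{\alpha^p}\cdots f_{\alpha^r}))$. 2. The $\mathrm{ord}_w^\nu$ of $\text{æ}^\delta$ of any product in the expansion of $\ddot G^+_{-\alpha^r}\cdots\ddot G^+_{-\alpha^p}$ is at least $\mathrm{ord}_w^\nu(\text{æ}^\delta(f_{-\alpha^r}\cdots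 f_{-\alpha^p}))$. 3. The ${}^\dagger\mathrm{ord}_w^\nu$ of $\text{æ}^\delta$ of any product in the expansion of $\ddot G^-_{\alpha^p}\cdots\ddot G^-_{\alpha^r}$ is at least $\mathrm{ord}_w^\nu(\text{æ}^\delta(f_{\alpha^p}\cdots f_{\alpha^r}))$. 4. The ${}^\dagger\mathrm{ord}_w^\nu$ of $\text{æ}^\delta$ of any product in the expansion of $\ddot G^-_{-\alpha^r}\cdots\ddot G^-_{-\alpha^p}$ is at least $\mathrm{ord}_w^\nu(\text{æ}^\delta(f_{-\alpha^r}\cdots f_{-\alpha^p}))$. **B.** Let $b=\pi s_{j_l}\cdots s_{j_1}$, $\pi\in\Pi$, be a reduced decomposition of $b\in P_+\subset\widehat W$ and let $1\le p\le l$. 1. The $\mathrm{ord}_w^\nu$ of $\text{æ}^\delta$ of any product in the expansion of $\ddot G^+_{\tilde\alpha^p}\cdots\ddot G^+_{\tilde\alpha^1}$ is at least $\mathrm{ord}_w^\nu(\text{æ}^\delta(f_{\tilde\alpha^p}\cdots f_{\tilde\alpha^1}))$. 2. The ${}^\dagger\mathrm{ord}_w^\nu$ of $\text{æ}^\delta$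 of any product in the expansion of $\ddot G^-_{-\tilde\alpha^1}\cdots\ddot G^-_{-\tilde\alpha^p}$ is at least $\mathrm{ord}_w^\nu(\text{æ}^\delta(f_{-\tilde\alpha^1}\cdots f_{-\tilde\alpha^p}))$. -/

import Mathlib

noncomputable section

namespace TodaDunkl

open scoped Classical

section Basics

variable {ι V N : Type*} [NormedAddCommGroup V] [InnerProductSpace ℝ V]
  [AddCommGroup N] [Module ℝ N] (P : RootPairing ι ℝ V N)

/-! ## The root system, its Euclidean form and its weight lattice -/

/-- The inner product of `V` is the Euclidean form `( , )` of the root system: it is invariant under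
the reflections, and it is normalized by `(α, α) = 2` for the short roots. -/
class NormalizedForm : Prop where
  inner_reflection : ∀ (i : ι) (x y : V),
    inner ℝ (P.reflection i x) (P.reflection i y) = inner ℝ x y
  two_le : ∀ i : ι, 2 ≤ inner ℝ (P.root i) (P.root i)
  exists_short : ∃ i : ι, inner ℝ (P.root i) (P.root i) = 2

/-- `ν_α = (α, α) / 2`. -/
def nu (i : ι) : ℝ := inner ℝ (P.root i) (P.root i) / 2

/-- The set `ν_R` of the values of `ν_α`. -/
abbrev NuR : Type := Set.range (nu P)

/-- `ν_α` as an element of `ν_R`. -/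
def nuR (i : ι) : NuR P := ⟨nu P i, i, rfl⟩

/-- The weight lattice: all `x` such that `(x, α^∨) ∈ ℤ` for every coroot `α^∨ = 2α/(α, α)`. -/
def weightLattice : AddSubgroup V where
  carrier := {x | ∀ i, ∃ n : ℤ, 2 * inner ℝ x (P.root i) / inner ℝ (P.root i) (P.root i) = n}
  zero_mem' := fun i => ⟨0, by simp⟩
  add_mem' := by
    intro x y hx hy i
    obtain ⟨m, hm⟩ := hx i
    obtain ⟨n, hn⟩ := hy i
    exact ⟨m + n, by rw [inner_add_left, mul_add, add_div, hm, hn]; push_cast; rfl⟩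
  neg_mem' := by
    intro x hx i
    obtain ⟨m, hm⟩ := hx i
    exact ⟨-m, by rw [inner_neg_left, mul_neg, neg_div, hm]; push_cast; rfl⟩

/-- The integer `(b, α^∨)` for a weight `b` and a root `α`. -/
def coPair (b : weightLattice P) (i : ι) : ℤ := (b.2 i).choose

lemma coPair_spec (b : weightLattice P) (i : ι) :
    2 * inner ℝ (b : V) (P.root i) / inner ℝ (P.root i) (P.root i) = (coPair P b i : ℝ) :=
  (b.2 i).choose_spec

lemma coPair_add (b c : weightLattice P) (i : ι) :
    coPair P (b + c) i = coPair P b i + coPair P c i := by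
  have h : ((coPair P (b + c) i : ℤ) : ℝ) = ((coPair P b i + coPair P c i : ℤ) : ℝ) := by
    push_cast
    rw [← coPair_spec, ← coPair_spec, ← coPair_spec]
    simp only [AddSubgroup.coe_add, inner_add_left]
    ring
  exact_mod_cast h

lemma inner_weyl [NormalizedForm P] (w : P.weylGroup) (x y : V) :
    inner ℝ (w • x) (w • y) = inner ℝ x y := by
  revert x y
  obtain ⟨g, hg⟩ := w
  induction hg using RootPairing.weylGroup.induction with
  | mem i => exact fun x y => NormalizedForm.inner_reflection i x y
  | one => intro x y; rfl
  | mul g₁ g₂ hg₁ hg₂ hg₁' hg₂' =>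
    intro x y
    rw [← Submonoid.mk_mul_mk _ _ _ hg₁ hg₂, mul_smul, mul_smul]
    exact (hg₁' _ _).trans (hg₂' _ _)

lemma weyl_root (w : P.weylGroup) (i : ι) : w • P.root i = P.root (w • i) :=
  P.weylGroup_apply_root w i

lemma inner_weyl_root [NormalizedForm P] (w : P.weylGroup) (x : V) (i : ι) :
    inner ℝ (w • x) (P.root (w • i)) = inner ℝ x (P.root i) := by
  rw [← weyl_root, inner_weyl]

lemma inner_root_weyl [NormalizedForm P] (w : P.weylGroup) (i : ι) :
    inner ℝ (P.root (w • i)) (P.root (w • i)) = inner ℝ (P.root i) (P.root i) := by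
  rw [← weyl_root, inner_weyl]

lemma weyl_mem [NormalizedForm P] (w : P.weylGroup) {x : V} (hx : x ∈ weightLattice P) :
    w • x ∈ weightLattice P := by
  intro i
  obtain ⟨n, hn⟩ := hx (w⁻¹ • i)
  refine ⟨n, ?_⟩
  rw [← hn, ← inner_weyl_root P w x, inner_root_weyl P w⁻¹ i, smul_inv_smul]

/-- The action of the Weyl group on the weight lattice. -/
instance [NormalizedForm P] : DistribMulAction P.weylGroup (weightLattice P) where
  smul w b := ⟨w • (b : V), weyl_mem P w b.2⟩
  one_smul b := Subtype.ext (one_smul _ (b : V))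
  mul_smul v w b := Subtype.ext (mul_smul v w (b : V))
  smul_zero w := Subtype.ext (smul_zero w)
  smul_add w b c := Subtype.ext (smul_add w (b : V) (c : V))

@[simp] lemma coe_weyl_smul [NormalizedForm P] (w : P.weylGroup) (b : weightLattice P) :
    ((w • b : weightLattice P) : V) = w • (b : V) := rfl

lemma coPair_weyl [NormalizedForm P] (w : P.weylGroup) (b : weightLattice P) (i : ι) :
    coPair P (w • b) (w • i) = coPair P b i := by
  have h : ((coPair P (w • b) (w • i) : ℤ) : ℝ) = (coPair P b i : ℝ) := by
    rw [← coPair_spec, ← coPair_spec, coe_weyl_smul, inner_weyl_root, inner_root_weyl]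
  exact_mod_cast h

lemma coPair_zero (i : ι) : coPair P 0 i = 0 := by
  have h := coPair_add P 0 0 i
  rw [add_zero] at h
  omega

lemma root_mem [P.IsCrystallographic] [NormalizedForm P] (i : ι) :
    P.root i ∈ weightLattice P := by
  intro j
  obtain ⟨n, hn⟩ := P.exists_value (S := ℤ) i j
  refine ⟨n, ?_⟩
  have h0 : inner ℝ (P.root j) (P.root j) ≠ 0 := by
    have := NormalizedForm.two_le (P := P) j
    linarith
  have h1 := NormalizedForm.inner_reflection (P := P) j (P.root i) (P.root j)
  rw [RootPairing.reflection_apply_self, RootPairing.reflection_apply_root, inner_neg_right,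
    inner_sub_left, inner_smul_left] at h1
  simp only [conj_trivial] at h1
  rw [div_eq_iff h0]
  have hn' : (n : ℝ) = P.pairing i j := by simpa using hn
  rw [hn']
  linarith

/-- A root as an element of the weight lattice. -/
def rootWt [P.IsCrystallographic] [NormalizedForm P] (i : ι) : weightLattice P :=
  ⟨P.root i, root_mem P i⟩

/-- The reflection `s_α` in the Weyl group. -/
abbrev refl (i : ι) : P.weylGroup := RootPairing.weylGroup.ofIdx P i

/-- The index of the root `-α`. -/
def negIdx (i : ι) : ι := P.reflectionPerm i i

instance [Finite ι] [P.IsRootSystem] : Finite P.weylGroup := by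
  refine Finite.of_injective (fun w : P.weylGroup => fun i : ι => w • i) ?_
  intro v w h
  apply Subtype.ext
  apply RootPairing.Equiv.weightHom_injective P
  apply LinearEquiv.toLinearMap_injective
  refine LinearMap.ext_on (RootPairing.IsRootSystem.span_root_eq_top (P := P)) ?_
  rintro - ⟨i, rfl⟩
  have h1 := weyl_root P v i
  have h2 := weyl_root P w i
  have h3 : v • i = w • i := congrFun h i
  rw [h3, ← h2] at h1
  exact h1

instance [Finite ι] [P.IsRootSystem] : Fintype P.weylGroup := Fintype.ofFinite _

/-! ## The extended affine Weyl group and the affine roots -/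

/-- The extended affine Weyl group `Ŵ = P ⋊ W`; the element `⟨b, w⟩` is the product `b w`. -/
@[ext] structure ExtAffWeyl where
  trans : weightLattice P
  lin : P.weylGroup

/-- An affine root; `⟨α, j⟩` stands for `[α, ν_α j]`. -/
@[ext] structure AffRoot (P : RootPairing ι ℝ V N) where
  idx : ι
  lvl : ℤ

variable [NormalizedForm P]

instance : Group (ExtAffWeyl P) where
  mul g h := ⟨g.trans + g.lin • h.trans, g.lin * h.lin⟩
  one := ⟨0, 1⟩
  inv g := ⟨-(g.lin⁻¹ • g.trans), g.lin⁻¹⟩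
  mul_assoc a b c := by
    apply ExtAffWeyl.ext
    · change a.trans + a.lin • b.trans + (a.lin * b.lin) • c.trans
        = a.trans + a.lin • (b.trans + b.lin • c.trans)
      rw [smul_add, mul_smul, add_assoc]
    · exact mul_assoc _ _ _
  one_mul a := by
    apply ExtAffWeyl.ext
    · change 0 + (1 : P.weylGroup) • a.trans = a.trans
      rw [one_smul, zero_add]
    · exact one_mul _
  mul_one a := by
    apply ExtAffWeyl.ext
    · change a.trans + a.lin • (0 : weightLattice P) = a.trans
      rw [smul_zero, add_zero]
    · exact mul_one _
  inv_mul_cancel a := by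
    apply ExtAffWeyl.ext
    · change -(a.lin⁻¹ • a.trans) + a.lin⁻¹ • a.trans = 0
      exact neg_add_cancel _
    · exact inv_mul_cancel _

@[simp] lemma mul_trans (g h : ExtAffWeyl P) : (g * h).trans = g.trans + g.lin • h.trans := rfl
@[simp] lemma mul_lin (g h : ExtAffWeyl P) : (g * h).lin = g.lin * h.lin := rfl
@[simp] lemma one_trans : (1 : ExtAffWeyl P).trans = 0 := rfl
@[simp] lemma one_lin : (1 : ExtAffWeyl P).lin = 1 := rfl

/-- `Ŵ` acts on the affine roots by `(b w)[z, ζ] = [w z, ζ - (w z, b)]`; here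
`(α, b) = ν_α (b, α^∨)`. -/
instance : MulAction (ExtAffWeyl P) (AffRoot P) where
  smul g a := ⟨g.lin • a.idx, a.lvl - coPair P g.trans (g.lin • a.idx)⟩
  one_smul a := by
    apply AffRoot.ext
    · exact one_smul _ _
    · change a.lvl - coPair P 0 _ = a.lvl
      rw [coPair_zero, sub_zero]
  mul_smul g h a := by
    apply AffRoot.ext
    · exact mul_smul g.lin h.lin a.idx
    · change a.lvl - coPair P (g.trans + g.lin • h.trans) ((g.lin * h.lin) • a.idx)
        = a.lvl - coPair P h.trans (h.lin • a.idx)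
          - coPair P g.trans (g.lin • h.lin • a.idx)
      rw [mul_smul, coPair_add, coPair_weyl]
      ring

/-- The reflection `s_α̃` for `α̃ = [α, ν_α j]`, that is `z̃ ↦ z̃ - (z, α^∨) α̃`. -/
def affRefl [P.IsCrystallographic] (a : AffRoot P) : ExtAffWeyl P :=
  ⟨-(a.lvl • rootWt P a.idx), refl P a.idx⟩

/-- The affine root `-α̃`. -/
def AffRoot.neg {P : RootPairing ι ℝ V N} (a : AffRoot P) : AffRoot P := ⟨negIdx P a.idx, -a.lvl⟩

/-- A root `α` viewed as the affine root `[α, 0]`. -/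
def AffRoot.ofRoot (i : ι) : AffRoot P := ⟨i, 0⟩

end Basics

section Words

/-! ## Words, reduced decompositions and `λ`-sequences -/

/-- The product `h p * h (p - 1) * ⋯ * h r`. -/
def descProd {M : Type*} [Monoid M] (h : ℕ → M) (p r : ℕ) : M :=
  ((List.range' r (p + 1 - r)).reverse.map h).prod

/-- The product `h r * h (r + 1) * ⋯ * h p`. -/
def ascProd {M : Type*} [Monoid M] (h : ℕ → M) (r p : ℕ) : M :=
  ((List.range' r (p + 1 - r)).map h).prod

variable {S G X : Type*} [Group G]

/-- The product `s_{j_l} ⋯ s_{j_1}`. -/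
def wordProd (s : S → G) (j : ℕ → S) (l : ℕ) : G := descProd (fun i => s (j i)) l 1

/-- `g = s_{j_l} ⋯ s_{j_1}` and no product of fewer than `l` of the generators is equal to `g`. -/
def IsReducedDecomposition (s : S → G) (g : G) (j : ℕ → S) (l : ℕ) : Prop :=
  g = wordProd s j l ∧ ∀ (j' : ℕ → S) (l' : ℕ), g = wordProd s j' l' → l ≤ l'

/-- The `i`-th member `s_{j_1} ⋯ s_{j_{i-1}} (α_{j_i})` of the `λ`-sequence, `i = 1, 2, …`, where
`a j` is the simple root of the generator `s j`. -/
def lambdaSeq [MulAction G X] (s : S → G) (a : S → X) (j : ℕ → S) (i : ℕ) : X :=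
  ascProd (fun k => s (j k)) 1 (i - 1) • a (j i)

end Words

section Simple

variable {ι V N : Type*} [NormedAddCommGroup V] [InnerProductSpace ℝ V]
  [AddCommGroup N] [Module ℝ N] {P : RootPairing ι ℝ V N} (Δ : P.Base)

/-- The simple reflections `s_1, …, s_n` of the Weyl group. -/
def simpleRefl (i : Δ.support) : P.weylGroup := refl P i

/-- `ϑ` is the maximal short root: it is short, and for every short root `α` the difference `ϑ - α`
is a sum of simple roots. -/
def IsMaximalShortRoot (ϑ : ι) : Prop :=
  nu P ϑ = 1 ∧
    ∀ i, nu P i = 1 → P.root ϑ - P.root i ∈ AddSubmonoid.closure (P.root '' Δ.support)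

/-- The affine simple roots: `α_0 = [-ϑ, 1]` (for `none`) and `α_1, …, α_n`. -/
def affSimple (ϑ : ι) : Option Δ.support → AffRoot P
  | none => ⟨negIdx P ϑ, 1⟩
  | some i => AffRoot.ofRoot P i

/-- The integer `(2 ρ_ν^∨, b)`, the sum of `(b, α^∨)` over the positive `α` with `ν_α = ν`. -/
def twoRho [Fintype ι] (ν : NuR P) (b : weightLattice P) : ℤ :=
  ∑ i with Δ.IsPos i ∧ nuR P i = ν, coPair P b i

lemma twoRho_add [Fintype ι] (ν : NuR P) (b c : weightLattice P) :
    twoRho Δ ν (b + c) = twoRho Δ ν b + twoRho Δ ν c := by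
  simp only [twoRho, coPair_add, Finset.sum_add_distrib]

variable [NormalizedForm P]

/-- The affine simple reflections `s_0, …, s_n`. -/
def affSimpleRefl [P.IsCrystallographic] (ϑ : ι) (i : Option Δ.support) : ExtAffWeyl P :=
  affRefl P (affSimple Δ ϑ i)

/-- The group `Π = {π_r}`: the elements of `Ŵ` that permute the affine simple roots. -/
def diagramGroup (ϑ : ι) : Set (ExtAffWeyl P) :=
  {g | (fun a => g • a) '' Set.range (affSimple Δ ϑ) = Set.range (affSimple Δ ϑ)}

/-- `b ∈ P_+`. -/
def IsDominant (b : weightLattice P) : Prop := ∀ i ∈ Δ.support, 0 ≤ coPair P b i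

end Simple

section Field

/-! ## The field of rational functions -/

variable {ι V N : Type*} [NormedAddCommGroup V] [InnerProductSpace ℝ V]
  [AddCommGroup N] [Module ℝ N] (P : RootPairing ι ℝ V N)

/-- The group of exponents of `q`, generated by all `(a, b) / 2` for `a, b ∈ P`. It is `(1/2m) ℤ`
when `(P, P) = (1/m) ℤ`. -/
def qExp : AddSubgroup ℝ :=
  AddSubgroup.closure {r | ∃ a b : weightLattice P, r = inner ℝ (a : V) (b : V) / 2}

lemma inner_mem_qExp (a b : weightLattice P) : inner ℝ (a : V) (b : V) ∈ qExp P := by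
  have h : inner ℝ (a : V) (b : V) / 2 ∈ qExp P := AddSubgroup.subset_closure ⟨a, b, rfl⟩
  have h2 := (qExp P).add_mem h h
  rwa [add_halves] at h2

/-- `(a, b)` as an exponent of `q`. -/
def qInner (a b : weightLattice P) : qExp P := ⟨inner ℝ (a : V) (b : V), inner_mem_qExp P a b⟩

lemma nu_mem_qExp [P.IsCrystallographic] [NormalizedForm P] (i : ι) : nu P i ∈ qExp P :=
  AddSubgroup.subset_closure ⟨rootWt P i, rootWt P i, rfl⟩

/-- Exponents of the monomials `q^r ∏_ν (t_ν^{1/2})^{d_ν} X_a`: the triples `(r, d, a)`. -/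
abbrev Expo : Type _ := qExp P × (NuR P → ℤ) × weightLattice P

/-- Laurent polynomials over `ℚ` in `q^{1/(2m)}`, `t_ν^{1/2}` and `X_b`, `b ∈ P`. -/
abbrev Laurent : Type _ := AddMonoidAlgebra ℚ (Expo P)

instance : TwoUniqueSums (Expo P) := by
  let f : Expo P →+ ℝ × (NuR P → ℝ) × V :=
    { toFun := fun e => ((e.1 : ℝ), (fun ν => (e.2.1 ν : ℝ)), (e.2.2 : V))
      map_zero' := by ext <;> simp
      map_add' := by intro x y; ext <;> simp }
  let _ : Module ℚ (ℝ × (NuR P → ℝ) × V) := Module.compHom _ (algebraMap ℚ ℝ)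
  refine TwoUniqueSums.of_injective_addHom f.toAddHom ?_ inferInstance
  rintro ⟨a, b, c⟩ ⟨a', b', c'⟩ h
  have h' : ((a : ℝ), (fun ν => (b ν : ℝ)), (c : V))
    = ((a' : ℝ), (fun ν => (b' ν : ℝ)), (c' : V)) := h
  simp only [Prod.mk.injEq] at h'
  obtain ⟨h1, h2, h3⟩ := h'
  refine Prod.ext (Subtype.ext h1) (Prod.ext ?_ (Subtype.ext h3))
  funext ν
  exact_mod_cast congrFun h2 ν

instance : IsDomain (Laurent P) := NoZeroDivisors.to_isDomain _

/-- The field `ℚ(q^{1/(2m)}, t_ν^{1/2})(X)`. -/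
def RatField : Type _ := FractionRing (Laurent P)

instance : Field (RatField P) := inferInstanceAs (Field (FractionRing (Laurent P)))
instance : Algebra (Laurent P) (RatField P) :=
  inferInstanceAs (Algebra (Laurent P) (FractionRing (Laurent P)))
instance : IsFractionRing (Laurent P) (RatField P) :=
  inferInstanceAs (IsFractionRing (Laurent P) (FractionRing (Laurent P)))

/-- A monomial as an element of the field. -/
def monomial (e : Expo P) : RatField P :=
  algebraMap (Laurent P) (RatField P) (AddMonoidAlgebra.single e 1)

/-- The automorphism of the field over `ℚ` that acts on the monomials by an automorphism of the
group of exponents. -/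
def monAut (σ : Expo P ≃+ Expo P) : RatField P ≃+* RatField P :=
  IsFractionRing.ringEquivOfRingEquiv (AddMonoidAlgebra.mapDomainRingEquiv ℚ σ)

lemma monAut_refl (x : RatField P) : monAut P (AddEquiv.refl _) x = x := by
  have h : AddMonoidAlgebra.mapDomainRingEquiv ℚ (AddEquiv.refl (Expo P)) = RingEquiv.refl _ := by
    ext x
    simp [AddMonoidAlgebra.coeff_mapDomainRingEquiv]
  rw [monAut, h, IsFractionRing.ringEquivOfRingEquiv_refl]
  rfl

lemma monAut_trans (σ τ : Expo P ≃+ Expo P) (x : RatField P) :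
    monAut P (σ.trans τ) x = monAut P τ (monAut P σ x) := by
  have h : AddMonoidAlgebra.mapDomainRingEquiv ℚ (σ.trans τ)
      = (AddMonoidAlgebra.mapDomainRingEquiv ℚ σ).trans
        (AddMonoidAlgebra.mapDomainRingEquiv ℚ τ) := by
    ext x
    simp [AddMonoidAlgebra.coeff_mapDomainRingEquiv]
  rw [monAut, h, IsFractionRing.ringEquivOfRingEquiv_comp (RatField P) (RatField P)]
  rfl

variable {P}

lemma monomial_add (e f : Expo P) : monomial P (e + f) = monomial P e * monomial P f := by
  rw [monomial, monomial, monomial, ← map_mul, AddMonoidAlgebra.single_mul_single, one_mul]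

lemma monomial_zero : monomial P 0 = 1 := by
  rw [monomial, ← AddMonoidAlgebra.one_def, map_one]

lemma monomial_injective : Function.Injective (monomial P) := by
  intro e f h
  have h1 := IsFractionRing.injective (Laurent P) (RatField P) h
  exact AddMonoidAlgebra.of_injective h1

variable (P)

variable [NormalizedForm P]

/-- The action of `Ŵ` on exponents: `(b w)(X_a) = q^{-(w a, b)} X_{w a}`. -/
instance : DistribMulAction (ExtAffWeyl P) (Expo P) where
  smul g e := (e.1 - qInner P (g.lin • e.2.2) g.trans, e.2.1, g.lin • e.2.2)
  one_smul e := by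
    refine Prod.ext (Subtype.ext ?_) (Prod.ext rfl (one_smul _ _))
    change (e.1 : ℝ) - inner ℝ (((1 : P.weylGroup) • e.2.2 : weightLattice P) : V) (0 : V) = e.1
    rw [inner_zero_right, sub_zero]
  mul_smul g h e := by
    refine Prod.ext (Subtype.ext ?_) (Prod.ext rfl (mul_smul g.lin h.lin _))
    change (e.1 : ℝ) - inner ℝ ((g.lin * h.lin) • (e.2.2 : V))
        ((g.trans : V) + g.lin • (h.trans : V))
      = (e.1 : ℝ) - inner ℝ (h.lin • (e.2.2 : V)) (h.trans : V)
        - inner ℝ (g.lin • h.lin • (e.2.2 : V)) (g.trans : V)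
    rw [mul_smul, inner_add_right, inner_weyl]
    ring
  smul_zero g := by
    refine Prod.ext (Subtype.ext ?_) (Prod.ext rfl (smul_zero _))
    change (0 : ℝ) - inner ℝ (g.lin • (0 : V)) (g.trans : V) = 0
    rw [smul_zero, inner_zero_left, sub_zero]
  smul_add g e f := by
    refine Prod.ext (Subtype.ext ?_) (Prod.ext rfl (smul_add _ _ _))
    change (e.1 : ℝ) + f.1 - inner ℝ (g.lin • ((e.2.2 : V) + (f.2.2 : V))) (g.trans : V)
      = ((e.1 : ℝ) - inner ℝ (g.lin • (e.2.2 : V)) (g.trans : V))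
        + ((f.1 : ℝ) - inner ℝ (g.lin • (f.2.2 : V)) (g.trans : V))
    rw [smul_add, inner_add_left]
    ring

/-- The action of `Ŵ` on the field. -/
instance : MulSemiringAction (ExtAffWeyl P) (RatField P) where
  smul g x := monAut P (DistribMulAction.toAddEquiv (Expo P) g) x
  one_smul x := by
    have h : DistribMulAction.toAddEquiv (Expo P) (1 : ExtAffWeyl P) = AddEquiv.refl _ := by
      apply AddEquiv.ext
      intro e
      exact one_smul (ExtAffWeyl P) e
    change monAut P _ x = x
    rw [h, monAut_refl]
  mul_smul g h x := by
    have h' : DistribMulAction.toAddEquiv (Expo P) (g * h)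
        = (DistribMulAction.toAddEquiv (Expo P) h).trans
          (DistribMulAction.toAddEquiv (Expo P) g) := by
      apply AddEquiv.ext
      intro e
      exact mul_smul g h e
    change monAut P _ x = monAut P _ (monAut P _ x)
    rw [h', monAut_trans]
  smul_zero g := map_zero (monAut P _)
  smul_add g := map_add (monAut P _)
  smul_one g := map_one (monAut P _)
  smul_mul g := map_mul (monAut P _)

lemma smul_monomial (g : ExtAffWeyl P) (e : Expo P) :
    g • monomial P e = monomial P (g • e) := by
  change IsFractionRing.ringEquivOfRingEquiv _ (algebraMap _ _ _) = _
  rw [IsFractionRing.ringEquivOfRingEquiv_algebraMap, AddMonoidAlgebra.mapDomainRingEquiv_single]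
  rfl

end Field

section Operators

/-! ## Difference-reflection operators and the binomials `G̈^±` -/

variable {ι V N : Type*} [NormedAddCommGroup V] [InnerProductSpace ℝ V]
  [AddCommGroup N] [Module ℝ N] (P : RootPairing ι ℝ V N) [NormalizedForm P]

/-- The algebra `𝒜` of difference-reflection operators: the sums of `g ŵ` with `g` in the field and
`ŵ ∈ Ŵ`, multiplied by the rule `ŵ g = ŵ(g) ŵ`. The difference operator `Γ_b` is the element `-b` of
`Ŵ`, so that `Γ_b X_a = q^{(a, b)} X_a Γ_b`. -/
abbrev DiffRefl : Type _ := SkewMonoidAlgebra (RatField P) (ExtAffWeyl P)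

variable {P}

/-- A function as an operator. -/
def func (x : RatField P) : DiffRefl P := SkewMonoidAlgebra.single 1 x

/-- An element of `Ŵ` as an operator. -/
def grp (g : ExtAffWeyl P) : DiffRefl P := SkewMonoidAlgebra.single g 1

lemma func_mul_grp (x : RatField P) (g : ExtAffWeyl P) :
    func x * grp g = SkewMonoidAlgebra.single g x := by
  rw [func, grp, SkewMonoidAlgebra.single_mul_single, one_mul, one_smul, mul_one]

lemma grp_mul_func (x : RatField P) (g : ExtAffWeyl P) :
    grp g * func x = SkewMonoidAlgebra.single g (g • x) := by
  rw [func, grp, SkewMonoidAlgebra.single_mul_single, one_mul, mul_one]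

/-- `t_α = t_{ν_α}`, the square of the variable `t_ν^{1/2}`. -/
def tvar (i : ι) : RatField P := monomial P (0, Pi.single (nuR P i) 2, 0)

variable [P.IsCrystallographic]

/-- `X_α̃ = X_α q^{ν_α j}` for `α̃ = [α, ν_α j]`. -/
def Xvar (a : AffRoot P) : RatField P :=
  monomial P (a.lvl • ⟨nu P a.idx, nu_mem_qExp P a.idx⟩, 0, rootWt P a.idx)

/-- `f_α̃ = (t_α X_α̃⁻¹ - 1) / (X_α̃⁻¹ - 1)`. -/
def fFun (a : AffRoot P) : RatField P := (tvar a.idx * (Xvar a)⁻¹ - 1) / ((Xvar a)⁻¹ - 1)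

/-- `g_α̃ = (t_α - 1) / (1 - X_α̃⁻¹)`. -/
def gFun (a : AffRoot P) : RatField P := (tvar a.idx - 1) / (1 - (Xvar a)⁻¹)

/-- `G̈_α̃^+ = t_α^{1/2} G_α̃^+ = t_α + (t_α - 1) / (X_α̃⁻¹ - 1) (1 - s_α̃)`. -/
def ddotGPlus (a : AffRoot P) : DiffRefl P :=
  func (tvar a.idx) + func ((tvar a.idx - 1) / ((Xvar a)⁻¹ - 1)) * (1 - grp (affRefl P a))

/-- `G̈_α̃^- = t_α^{1/2} G_α̃^- = 1 + (t_α - 1) / (1 - X_α̃) (1 - s_α̃)`. -/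
def ddotGMinus (a : AffRoot P) : DiffRefl P :=
  1 + func ((tvar a.idx - 1) / (1 - Xvar a)) * (1 - grp (affRefl P a))

/-- The two terms of `G̈_α̃^+ = f_α̃ + g_α̃ s_α̃`. -/
def plusTerm (a : AffRoot P) : Bool → DiffRefl P
  | false => func (fFun a)
  | true => func (gFun a) * grp (affRefl P a)

/-- The two terms of `G̈_α̃^- = f_α̃ - s_α̃ g_α̃`. -/
def minusTerm (a : AffRoot P) : Bool → DiffRefl P
  | false => func (fFun a)
  | true => -(grp (affRefl P a) * func (gFun a))

lemma Xvar_ne_one (a : AffRoot P) : Xvar a ≠ 1 := by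
  rw [← monomial_zero]
  intro h
  have h1 := congrArg (fun e : Expo P => (e.2.2 : V)) (monomial_injective h)
  have h2 : P.root a.idx = 0 := h1
  have h3 := NormalizedForm.two_le (P := P) a.idx
  rw [h2, inner_zero_left] at h3
  linarith

lemma Xvar_ne_zero (a : AffRoot P) : Xvar a ≠ 0 := by
  intro h
  have h1 := IsFractionRing.injective (Laurent P) (RatField P) (h.trans (map_zero _).symm)
  exact one_ne_zero (AddMonoidAlgebra.single_eq_zero.mp h1)

lemma affRefl_smul_tvar (a : AffRoot P) (i : ι) : affRefl P a • (tvar i : RatField P) = tvar i := by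
  rw [tvar, smul_monomial]
  congr 1
  refine Prod.ext (Subtype.ext ?_) (Prod.ext rfl (smul_zero _))
  change (0 : ℝ) - inner ℝ (refl P a.idx • (0 : V)) _ = 0
  rw [smul_zero, inner_zero_left, sub_zero]

lemma affRefl_smul_Xvar (a : AffRoot P) : affRefl P a • Xvar a = (Xvar a)⁻¹ := by
  refine eq_inv_of_mul_eq_one_left ?_
  rw [Xvar, smul_monomial, ← monomial_add, ← monomial_zero]
  congr 1
  have hr : refl P a.idx • P.root a.idx = -P.root a.idx :=
    RootPairing.reflection_apply_self P a.idx
  refine Prod.ext (Subtype.ext ?_) (Prod.ext (add_zero _) (Subtype.ext ?_))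
  · change ((a.lvl • (⟨nu P a.idx, nu_mem_qExp P a.idx⟩ : qExp P) : qExp P) : ℝ)
      - inner ℝ (refl P a.idx • P.root a.idx)
        ((-(a.lvl • rootWt P a.idx) : weightLattice P) : V)
      + ((a.lvl • (⟨nu P a.idx, nu_mem_qExp P a.idx⟩ : qExp P) : qExp P) : ℝ) = 0
    rw [hr]
    have h4 : ((-(a.lvl • rootWt P a.idx) : weightLattice P) : V)
      = -((a.lvl : ℝ) • P.root a.idx) := by
      simp only [rootWt, AddSubgroup.coe_neg, AddSubgroup.coe_zsmul, Int.cast_smul_eq_zsmul]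
    rw [h4, inner_neg_left, inner_neg_right, inner_smul_right]
    simp only [AddSubgroup.coe_zsmul, zsmul_eq_mul, nu]
    ring
  · change refl P a.idx • P.root a.idx + P.root a.idx = 0
    rw [hr, neg_add_cancel]

lemma ddotGPlus_eq (a : AffRoot P) : ddotGPlus a = plusTerm a false + plusTerm a true := by
  have h0 := Xvar_ne_zero a
  have h1 : 1 - Xvar a ≠ 0 := sub_ne_zero.mpr (Xvar_ne_one a).symm
  have h2 : (Xvar a)⁻¹ - 1 ≠ 0 := by
    rw [sub_ne_zero]
    exact fun h => Xvar_ne_one a (inv_eq_one.mp h)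
  have h3 : 1 - (Xvar a)⁻¹ ≠ 0 := by
    rw [← neg_sub]
    exact neg_ne_zero.mpr h2
  rw [ddotGPlus, mul_sub, mul_one, func_mul_grp, plusTerm, plusTerm, func_mul_grp, ← add_sub_assoc,
    func, func, func, ← SkewMonoidAlgebra.single_add, sub_eq_add_neg,
    ← SkewMonoidAlgebra.single_neg]
  congr 2
  · rw [fFun]
    field_simp
    ring
  · rw [gFun, ← div_neg, neg_sub]

lemma ddotGMinus_eq (a : AffRoot P) : ddotGMinus a = minusTerm a false + minusTerm a true := by
  have h0 := Xvar_ne_zero a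
  have h1 : 1 - Xvar a ≠ 0 := sub_ne_zero.mpr (Xvar_ne_one a).symm
  have h2 : (Xvar a)⁻¹ - 1 ≠ 0 := by
    rw [sub_ne_zero]
    exact fun h => Xvar_ne_one a (inv_eq_one.mp h)
  rw [ddotGMinus, mul_sub, mul_one, func_mul_grp, minusTerm, minusTerm, grp_mul_func,
    ← add_sub_assoc, SkewMonoidAlgebra.one_def,
    func, func, ← SkewMonoidAlgebra.single_add, sub_eq_add_neg]
  congr 2
  · rw [fFun, eq_div_iff h2]
    field_simp
    ring
  · congr 1
    rw [gFun, div_eq_mul_inv (tvar a.idx - 1) (1 - (Xvar a)⁻¹), smul_mul', smul_inv'', smul_sub,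
      smul_sub, smul_one, affRefl_smul_tvar, smul_inv'', affRefl_smul_Xvar, inv_inv, div_eq_mul_inv]

end Operators

section Spinors

/-! ## Spinors and the Ruijsenaars–Etingof conjugation -/

variable {ι V N : Type*} [NormedAddCommGroup V] [InnerProductSpace ℝ V]
  [AddCommGroup N] [Module ℝ N] (P : RootPairing ι ℝ V N)

/-- `W`-spinors with values in the field: functions on `W` with the pointwise operations. -/
def Spin : Type _ := P.weylGroup → RatField P

instance : CommRing (Spin P) := inferInstanceAs (CommRing (P.weylGroup → RatField P))

/-- The group of the products `Γ_b δ(v)` acting on spinors; the pair `(b, v)` is `Γ_b δ(v)`. -/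
abbrev SpinGrp : Type _ := Multiplicative (weightLattice P) × P.weylGroup

variable [NormalizedForm P]

/-- `Γ_b` acts on spinors pointwise, and `(δ(v) f)(u) = f(v⁻¹ u)`. -/
instance : MulSemiringAction (SpinGrp P) (Spin P) where
  smul x f := fun u => (⟨-x.1.toAdd, 1⟩ : ExtAffWeyl P) • f (x.2⁻¹ * u)
  one_smul f := by
    funext u
    change (⟨-0, 1⟩ : ExtAffWeyl P) • f (1⁻¹ * u) = f u
    rw [inv_one, one_mul, neg_zero]
    exact one_smul _ _
  mul_smul x y f := by
    funext u
    change (⟨-(x.1.toAdd + y.1.toAdd), 1⟩ : ExtAffWeyl P) • f ((x.2 * y.2)⁻¹ * u)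
      = (⟨-x.1.toAdd, 1⟩ : ExtAffWeyl P) • (⟨-y.1.toAdd, 1⟩ : ExtAffWeyl P) •
        f (y.2⁻¹ * (x.2⁻¹ * u))
    rw [← mul_smul, mul_inv_rev, mul_assoc]
    congr 1
    apply ExtAffWeyl.ext
    · change -(x.1.toAdd + y.1.toAdd) = -x.1.toAdd + (1 : P.weylGroup) • -y.1.toAdd
      rw [one_smul, neg_add]
    · exact (one_mul _).symm
  smul_zero x := by
    funext u
    exact smul_zero (⟨-x.1.toAdd, 1⟩ : ExtAffWeyl P)
  smul_add x f g := by
    funext u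
    exact smul_add (⟨-x.1.toAdd, 1⟩ : ExtAffWeyl P) _ _
  smul_one x := by
    funext u
    exact smul_one (⟨-x.1.toAdd, 1⟩ : ExtAffWeyl P)
  smul_mul x f g := by
    funext u
    exact smul_mul' (⟨-x.1.toAdd, 1⟩ : ExtAffWeyl P) _ _

/-- Spinor difference-reflection operators: the sums of `f Γ_b δ(v)` with a spinor `f`. -/
abbrev SpinDiffRefl : Type _ := SkewMonoidAlgebra (Spin P) (SpinGrp P)

variable {P}

/-- The idempotent `ζ_w`, the characteristic function of `w`. -/
def zeta (w : P.weylGroup) : Spin P := fun u => if u = w then 1 else 0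

/-- The spinor `ϱ(g) = ∑_w w⁻¹(g) ζ_w`. -/
def rhoSpin (g : RatField P) : Spin P := fun w => (⟨0, w⁻¹⟩ : ExtAffWeyl P) • g

/-- `ϱ(g)` as a multiplication operator. -/
def rhoFun (g : RatField P) : SpinDiffRefl P := SkewMonoidAlgebra.single 1 (rhoSpin g)

/-- `ϱ(Γ_b) = ∑_w Γ_{w⁻¹(b)} ζ_w`. -/
def rhoGamma [Finite ι] [P.IsRootSystem] (b : weightLattice P) : SpinDiffRefl P :=
  ∑ w : P.weylGroup, SkewMonoidAlgebra.single (Multiplicative.ofAdd (w⁻¹ • b), 1) (zeta w)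

/-- The operator `δ(v)`. -/
def deltaW (v : P.weylGroup) : SpinDiffRefl P := SkewMonoidAlgebra.single (1, v) 1

/-- The action `ϕ : g Γ_b w ↦ ϱ(g) ϱ(Γ_b) δ(w)` of `𝒜` on spinors. -/
def phi [Finite ι] [P.IsRootSystem] (A : DiffRefl P) : SpinDiffRefl P :=
  A.sum fun x g => rhoFun g * rhoGamma (-x.trans) * deltaW x.lin

/-- The effect of `Γ_{-ρ_k}` on exponents: `X_a ↦ q^{-(ρ_k, a)} X_a`, where
`q^{(ρ_k, a)} = ∏_ν t_ν^{(ρ_ν^∨, a)}`. -/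
def rhoShift [Fintype ι] (Δ : P.Base) : Expo P ≃+ Expo P where
  toFun e := (e.1, fun ν => e.2.1 ν - twoRho Δ ν e.2.2, e.2.2)
  invFun e := (e.1, fun ν => e.2.1 ν + twoRho Δ ν e.2.2, e.2.2)
  left_inv e := by simp
  right_inv e := by simp
  map_add' e f := by
    refine Prod.ext rfl (Prod.ext ?_ rfl)
    funext ν
    change e.2.1 ν + f.2.1 ν - twoRho Δ ν (e.2.2 + f.2.2)
      = (e.2.1 ν - twoRho Δ ν e.2.2) + (f.2.1 ν - twoRho Δ ν f.2.2)
    rw [twoRho_add]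
    ring

/-- The spinor `q^{-(ρ_k, b)} Γ_{-ρ_k}(f)`. -/
def shiftSpin [Fintype ι] (Δ : P.Base) (b : weightLattice P) (f : Spin P) : Spin P :=
  fun u => monomial P (0, fun ν => -twoRho Δ ν b, 0) * monAut P (rhoShift Δ) (f u)

/-- Conjugation by `δ(X_{ρ_k} Γ_{-ρ_k})`: it sends `f ∈ Spin` to `Γ_{-ρ_k}(f)` (pointwise) and `Γ_b`
to `q^{-(ρ_k, b)} Γ_b`, and it fixes all `δ(v)`. -/
def conjRho [Fintype ι] (Δ : P.Base) (A : SpinDiffRefl P) : SpinDiffRefl P :=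
  A.sum fun x f => SkewMonoidAlgebra.single x (shiftSpin Δ x.1.toAdd f)

/-- `æ^δ(L)`, the conjugation of `ϕ(L)` by `δ(X_{ρ_k} Γ_{-ρ_k})`. -/
def aeDelta [Fintype ι] [P.IsRootSystem] (Δ : P.Base) (A : DiffRefl P) : SpinDiffRefl P :=
  conjRho Δ (phi A)

/-! ## Orders with respect to `t_ν` -/

/-- The lowest exponent of `t_ν^{1/2}` in a nonzero Laurent polynomial. -/
def laurentOrd (ν : NuR P) (p : Laurent P) : ℤ :=
  (p.coeff.support.inf fun e => ((e.2.1 ν : ℤ) : WithTop ℤ)).untopD 0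

/-- The order of a rational function at `t_ν = 0`, normalized by giving `t_ν` the order `1`; the
order of `0` is `⊤`. -/
def tOrd (ν : NuR P) (x : RatField P) : WithTop ℚ :=
  if x = 0 then ⊤ else
    (((laurentOrd ν (IsLocalization.sec (nonZeroDivisors (Laurent P)) x).1
      - laurentOrd ν (IsLocalization.sec (nonZeroDivisors (Laurent P)) x).2 : ℤ) : ℚ) / 2 : ℚ)

/-- `ord_w^ν(A v) = ord_w^ν(A)` for a spinor difference operator `A = ∑_b f_b Γ_b`, where
`ord_w^ν(A)` is the least order of the `w`-components of the coefficients `f_b`. -/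
def ordW (w : P.weylGroup) (ν : NuR P) (A : SpinDiffRefl P) : WithTop ℚ :=
  A.support.inf fun x => tOrd ν (A.coeff x w)

/-- `†ord_w^ν(v A) = ord_w^ν(A)` for a spinor difference operator `A = ∑_b f_b Γ_b`. Since
`δ(v) f_b Γ_b = (δ(v) f_b) Γ_b δ(v)`, the `w`-component of `f_b` is the `v w`-component of the
coefficient of `Γ_b δ(v)`. -/
def dagOrdW (w : P.weylGroup) (ν : NuR P) (A : SpinDiffRefl P) : WithTop ℚ :=
  A.support.inf fun x => tOrd ν (A.coeff x (x.2 * w))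

end Spinors

end TodaDunkl
end

open TodaDunkl

noncomputable section

namespace TodaDunkl

open scoped Classical
open RootPairing

set_option linter.unusedSectionVars false

/-! ### Finite root system: symmetries, inversions of reflections, and the finite inequality. -/

section RootCombinatorics

variable {ι V N : Type*} [Fintype ι] [NormedAddCommGroup V] [InnerProductSpace ℝ V]
  [AddCommGroup N] [Module ℝ N] {P : RootPairing ι ℝ V N} [P.IsCrystallographic]
  [NormalizedForm P]

/-! A product of chosen terms is one function times one element of `Ŵ`. The `w`-component of its
image under `æ^δ` therefore has a single nonzero coefficient, whose order is a sum over the factors.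
Let `θ` be the symmetry by which the component acts on the roots (initially `w⁻¹`), and measure
orders in `t_ν^{1/2}`. After the conjugation, `X_α̃` has order `-(2ρ_ν^∨, θα)`. Since `(2ρ_ν^∨, γ) ≥
2` for positive `γ` of length `ν`, the term `f_α̃` costs `2` if `θα` is negative of length `ν`, and
`0` otherwise. The term `g_α̃ s_α̃` with `α̃ = [α, ν_α j]` costs `max(0, -(2ρ_ν^∨, θα)) - j (2ρ_ν^∨,
θα)`, the last summand coming from the translation in `s_α̃`, and it replaces `θ` by `θ s_α` for the
factors that follow. This is `pathCost`. For the terms of `G̈^-` the `†`-order gives the same rule,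
read from the right and with `j` replaced by `-j`.

The claim is thus that choosing `f` everywhere minimizes the cost (`pathCost_false_le`). By
induction all later choices may be taken to be `f`, so a single reflection in a root `β` has to be
compared with `f_β`. The roots after `β` form the inversion set `L` of some `u` for which `u β` is
simple, and choosing `f` on `L` costs twice the number of roots of length `ν` in `L` made negative
by `θ`. Passing from `θ` to `θ s_β` changes this cost by a sum of signs over the inversions of `s_β`
other than `β` (`two_mul_negCount_sub`). Counting the levels of these inversions and pairing
opposite roots makes the sum explicit (`two_mul_sum_reflInversions`); its part linear in `j` is
exactly what the translation contributes to the cost. What remains is an inequality in the finite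
root system (`two_mul_nuInd_add_min_le`), which rests on the fact that `(2ρ_ν^∨, γ)` exceeds the
number of inversions of `s_γ` of length `ν`, by at least one if `γ` itself has length `ν`.

Up to a symmetry of the roots (an element of `W`, possibly times `-1`), the sequences in the theorem
are such lists of inversions, by the exchange condition. The finite inequality needs roots with
positive nonaffine part. In the affine case this follows from the dominance of `b`, because `Π`
preserves the positive affine roots. -/

lemma coPair_rootWt (i j : ι) : coPair P (rootWt P i) j = P.pairingIn ℤ i j := by
  have h0 : inner ℝ (P.root j) (P.root j) ≠ 0 := by
    have := NormalizedForm.two_le (P := P) j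
    linarith
  have h1 := NormalizedForm.inner_reflection (P := P) j (P.root i) (P.root j)
  rw [RootPairing.reflection_apply_self, RootPairing.reflection_apply_root, inner_neg_right,
    inner_sub_left, inner_smul_left] at h1
  simp only [conj_trivial] at h1
  have h2 : ((coPair P (rootWt P i) j : ℤ) : ℝ) = ((P.pairingIn ℤ i j : ℤ) : ℝ) := by
    rw [← coPair_spec, div_eq_iff h0]
    have h3 : ((P.pairingIn ℤ i j : ℤ) : ℝ) = P.pairing i j := P.algebraMap_pairingIn ℤ i j
    rw [h3]
    change 2 * inner ℝ (P.root i) (P.root j) = _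
    linarith
  exact_mod_cast h2

lemma two_inner_root (i j : ι) :
    inner ℝ (P.root i) (P.root j) = P.pairingIn ℤ i j * nu P j := by
  have h0 : inner ℝ (P.root j) (P.root j) ≠ 0 := by
    have := NormalizedForm.two_le (P := P) j
    linarith
  have h := coPair_spec P (rootWt P i) j
  rw [coPair_rootWt, div_eq_iff h0] at h
  change 2 * inner ℝ (P.root i) (P.root j) = _ at h
  rw [nu]
  linarith

lemma pairingIn_pos_of_pos {i j : ι} (h : 0 < P.pairingIn ℤ i j) : 0 < P.pairingIn ℤ j i := by
  rw [P.zero_lt_pairingIn_iff']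
  exact h

lemma root_reflectionPerm_eq (i k : ι) :
    P.root (P.reflectionPerm i k) = P.root k + (-P.pairingIn ℤ k i) • P.root i := by
  rw [root_reflectionPerm, neg_smul, reflection_apply_root' ℤ, sub_eq_add_neg]

lemma pairingIn_reflectionPerm_right (i k : ι) :
    P.pairingIn ℤ i (P.reflectionPerm i k) = -P.pairingIn ℤ i k := by
  have h := P.pairing_reflectionPerm i i k
  rw [pairing_reflectionPerm_self_left, ← P.algebraMap_pairingIn ℤ, ← P.algebraMap_pairingIn ℤ,
    ← map_neg] at h
  exact ((algebraMap ℤ ℝ).injective_int h)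

lemma pairingIn_negIdx_left (i k : ι) :
    P.pairingIn ℤ (negIdx P i) k = -P.pairingIn ℤ i k := by
  have h := P.pairing_reflectionPerm_self_left i k
  rw [← P.algebraMap_pairingIn ℤ, ← P.algebraMap_pairingIn ℤ, ← map_neg] at h
  exact ((algebraMap ℤ ℝ).injective_int h)

lemma pairingIn_negIdx_right (i k : ι) :
    P.pairingIn ℤ i (negIdx P k) = -P.pairingIn ℤ i k := by
  have h := P.pairing_reflectionPerm_self_right i k
  rw [← P.algebraMap_pairingIn ℤ, ← P.algebraMap_pairingIn ℤ, ← map_neg] at h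
  exact ((algebraMap ℤ ℝ).injective_int h)

lemma root_negIdx (i : ι) : P.root (negIdx P i) = -P.root i := by
  rw [negIdx, root_reflectionPerm, reflection_apply_self]

lemma negIdx_negIdx (i : ι) : negIdx P (negIdx P i) = i := by
  apply P.root.injective
  rw [root_negIdx, root_negIdx, neg_neg]

lemma reflectionPerm_negIdx_left (i k : ι) :
    P.reflectionPerm (negIdx P i) k = P.reflectionPerm i k := by
  apply P.root.injective
  rw [root_reflectionPerm_eq, root_reflectionPerm_eq, root_negIdx, pairingIn_negIdx_right]
  module

lemma reflectionPerm_negIdx_right (i k : ι) :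
    P.reflectionPerm i (negIdx P k) = negIdx P (P.reflectionPerm i k) := by
  apply P.root.injective
  rw [root_reflectionPerm_eq, root_negIdx, root_negIdx, root_reflectionPerm_eq,
    pairingIn_negIdx_left]
  module

lemma nu_reflectionPerm (i k : ι) : nu P (P.reflectionPerm i k) = nu P k := by
  rw [nu, nu, root_reflectionPerm, NormalizedForm.inner_reflection]

lemma nuR_reflectionPerm (i k : ι) : nuR P (P.reflectionPerm i k) = nuR P k :=
  Subtype.ext (nu_reflectionPerm i k)

lemma nuR_negIdx (i : ι) : nuR P (negIdx P i) = nuR P i := nuR_reflectionPerm i i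

/-- Symmetries of a root system, given by their action on the indices. -/
structure IsRootSymm (P : RootPairing ι ℝ V N) [P.IsCrystallographic] (θ : Equiv.Perm ι) :
    Prop where
  pairing : ∀ i j, P.pairingIn ℤ (θ i) (θ j) = P.pairingIn ℤ i j
  reflection : ∀ i j, θ (P.reflectionPerm i j) = P.reflectionPerm (θ i) (θ j)
  nu : ∀ i, nuR P (θ i) = nuR P i

lemma IsRootSymm.negIdx {θ : Equiv.Perm ι} (h : IsRootSymm P θ) (i : ι) :
    θ (negIdx P i) = TodaDunkl.negIdx P (θ i) := h.reflection i i

lemma IsRootSymm.mul {θ η : Equiv.Perm ι} (h : IsRootSymm P θ) (h' : IsRootSymm P η) :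
    IsRootSymm P (θ * η) where
  pairing i j := by simp [h.pairing, h'.pairing]
  reflection i j := by simp [h.reflection, h'.reflection]
  nu i := by simp [h.nu, h'.nu]

/-- The permutation `α ↦ -α` of the roots. -/
def negPerm (P : RootPairing ι ℝ V N) : Equiv.Perm ι where
  toFun := negIdx P
  invFun := negIdx P
  left_inv i := @neg_neg ι P.indexNeg i
  right_inv i := @neg_neg ι P.indexNeg i

@[simp] lemma negPerm_apply (i : ι) : negPerm P i = negIdx P i := rfl

/-- The map `-1` need not belong to `W`. It is the reason for working with symmetries rather than
Weyl group elements: sequences of negative roots are brought to positive ones by it. -/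
lemma isRootSymm_neg : IsRootSymm P (negPerm P) where
  pairing i j := by simp [pairingIn_negIdx_left, pairingIn_negIdx_right]
  reflection i j := by
    simp [reflectionPerm_negIdx_left, reflectionPerm_negIdx_right]
  nu i := nuR_negIdx i

lemma refl_smul (i k : ι) : refl P i • k = P.reflectionPerm i k := by
  apply P.root.injective
  rw [← weyl_root, root_reflectionPerm]
  rfl

lemma weyl_pairing (w : P.weylGroup) (i j : ι) :
    P.pairingIn ℤ (w • i) (w • j) = P.pairingIn ℤ i j := by
  rw [← coPair_rootWt, ← coPair_rootWt, ← coPair_weyl P w (rootWt P i)]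
  exact congrArg (fun b => coPair P b (w • j)) (Subtype.ext (weyl_root P w i).symm)

lemma weyl_reflectionPerm (w : P.weylGroup) (i j : ι) :
    w • P.reflectionPerm i j = P.reflectionPerm (w • i) (w • j) := by
  apply P.root.injective
  rw [← weyl_root, root_reflectionPerm_eq, root_reflectionPerm_eq, weyl_pairing, smul_add,
    weyl_root]
  congr 1
  rw [← weyl_root]
  exact map_zsmul (DistribSMul.toAddMonoidHom V w) _ _

lemma nuR_weyl (w : P.weylGroup) (i : ι) : nuR P (w • i) = nuR P i := by
  apply Subtype.ext
  change nu P _ = nu P _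
  rw [nu, nu, inner_root_weyl]

lemma isRootSymm_weyl (w : P.weylGroup) : IsRootSymm P (MulAction.toPerm w) where
  pairing i j := weyl_pairing w i j
  reflection i j := weyl_reflectionPerm w i j
  nu i := nuR_weyl w i

lemma isRootSymm_reflectionPerm (i : ι) : IsRootSymm P (P.reflectionPerm i) := by
  have h : MulAction.toPerm (refl P i) = P.reflectionPerm i := Equiv.ext fun k => refl_smul i k
  exact h ▸ isRootSymm_weyl (refl P i)

variable (Δ : P.Base)

lemma isPos_negIdx (i : ι) : Δ.IsPos (negIdx P i) ↔ ¬ Δ.IsPos i :=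
  RootPairing.Base.IsPos.neg_iff_not Δ i

lemma height_reflectionPerm (i k : ι) :
    Δ.height (P.reflectionPerm i k) = Δ.height k - P.pairingIn ℤ k i * Δ.height i := by
  rw [Δ.height_add_zsmul (root_reflectionPerm_eq i k), smul_eq_mul]
  ring

/-- Otherwise `s_i` would add a nonnegative multiple of the positive root `i` to `k`, and the height
would stay positive. -/
lemma pairingIn_pos_of_isPos {i k : ι} (hi : Δ.IsPos i) (hk : Δ.IsPos k)
    (h : ¬ Δ.IsPos (P.reflectionPerm i k)) : 0 < P.pairingIn ℤ i k := by
  refine pairingIn_pos_of_pos ?_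
  rw [RootPairing.Base.isPos_iff] at hi hk h
  rw [height_reflectionPerm] at h
  by_contra hn
  nlinarith

/-- `1` if `ν_α = ν` and `0` otherwise. -/
def nuInd (ν : NuR P) (i : ι) : ℤ := if nuR P i = ν then 1 else 0

/-- The sign of a root. -/
def sgn (i : ι) : ℤ := if Δ.IsPos i then 1 else -1

/-- `1` for a positive root and `0` for a negative one. -/
def posInd (i : ι) : ℤ := if Δ.IsPos i then 1 else 0

lemma nuInd_nonneg (ν : NuR P) (i : ι) : 0 ≤ nuInd ν i := by
  rw [nuInd]; split_ifs <;> norm_num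

lemma IsRootSymm.nuInd {θ : Equiv.Perm ι} (h : IsRootSymm P θ) (ν : NuR P) (i : ι) :
    nuInd ν (θ i) = TodaDunkl.nuInd ν i := by
  rw [TodaDunkl.nuInd, TodaDunkl.nuInd, h.nu]

lemma nuInd_reflectionPerm (ν : NuR P) (i k : ι) :
    nuInd ν (P.reflectionPerm i k) = nuInd ν k := (isRootSymm_reflectionPerm i).nuInd ν k

lemma nuInd_negIdx (ν : NuR P) (i : ι) : nuInd ν (negIdx P i) = nuInd ν i :=
  isRootSymm_neg.nuInd ν i

lemma sgn_negIdx (i : ι) : sgn Δ (negIdx P i) = -sgn Δ i := by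
  simp only [sgn, isPos_negIdx]; split_ifs <;> simp_all

lemma posInd_negIdx (i : ι) : posInd Δ (negIdx P i) = 1 - posInd Δ i := by
  simp only [posInd, isPos_negIdx]; split_ifs <;> simp_all

lemma sgn_eq (i : ι) : sgn Δ i = 2 * posInd Δ i - 1 := by
  simp only [sgn, posInd]; split_ifs <;> simp

/-- `(2 ρ_ν^∨, α)` for a root `α`. -/
def rhoRoot (ν : NuR P) (i : ι) : ℤ := twoRho Δ ν (rootWt P i)

lemma rhoRoot_eq (ν : NuR P) (γ : ι) :
    rhoRoot Δ ν γ = ∑ i, nuInd ν i * posInd Δ i * P.pairingIn ℤ γ i := by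
  rw [rhoRoot, twoRho, Finset.sum_filter]
  refine Finset.sum_congr rfl fun i _ => ?_
  rw [coPair_rootWt, nuInd, posInd]
  by_cases h1 : Δ.IsPos i <;> by_cases h2 : nuR P i = ν <;> simp [h1, h2]

lemma rhoRoot_negIdx (ν : NuR P) (γ : ι) :
    rhoRoot Δ ν (negIdx P γ) = -rhoRoot Δ ν γ := by
  simp only [rhoRoot_eq, pairingIn_negIdx_left, mul_neg, Finset.sum_neg_distrib]

/-- The sum of the pairings over all roots of one length vanishes under `i ↦ -i`, so the positivity
indicator may be replaced by half of the sign. Unlike the indicator, the sign is odd, and the sum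
runs over a set that every symmetry preserves. -/
lemma two_mul_rhoRoot (ν : NuR P) (γ : ι) :
    2 * rhoRoot Δ ν γ = ∑ i, nuInd ν i * sgn Δ i * P.pairingIn ℤ γ i := by
  have h : ∑ i, nuInd ν i * P.pairingIn ℤ γ i = 0 := by
    have h1 : ∑ i, nuInd ν i * P.pairingIn ℤ γ i
        = ∑ i, nuInd ν (negPerm P i) * P.pairingIn ℤ γ (negPerm P i) :=
      (Equiv.sum_comp (negPerm P) fun i => nuInd ν i * P.pairingIn ℤ γ i).symm
    simp only [negPerm_apply, nuInd_negIdx, pairingIn_negIdx_right, mul_neg,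
      Finset.sum_neg_distrib] at h1
    omega
  rw [rhoRoot_eq, Finset.mul_sum, ← sub_eq_zero, ← h, ← Finset.sum_sub_distrib]
  refine Finset.sum_congr rfl fun i _ => ?_
  rw [sgn_eq]
  ring

/-- A function that is antisymmetric under a reflection has sum zero over the positive roots that
stay positive. -/
lemma sum_posInd_mul_reflection (β : ι) (F : ι → ℤ)
    (hF : ∀ i, F (P.reflectionPerm β i) = -F i) :
    ∑ i, posInd Δ i * F i = ∑ i, posInd Δ i * (1 - posInd Δ (P.reflectionPerm β i)) * F i := by
  -- The reflection permutes the positive roots that stay positive and changes the sign of `F`.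
  have h : ∑ i, posInd Δ i * posInd Δ (P.reflectionPerm β i) * F i = 0 := by
    have h1 := Equiv.sum_comp (P.reflectionPerm β)
      fun i => posInd Δ i * posInd Δ (P.reflectionPerm β i) * F i
    simp only [reflectionPerm_self, hF, mul_neg, Finset.sum_neg_distrib] at h1
    have h2 : ∑ i, posInd Δ (P.reflectionPerm β i) * posInd Δ i * F i
        = ∑ i, posInd Δ i * posInd Δ (P.reflectionPerm β i) * F i :=
      Finset.sum_congr rfl fun i _ => by ring
    omega
  rw [← sub_zero (∑ i, posInd Δ i * F i), ← h, ← Finset.sum_sub_distrib]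
  exact Finset.sum_congr rfl fun i _ => by ring

/-- The indicator of the inversions of the reflection `s_β`. -/
def invInd (β i : ι) : ℤ := posInd Δ i * (1 - posInd Δ (P.reflectionPerm β i))

/-- The pairing with `γ` is antisymmetric under `s_γ`, so only the inversions of `s_γ` survive. -/
lemma rhoRoot_eq_sum_inv (ν : NuR P) (γ : ι) :
    rhoRoot Δ ν γ = ∑ i, invInd Δ γ i * (nuInd ν i * P.pairingIn ℤ γ i) := by
  rw [rhoRoot_eq]
  simp only [invInd]
  rw [← sum_posInd_mul_reflection Δ γ (fun i => nuInd ν i * P.pairingIn ℤ γ i)]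
  · exact Finset.sum_congr rfl fun i _ => by ring
  · intro i
    rw [nuInd_reflectionPerm, pairingIn_reflectionPerm_right]
    ring

lemma invInd_nonneg (β i : ι) : 0 ≤ invInd Δ β i := by
  simp only [invInd, posInd]; split_ifs <;> norm_num

lemma invInd_self {β : ι} (hβ : Δ.IsPos β) : invInd Δ β β = 1 := by
  have h := isPos_negIdx Δ β
  rw [negIdx] at h
  simp [invInd, posInd, hβ, h]

/-- A refinement of `(2 ρ_ν^∨, γ) ≥ #{inversions of s_γ of length ν}`. -/
lemma sum_invInd_add_le_rhoRoot (ν : NuR P) {γ : ι} (hγ : Δ.IsPos γ) :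
    ∑ i, invInd Δ γ i * nuInd ν i + nuInd ν γ ≤ rhoRoot Δ ν γ := by
  rw [rhoRoot_eq_sum_inv]
  have h1 : nuInd ν γ = ∑ i, if i = γ then nuInd ν γ else 0 := by simp
  rw [h1, ← Finset.sum_add_distrib]
  refine Finset.sum_le_sum fun i _ => ?_
  split_ifs with h
  · subst h
    -- Every inversion of `s_γ` pairs with `γ` to at least `1`. The root `γ` itself gives `2`, which
    -- accounts for the extra summand.
    rw [invInd_self Δ hγ, P.pairingIn_same]
    linarith
  · rw [add_zero]
    have h3 := nuInd_nonneg ν i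
    by_cases h4 : Δ.IsPos i ∧ ¬ Δ.IsPos (P.reflectionPerm γ i)
    · have h5 := pairingIn_pos_of_isPos Δ hγ h4.1 h4.2
      simp only [invInd, posInd, h4.1, h4.2, if_true, if_false]
      nlinarith
    · have : invInd Δ γ i = 0 := by
        rw [not_and_not_right] at h4
        by_cases h5 : Δ.IsPos i
        · simp [invInd, posInd, h5, h4 h5]
        · simp [invInd, posInd, h5]
      simp [this]

lemma two_mul_nuInd_le_rhoRoot (ν : NuR P) {γ : ι} (hγ : Δ.IsPos γ) :
    2 * nuInd ν γ ≤ rhoRoot Δ ν γ := by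
  have h := sum_invInd_add_le_rhoRoot Δ ν hγ
  have h1 : invInd Δ γ γ * nuInd ν γ ≤ ∑ i, invInd Δ γ i * nuInd ν i :=
    Finset.single_le_sum (f := fun i => invInd Δ γ i * nuInd ν i)
      (fun i _ => mul_nonneg (invInd_nonneg Δ γ i) (nuInd_nonneg ν i)) (Finset.mem_univ γ)
  rw [invInd_self Δ hγ] at h1
  linarith

lemma height_reflectionPerm_add (θ : Equiv.Perm ι) (hθ : IsRootSymm P θ) (β i : ι) :
    Δ.height (θ (P.reflectionPerm β i))
      = Δ.height (θ i) - P.pairingIn ℤ i β * Δ.height (θ β) := by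
  rw [hθ.reflection, height_reflectionPerm, hθ.pairing]

/-- The finite form of the main inequality. -/
lemma two_mul_nuInd_add_min_le (ν : NuR P) {θ : Equiv.Perm ι} (hθ : IsRootSymm P θ) {β : ι}
    (hβ : Δ.IsPos β) :
    2 * nuInd ν β + 2 * min 0 (rhoRoot Δ ν (θ β))
      ≤ ∑ i, nuInd ν i * sgn Δ (θ i) * (posInd Δ i - posInd Δ (P.reflectionPerm β i)) := by
  -- Substituting `s_β i` in the second half makes the summand antisymmetric under `s_β`; again only
  -- the inversions of `s_β` remain.
  have key : ∑ i, nuInd ν i * sgn Δ (θ i) * (posInd Δ i - posInd Δ (P.reflectionPerm β i))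
      = ∑ i, invInd Δ β i * (nuInd ν i * (sgn Δ (θ i) - sgn Δ (θ (P.reflectionPerm β i)))) := by
    have h1 := Equiv.sum_comp (P.reflectionPerm β)
      fun i => nuInd ν i * sgn Δ (θ i) * posInd Δ (P.reflectionPerm β i)
    simp only [reflectionPerm_self, nuInd_reflectionPerm] at h1
    have h2 := sum_posInd_mul_reflection Δ β
      (fun i => nuInd ν i * (sgn Δ (θ i) - sgn Δ (θ (P.reflectionPerm β i))))
      (fun i => by rw [nuInd_reflectionPerm, reflectionPerm_self]; ring)
    simp only [invInd]
    rw [← h2]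
    simp only [mul_sub, Finset.sum_sub_distrib]
    rw [← h1]
    congr 1 <;> exact Finset.sum_congr rfl fun i _ => by ring
  rw [key]
  have hself : P.reflectionPerm β β = negIdx P β := rfl
  have hhalf : ∀ i, invInd Δ β i ≠ 0 → 0 < P.pairingIn ℤ i β := by
    intro i hi
    refine pairingIn_pos_of_pos (pairingIn_pos_of_isPos Δ hβ ?_ ?_)
    · by_contra h; simp [invInd, posInd, h] at hi
    · intro h; simp [invInd, posInd, h] at hi
  by_cases hp : Δ.IsPos (θ β)
  -- If `θ β` is positive, `θ(s_β i)` is `θ i` minus a positive multiple of `θ β`. The sign cannot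
  -- increase, so all terms are nonnegative, and the term of `β` alone gives `2`.
  · have hmin : min 0 (rhoRoot Δ ν (θ β)) ≤ 0 := min_le_left _ _
    have h1 : 2 * nuInd ν β ≤ ∑ i, invInd Δ β i *
        (nuInd ν i * (sgn Δ (θ i) - sgn Δ (θ (P.reflectionPerm β i)))) := by
      refine le_trans (le_of_eq ?_) (Finset.single_le_sum (f := fun i => invInd Δ β i *
        (nuInd ν i * (sgn Δ (θ i) - sgn Δ (θ (P.reflectionPerm β i))))) ?_ (Finset.mem_univ β))
      · rw [invInd_self Δ hβ, hself, hθ.negIdx, sgn_negIdx]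
        simp only [sgn, hp, if_true]
        ring
      · intro i _
        by_cases h0 : invInd Δ β i = 0
        · simp [h0]
        · refine mul_nonneg (invInd_nonneg Δ β i) (mul_nonneg (nuInd_nonneg ν i) ?_)
          have h3 := hhalf i h0
          have h4 := height_reflectionPerm_add Δ θ hθ β i
          have h5 : ¬ (¬ Δ.IsPos (θ i) ∧ Δ.IsPos (θ (P.reflectionPerm β i))) := by
            rintro ⟨h6, h7⟩
            rw [RootPairing.Base.isPos_iff] at hp h6 h7
            nlinarith
          simp only [sgn]
          split_ifs <;> simp_all
    linarith
  · have hγ : Δ.IsPos (θ (negIdx P β)) := by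
      rw [hθ.negIdx, isPos_negIdx]; exact hp
    have h1 := sum_invInd_add_le_rhoRoot Δ ν hγ
    have hC : rhoRoot Δ ν (θ (negIdx P β)) = -rhoRoot Δ ν (θ β) := by
      rw [hθ.negIdx, rhoRoot_negIdx]
    have hCneg : rhoRoot Δ ν (θ β) ≤ 0 := by
      have h2 := two_mul_nuInd_le_rhoRoot Δ ν hγ
      have h3 := nuInd_nonneg ν (θ (negIdx P β))
      linarith
    rw [min_eq_right hCneg]
    have hνβ : nuInd ν (θ (negIdx P β)) = nuInd ν β := by rw [hθ.nuInd, nuInd_negIdx]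
    rw [hC, hνβ] at h1
    -- If `θ β` is negative, a term equals `-2` only when `θ i` is negative and `θ(s_β i)` is
    -- positive. Then `θ(-i)` is an inversion of the reflection in the positive root `θ(-β)`, and
    -- the refined bound for `ρ` limits the number of these.
    have h2 : -∑ i, invInd Δ β i *
        (nuInd ν i * (sgn Δ (θ i) - sgn Δ (θ (P.reflectionPerm β i))))
        ≤ 2 * ∑ i, invInd Δ (θ (negIdx P β)) i * nuInd ν i := by
      have h3 := Equiv.sum_comp ((negPerm P).trans θ)
        fun i => invInd Δ (θ (negIdx P β)) i * nuInd ν i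
      rw [← h3, ← Finset.sum_neg_distrib, Finset.mul_sum]
      refine Finset.sum_le_sum fun i _ => ?_
      have hr : P.reflectionPerm (θ (negIdx P β)) (θ (negIdx P i))
          = negIdx P (θ (P.reflectionPerm β i)) := by
        rw [← hθ.reflection, reflectionPerm_negIdx_left, reflectionPerm_negIdx_right, hθ.negIdx]
      rw [Equiv.trans_apply, negPerm_apply, hθ.nuInd, nuInd_negIdx, invInd.eq_1 Δ (θ _), hr,
        posInd_negIdx, hθ.negIdx i, posInd_negIdx, sgn_eq, sgn_eq]
      have h5 := nuInd_nonneg ν i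
      have h6 : ∀ k, posInd Δ k = 0 ∨ posInd Δ k = 1 := fun k => by
        rw [posInd]; split_ifs <;> simp
      have h7 : invInd Δ β i = 0 ∨ invInd Δ β i = 1 := by
        simp only [invInd]
        rcases h6 i with h | h <;> rcases h6 (P.reflectionPerm β i) with h' | h' <;> simp [h, h']
      rcases h6 (θ i) with h | h <;> rcases h6 (θ (P.reflectionPerm β i)) with h' | h' <;>
        rcases h7 with h'' | h'' <;> rw [h, h', h''] <;> linarith
    linarith

end RootCombinatorics

/-! ### Affine roots: positivity, inversions of affine reflections, and the main inequality. -/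

section AffineRoots

variable {ι V N : Type*} [Fintype ι] [NormedAddCommGroup V] [InnerProductSpace ℝ V]
  [AddCommGroup N] [Module ℝ N] {P : RootPairing ι ℝ V N} [P.IsCrystallographic]
  [NormalizedForm P] (Δ : P.Base)

@[simp] lemma smul_idx (g : ExtAffWeyl P) (a : AffRoot P) : (g • a).idx = g.lin • a.idx := rfl

lemma smul_lvl (g : ExtAffWeyl P) (a : AffRoot P) :
    (g • a).lvl = a.lvl - coPair P g.trans (g.lin • a.idx) := rfl

lemma coPair_neg (b : weightLattice P) (i : ι) : coPair P (-b) i = -coPair P b i := by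
  have h := coPair_add P b (-b) i
  rw [add_neg_cancel, coPair_zero] at h
  omega

lemma coPair_zsmul (n : ℤ) (b : weightLattice P) (i : ι) :
    coPair P (n • b) i = n * coPair P b i := by
  have h := map_zsmul (⟨⟨fun b => coPair P b i, coPair_zero P i⟩,
    fun b c => coPair_add P b c i⟩ : weightLattice P →+ ℤ) n b
  simpa using h

lemma coPair_negIdx (b : weightLattice P) (i : ι) :
    coPair P b (negIdx P i) = -coPair P b i := by
  have h : ((coPair P b (negIdx P i) : ℤ) : ℝ) = ((-coPair P b i : ℤ) : ℝ) := by
    push_cast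
    rw [← coPair_spec, ← coPair_spec, root_negIdx, inner_neg_right, inner_neg_neg]
    ring
  exact_mod_cast h

@[simp] lemma affRefl_smul_idx (a x : AffRoot P) :
    (affRefl P a • x).idx = P.reflectionPerm a.idx x.idx := refl_smul a.idx x.idx

lemma affRefl_smul_lvl (a x : AffRoot P) :
    (affRefl P a • x).lvl = x.lvl - a.lvl * P.pairingIn ℤ a.idx x.idx := by
  change x.lvl - coPair P (-(a.lvl • rootWt P a.idx)) (refl P a.idx • x.idx) = _
  rw [refl_smul, coPair_neg, coPair_zsmul, coPair_rootWt, pairingIn_reflectionPerm_right]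
  ring

@[simp] lemma neg_idx (a : AffRoot P) : a.neg.idx = negIdx P a.idx := rfl

@[simp] lemma neg_lvl (a : AffRoot P) : a.neg.lvl = -a.lvl := rfl

@[simp] lemma neg_neg_affRoot (a : AffRoot P) : a.neg.neg = a := by
  apply AffRoot.ext
  · exact negIdx_negIdx a.idx
  · simp

lemma weyl_smul_negIdx (w : P.weylGroup) (i : ι) : w • negIdx P i = negIdx P (w • i) :=
  (isRootSymm_weyl w).negIdx i

@[simp] lemma smul_neg_affRoot (g : ExtAffWeyl P) (a : AffRoot P) : g • a.neg = (g • a).neg := by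
  apply AffRoot.ext
  · exact weyl_smul_negIdx g.lin a.idx
  · rw [smul_lvl, neg_lvl, neg_lvl, neg_idx, weyl_smul_negIdx, coPair_negIdx, smul_lvl]
    ring

@[simp] lemma affRefl_smul_self (a : AffRoot P) : affRefl P a • a = a.neg := by
  apply AffRoot.ext
  · rw [affRefl_smul_idx]; rfl
  · rw [affRefl_smul_lvl, P.pairingIn_same, neg_lvl]
    ring

lemma refl_mul_self (i : ι) : refl P i * refl P i = 1 := by
  apply Subtype.ext
  have h : (RootPairing.Equiv.reflection P i) ^ 2 = 1 := by
    rw [sq, mul_eq_one_iff_inv_eq, RootPairing.Equiv.reflection_inv P i]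
  rw [sq] at h
  exact h

lemma refl_smul_rootWt (i j : ι) : refl P i • rootWt P j = rootWt P (P.reflectionPerm i j) := by
  apply Subtype.ext
  rw [← refl_smul]
  exact weyl_root P _ j

lemma weyl_smul_rootWt (w : P.weylGroup) (j : ι) : w • rootWt P j = rootWt P (w • j) :=
  Subtype.ext (weyl_root P w j)

lemma rootWt_negIdx (i : ι) : rootWt P (negIdx P i) = -rootWt P i :=
  Subtype.ext (root_negIdx i)

lemma weyl_smul_zsmul (w : P.weylGroup) (n : ℤ) (b : weightLattice P) :
    w • (n • b) = n • (w • b) :=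
  map_zsmul (DistribSMul.toAddMonoidHom (weightLattice P) w) n b

lemma affRefl_mul_self (a : AffRoot P) : affRefl P a * affRefl P a = 1 := by
  apply ExtAffWeyl.ext
  · change -(a.lvl • rootWt P a.idx) + refl P a.idx • -(a.lvl • rootWt P a.idx) = 0
    rw [smul_neg, weyl_smul_zsmul, refl_smul_rootWt]
    change -(a.lvl • rootWt P a.idx) + -(a.lvl • rootWt P (negIdx P a.idx)) = 0
    rw [rootWt_negIdx]
    simp
  · exact refl_mul_self a.idx

@[simp] lemma affRefl_smul_smul (a x : AffRoot P) : affRefl P a • affRefl P a • x = x := by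
  rw [← mul_smul, affRefl_mul_self, one_smul]

/-- Elements of the Weyl group are determined by their action on the roots. -/
lemma weylGroup_ext [P.IsRootSystem] {v w : P.weylGroup} (h : ∀ i : ι, v • i = w • i) :
    v = w := by
  apply Subtype.ext
  apply RootPairing.Equiv.weightHom_injective P
  apply LinearEquiv.toLinearMap_injective
  refine LinearMap.ext_on (RootPairing.IsRootSystem.span_root_eq_top (P := P)) ?_
  rintro - ⟨i, rfl⟩
  have h1 := weyl_root P v i
  have h2 := weyl_root P w i
  rw [h i, ← h2] at h1
  exact h1

lemma refl_weyl_smul [P.IsRootSystem] (w : P.weylGroup) (i : ι) :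
    refl P (w • i) = w * refl P i * w⁻¹ := by
  apply weylGroup_ext
  intro k
  rw [refl_smul, mul_smul, mul_smul, refl_smul, weyl_reflectionPerm, smul_inv_smul]

lemma refl_negIdx [P.IsRootSystem] (i : ι) : refl P (negIdx P i) = refl P i := by
  apply weylGroup_ext
  intro k
  rw [refl_smul, refl_smul, reflectionPerm_negIdx_left]

/-- The reflection of a weight: `s_α(b) = b - (b, α^∨) α`. -/
lemma refl_smul_weight (i : ι) (b : weightLattice P) :
    refl P i • b = b - coPair P b i • rootWt P i := by
  apply Subtype.ext
  have h0 : inner ℝ (P.root i) (P.root i) ≠ 0 := by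
    have := NormalizedForm.two_le (P := P) i
    linarith
  have h1 := NormalizedForm.inner_reflection (P := P) i (b : V) (P.root i)
  have h3 := coPair_spec P b i
  change P.reflection i (b : V) = (b : V) - ((coPair P b i • rootWt P i : weightLattice P) : V)
  rw [RootPairing.reflection_apply_self, RootPairing.reflection_apply, inner_neg_right,
    inner_sub_left, inner_smul_left] at h1
  simp only [conj_trivial] at h1
  rw [div_eq_iff h0] at h3
  rw [RootPairing.reflection_apply]
  have h4 : (P.toLinearMap.flip (P.coroot i)) (b : V) = (coPair P b i : ℝ) := by
    refine mul_right_cancel₀ h0 ?_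
    linarith
  rw [h4, AddSubgroup.coe_zsmul, Int.cast_smul_eq_zsmul]
  rfl

lemma affRefl_smul [P.IsRootSystem] (g : ExtAffWeyl P) (a : AffRoot P) :
    affRefl P (g • a) = g * affRefl P a * g⁻¹ := by
  rw [eq_mul_inv_iff_mul_eq]
  apply ExtAffWeyl.ext
  · change -((a.lvl - coPair P g.trans (g.lin • a.idx)) • rootWt P (g.lin • a.idx))
        + refl P (g.lin • a.idx) • g.trans = g.trans + g.lin • -(a.lvl • rootWt P a.idx)
    rw [refl_smul_weight, smul_neg, weyl_smul_zsmul, weyl_smul_rootWt]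
    module
  · change refl P (g.lin • a.idx) * g.lin = g.lin * refl P a.idx
    rw [refl_weyl_smul, inv_mul_cancel_right]

lemma affRefl_neg [P.IsRootSystem] (a : AffRoot P) : affRefl P a.neg = affRefl P a := by
  apply ExtAffWeyl.ext
  · change -((-a.lvl) • rootWt P (negIdx P a.idx)) = -(a.lvl • rootWt P a.idx)
    rw [rootWt_negIdx]
    simp
  · exact refl_negIdx a.idx

/-- Positive affine roots. -/
def AffPos (a : AffRoot P) : Prop := 0 < a.lvl ∨ a.lvl = 0 ∧ Δ.IsPos a.idx

variable {Δ}

/-- The least positive level is `0` over a positive root and `1` over a negative one. In this linear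
form the inversions of a reflection over a fixed nonaffine part are an interval of levels. -/
lemma affPos_iff {a : AffRoot P} : AffPos Δ a ↔ 1 - posInd Δ a.idx ≤ a.lvl := by
  simp only [AffPos, posInd]
  split_ifs with h <;> simp only [h] <;> grind

lemma affPos_neg {a : AffRoot P} : AffPos Δ a.neg ↔ ¬ AffPos Δ a := by
  rw [affPos_iff, affPos_iff, neg_idx, neg_lvl, posInd_negIdx]
  omega

lemma AffPos.lvl_nonneg {a : AffRoot P} (h : AffPos Δ a) : 0 ≤ a.lvl := by
  rcases h with h | h
  · exact h.le
  · exact h.1.ge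

variable (Δ)

/-- A positive affine root whose reflection makes no other positive affine root negative. -/
def IsAffSimple (a : AffRoot P) : Prop :=
  AffPos Δ a ∧ ∀ x, AffPos Δ x → x ≠ a → AffPos Δ (affRefl P a • x)

/-- Affine roots as pairs of an index and a level. -/
def affRootEquiv (P : RootPairing ι ℝ V N) : (Σ _ : ι, ℤ) ≃ AffRoot P where
  toFun x := ⟨x.1, x.2⟩
  invFun a := ⟨a.idx, a.lvl⟩

@[simp] lemma affRootEquiv_apply (x : Σ _ : ι, ℤ) : affRootEquiv P x = ⟨x.1, x.2⟩ := rfl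

/-- The inversions of the reflection in an affine root. -/
def reflInversions (β : AffRoot P) : Finset (AffRoot P) :=
  ((Finset.univ : Finset ι).sigma fun i => Finset.Icc (1 - posInd Δ i)
    (β.lvl * P.pairingIn ℤ β.idx i - posInd Δ (P.reflectionPerm β.idx i))).map
    (affRootEquiv P).toEmbedding

lemma mem_reflInversions {β x : AffRoot P} :
    x ∈ reflInversions Δ β ↔ AffPos Δ x ∧ ¬ AffPos Δ (affRefl P β • x) := by
  rw [affPos_iff, affPos_iff, affRefl_smul_idx, affRefl_smul_lvl]
  simp only [reflInversions, Finset.mem_map, Finset.mem_sigma, Finset.mem_univ, true_and,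
    Finset.mem_Icc, Sigma.exists]
  constructor
  · rintro ⟨a, b, h, rfl⟩
    simp only [Equiv.coe_toEmbedding, affRootEquiv_apply]
    omega
  · intro h
    exact ⟨x.idx, x.lvl, by omega, rfl⟩

/-- The coefficient is the length of the interval of levels over `i`; `toNat` covers the case when
it is empty. -/
lemma sum_reflInversions (β : AffRoot P) (F : ι → ℤ) :
    ∑ x ∈ reflInversions Δ β, F x.idx
      = ∑ i, ((β.lvl * P.pairingIn ℤ β.idx i - posInd Δ (P.reflectionPerm β.idx i)
          + posInd Δ i).toNat : ℤ) * F i := by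
  rw [reflInversions, Finset.sum_map, Finset.sum_sigma]
  refine Finset.sum_congr rfl fun i _ => ?_
  simp only [Equiv.coe_toEmbedding, affRootEquiv_apply, Finset.sum_const]
  rw [Int.card_Icc, nsmul_eq_mul]
  congr 3
  ring

/-- The signed count of the inversions of an affine reflection. -/
lemma two_mul_sum_reflInversions (ν : NuR P) {θ : Equiv.Perm ι} (hθ : IsRootSymm P θ)
    {β : AffRoot P} :
    2 * ∑ x ∈ reflInversions Δ β, nuInd ν x.idx * sgn Δ (θ x.idx)
      = 2 * β.lvl * rhoRoot Δ ν (θ β.idx) +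
        ∑ i, nuInd ν i * sgn Δ (θ i) * (posInd Δ i - posInd Δ (P.reflectionPerm β.idx i)) := by
  rw [sum_reflInversions Δ β fun i => nuInd ν i * sgn Δ (θ i)]
  set c : ι → ℤ := fun i =>
    β.lvl * P.pairingIn ℤ β.idx i - posInd Δ (P.reflectionPerm β.idx i) + posInd Δ i with hc
  change 2 * ∑ i, ((c i).toNat : ℤ) * _ = _
  -- Since `c` and the sign are both odd, `i` and `-i` together contribute `c⁺ - c⁻ = c` times the
  -- sign. This removes the truncation and leaves an expression linear in the level.
  have hneg : ∀ i, c (negIdx P i) = -c i := fun i => by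
    simp only [hc, pairingIn_negIdx_right, reflectionPerm_negIdx_right, posInd_negIdx]
    ring
  have h1 := Equiv.sum_comp (negPerm P) fun i => ((c i).toNat : ℤ) * (nuInd ν i * sgn Δ (θ i))
  simp only [negPerm_apply, hneg, nuInd_negIdx, hθ.negIdx, sgn_negIdx] at h1
  have h2 : 2 * rhoRoot Δ ν (θ β.idx)
      = ∑ i, nuInd ν i * sgn Δ (θ i) * P.pairingIn ℤ β.idx i := by
    rw [two_mul_rhoRoot, ← Equiv.sum_comp θ]
    exact Finset.sum_congr rfl fun i _ => by rw [hθ.nuInd, hθ.pairing]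
  have h3 : 2 * β.lvl * rhoRoot Δ ν (θ β.idx)
      = ∑ i, β.lvl * (nuInd ν i * sgn Δ (θ i) * P.pairingIn ℤ β.idx i) := by
    rw [← Finset.mul_sum, ← h2]
    ring
  rw [two_mul]
  nth_rw 1 [← h1]
  rw [h3, ← Finset.sum_add_distrib, ← Finset.sum_add_distrib]
  refine Finset.sum_congr rfl fun i _ => ?_
  have h4 : ((c i).toNat : ℤ) - ((-c i).toNat : ℤ) = c i := by omega
  have h5 : ((-c i).toNat : ℤ) * (nuInd ν i * -sgn Δ (θ i))
      + ((c i).toNat : ℤ) * (nuInd ν i * sgn Δ (θ i))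
      = (((c i).toNat : ℤ) - ((-c i).toNat : ℤ)) * (nuInd ν i * sgn Δ (θ i)) := by ring
  rw [h5, h4, hc]
  ring

/-- The number of roots of length `ν` in a set of affine roots that `θ` makes negative. -/
def negCount (ν : NuR P) (θ : Equiv.Perm ι) (L : Finset (AffRoot P)) : ℤ :=
  ∑ x ∈ L, nuInd ν x.idx * (1 - posInd Δ (θ x.idx))

/-- The inversions of `u s_β` are `L` together with `β`. Roots of `L` that `s_β` keeps in `L` cancel
in pairs. The other roots of `L` are inversions of `s_β`, and `x ↦ -s_β x` is an involution of the
inversions of `s_β` other than `β` that exchanges those in `L` with those outside. -/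
lemma two_mul_negCount_sub (ν : NuR P) {θ : Equiv.Perm ι} (hθ : IsRootSymm P θ)
    {L : Finset (AffRoot P)} {u : ExtAffWeyl P} {β : AffRoot P} [P.IsRootSystem]
    (hL : ∀ x, x ∈ L ↔ AffPos Δ x ∧ ¬ AffPos Δ (u • x)) (hs : IsAffSimple Δ (u • β))
    (hβ : AffPos Δ β) :
    2 * negCount Δ ν (θ * P.reflectionPerm β.idx) L - 2 * negCount Δ ν θ L
      = ∑ x ∈ (reflInversions Δ β).erase β, nuInd ν x.idx * sgn Δ (θ x.idx) := by
  have hconj : ∀ x : AffRoot P, u • affRefl P β • x = affRefl P (u • β) • u • x := fun x => by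
    rw [affRefl_smul, ← mul_smul, ← mul_smul, inv_mul_cancel_right]
  -- As `u s_β = s_{uβ} u` and `u β` is simple, `s_{uβ}` makes the positive root `-u x` negative
  -- only if it is `u β`, that is, if `x = -β`, which is not positive.
  have hL1 : ∀ x ∈ L, ¬ AffPos Δ (u • affRefl P β • x) := by
    intro x hx
    rw [hL] at hx
    rw [hconj, ← affPos_neg, ← smul_neg_affRoot]
    refine hs.2 _ (affPos_neg.mpr hx.2) fun h => ?_
    rw [← smul_neg_affRoot] at h
    have h1 : x.neg = β := smul_left_cancel u h
    rw [← h1, affPos_neg] at hβ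
    exact hβ hx.1
  have hL2 : ∀ x, AffPos Δ x → x ∉ L → x ≠ β → AffPos Δ (u • affRefl P β • x) := by
    intro x hx hxL hne
    rw [hL, not_and_not_right] at hxL
    rw [hconj]
    exact hs.2 _ (hxL hx) fun h => hne (smul_left_cancel u h)
  set G : AffRoot P → ℤ := fun x =>
    nuInd ν x.idx * (posInd Δ (θ x.idx) - posInd Δ (θ (P.reflectionPerm β.idx x.idx))) with hG
  set F : AffRoot P → ℤ := fun x => nuInd ν x.idx * sgn Δ (θ x.idx) with hF
  set σ : AffRoot P → AffRoot P := fun x => (affRefl P β • x).neg with hσ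
  have hσσ : ∀ x, σ (σ x) = x := fun x => by simp [hσ]
  have hGF : ∀ x, 2 * G x = F x + F (σ x) := fun x => by
    simp only [hG, hF, hσ, neg_idx, affRefl_smul_idx, nuInd_negIdx, nuInd_reflectionPerm,
      hθ.negIdx, sgn_negIdx]
    rw [sgn_eq, sgn_eq]
    ring
  have hA : ∑ x ∈ L with affRefl P β • x ∈ L, G x = 0 := by
    have h1 : ∑ x ∈ L with affRefl P β • x ∈ L, G x
        = ∑ x ∈ L with affRefl P β • x ∈ L, -G x := by
      refine Finset.sum_bij' (fun x _ => affRefl P β • x) (fun x _ => affRefl P β • x)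
        ?_ ?_ ?_ ?_ ?_
      · intro x hx; simpa [and_comm] using hx
      · intro x hx; simpa [and_comm] using hx
      · simp
      · simp
      · intro x _
        simp only [hG, affRefl_smul_idx, nuInd_reflectionPerm, reflectionPerm_self]
        ring
    rw [Finset.sum_neg_distrib] at h1
    omega
  have hB : L.filter (fun x => ¬ affRefl P β • x ∈ L)
      = ((reflInversions Δ β).erase β).filter (· ∈ L) := by
    ext x
    simp only [Finset.mem_filter, Finset.mem_erase, mem_reflInversions]
    constructor
    · rintro ⟨h1, h2⟩
      refine ⟨⟨?_, ((hL x).mp h1).1, fun h3 => h2 ((hL _).mpr ⟨h3, hL1 x h1⟩)⟩, h1⟩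
      rintro rfl
      exact ((hL x).mp h1).2 hs.1
    · rintro ⟨⟨h1, h2, h3⟩, h4⟩
      exact ⟨h4, fun h5 => h3 ((hL _).mp h5).1⟩
  have hσmem : ∀ x ∈ (reflInversions Δ β).erase β, σ x ∈ (reflInversions Δ β).erase β := by
    intro x hx
    rw [Finset.mem_erase, mem_reflInversions] at hx ⊢
    refine ⟨fun h => hx.1 ?_, affPos_neg.mpr hx.2.2, ?_⟩
    · rw [← hσσ x, h]
      simp [hσ]
    · simp only [hσ, smul_neg_affRoot, affRefl_smul_smul, affPos_neg, not_not]
      exact hx.2.1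
  -- Exactly one of `u x` and `u s_β x` could change sign only at `±u β`, which is excluded; hence
  -- they have the same sign, while `x` and `-s_β x` are both positive.
  have hσL : ∀ x ∈ (reflInversions Δ β).erase β, (σ x ∈ L ↔ x ∉ L) := by
    intro x hx
    rw [Finset.mem_erase, mem_reflInversions] at hx
    constructor
    · intro h1 h2
      have h3 := hL1 x h2
      rw [hL] at h1
      apply h1.2
      simp only [hσ, smul_neg_affRoot]
      exact affPos_neg.mpr h3
    · intro h1
      rw [hL]
      refine ⟨affPos_neg.mpr hx.2.2, ?_⟩
      simp only [hσ, smul_neg_affRoot, affPos_neg, not_not]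
      exact hL2 x hx.2.1 h1 hx.1
  have hC : ∑ x ∈ (reflInversions Δ β).erase β with x ∈ L, F (σ x)
      = ∑ x ∈ (reflInversions Δ β).erase β with x ∉ L, F x := by
    refine Finset.sum_bij' (fun x _ => σ x) (fun x _ => σ x) ?_ ?_ ?_ ?_ ?_
    · intro x hx
      rw [Finset.mem_filter] at hx ⊢
      refine ⟨hσmem x hx.1, fun h => ?_⟩
      exact (hσL x hx.1).mp h hx.2
    · intro x hx
      rw [Finset.mem_filter] at hx ⊢
      exact ⟨hσmem x hx.1, (hσL x hx.1).mpr hx.2⟩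
    · exact fun x _ => hσσ x
    · exact fun x _ => hσσ x
    · exact fun x _ => rfl
  have hN : negCount Δ ν (θ * P.reflectionPerm β.idx) L - negCount Δ ν θ L = ∑ x ∈ L, G x := by
    rw [negCount, negCount, ← Finset.sum_sub_distrib]
    refine Finset.sum_congr rfl fun x _ => ?_
    simp only [hG, Equiv.Perm.mul_apply]
    ring
  rw [← mul_sub, hN, ← Finset.sum_filter_add_sum_filter_not L (fun x => affRefl P β • x ∈ L),
    hA, zero_add, hB, Finset.mul_sum, Finset.sum_congr rfl fun x _ => hGF x,
    Finset.sum_add_distrib, hC, Finset.sum_filter_add_sum_filter_not]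

/-- The main inequality: the change of the number of inversions along one step of a path. -/
lemma negCount_step (ν : NuR P) {θ : Equiv.Perm ι} (hθ : IsRootSymm P θ) [P.IsRootSystem]
    {L : Finset (AffRoot P)} {u : ExtAffWeyl P} {β : AffRoot P}
    (hL : ∀ x, x ∈ L ↔ AffPos Δ x ∧ ¬ AffPos Δ (u • x)) (hs : IsAffSimple Δ (u • β))
    (hβ : Δ.IsPos β.idx) (hl : 0 ≤ β.lvl) :
    2 * negCount Δ ν θ L + 2 * (nuInd ν β.idx * (1 - posInd Δ (θ β.idx)))
      ≤ max 0 (-rhoRoot Δ ν (θ β.idx)) - β.lvl * rhoRoot Δ ν (θ β.idx)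
        + 2 * negCount Δ ν (θ * P.reflectionPerm β.idx) L := by
  have hpos : AffPos Δ β := by
    rcases hl.lt_or_eq with h | h
    · exact Or.inl h
    · exact Or.inr ⟨h.symm, hβ⟩
  have h1 := two_mul_negCount_sub Δ ν hθ hL hs hpos
  have hmem : β ∈ reflInversions Δ β := by
    rw [mem_reflInversions, affRefl_smul_self, affPos_neg, not_not]
    exact ⟨hpos, hpos⟩
  have h2 := Finset.add_sum_erase (reflInversions Δ β)
    (fun x => nuInd ν x.idx * sgn Δ (θ x.idx)) hmem
  have h3 := two_mul_sum_reflInversions Δ ν hθ (β := β)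
  have h4 := two_mul_nuInd_add_min_le Δ ν hθ hβ
  -- The term of `β` in the full sum over inversions is `±1` according to the sign of `θ β`.
  -- Combined with the `2` in the finite inequality it gives exactly the cost of `f` at `β`.
  rw [← h1] at h2
  have h7 := sgn_eq Δ (θ β.idx)
  rw [h7] at h2
  have h5 : max 0 (-rhoRoot Δ ν (θ β.idx)) = -min 0 (rhoRoot Δ ν (θ β.idx)) := by
    omega
  rw [h5]
  have h6 : min 0 (rhoRoot Δ ν (θ β.idx)) ≤ 0 := min_le_left _ _
  linarith

end AffineRoots

/-! ### Reduced words and their roots in an abstract reflection system. -/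

section Words

variable {S G X : Type*} [Group G] [MulAction G X]

/-- The product of the generators along a word. -/
def listProd (s : S → G) (L : List S) : G := (L.map s).prod

@[simp] lemma listProd_nil (s : S → G) : listProd s [] = 1 := rfl

@[simp] lemma listProd_cons (s : S → G) (j : S) (L : List S) :
    listProd s (j :: L) = s j * listProd s L := by simp [listProd]

@[simp] lemma listProd_append (s : S → G) (L M : List S) :
    listProd s (L ++ M) = listProd s L * listProd s M := by simp [listProd]

/-- A word is reduced if no shorter word has the same product. -/
def IsReducedWord (s : S → G) (L : List S) : Prop :=
  ∀ M : List S, listProd s M = listProd s L → L.length ≤ M.length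

lemma IsReducedWord.of_append {s : S → G} {A B C : List S} (h : IsReducedWord s (A ++ B ++ C)) :
    IsReducedWord s B := by
  intro M hM
  have h1 := h (A ++ M ++ C) (by simp [hM])
  simp only [List.length_append] at h1
  omega

lemma listProd_reverse {s : S → G} (hs : ∀ j, s j * s j = 1) (L : List S) :
    listProd s L.reverse = (listProd s L)⁻¹ := by
  induction L with
  | nil => simp
  | cons j L ih =>
    rw [List.reverse_cons, listProd_append, ih, listProd_cons, listProd_cons, listProd_nil,
      mul_one, mul_inv_rev, inv_eq_of_mul_eq_one_left (hs j)]

lemma IsReducedWord.reverse {s : S → G} (hs : ∀ j, s j * s j = 1) {L : List S}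
    (h : IsReducedWord s L) : IsReducedWord s L.reverse := by
  intro M hM
  have h1 := h M.reverse (by rw [listProd_reverse hs, hM, listProd_reverse hs, inv_inv])
  simpa using h1

/-- The sequence of roots of a word `j_l, …, j_1`, from the last to the first. -/
def rootList (s : S → G) (a : S → X) : List S → List X
  | [] => []
  | j :: L => (listProd s L)⁻¹ • a j :: rootList s a L

/-- A group acting on a set of roots with its simple roots and simple reflections. -/
structure IsReflSystem (neg : X → X) (Pos : X → Prop) (s : S → G) (a : S → X) : Prop where
  neg_neg : ∀ x, neg (neg x) = x
  smul_neg : ∀ (g : G) x, g • neg x = neg (g • x)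
  pos_neg : ∀ x, Pos (neg x) ↔ ¬ Pos x
  simple_pos : ∀ j, Pos (a j)
  smul_simple : ∀ j, s j • a j = neg (a j)
  smul_pos : ∀ j x, Pos x → x ≠ a j → Pos (s j • x)
  conj : ∀ (g : G) j k, g • a j = a k → s k = g * s j * g⁻¹
  mul_self : ∀ j, s j * s j = 1

variable {neg : X → X} {Pos : X → Prop} {s : S → G} {a : S → X}

lemma exists_append_of_mem_rootList {L : List S} {x : X} (h : x ∈ rootList s a L) :
    ∃ A k B, L = A ++ k :: B ∧ x = (listProd s B)⁻¹ • a k := by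
  induction L with
  | nil => simp [rootList] at h
  | cons j L ih =>
    rw [rootList, List.mem_cons] at h
    rcases h with h | h
    · exact ⟨[], j, L, rfl, h⟩
    · obtain ⟨A, k, B, h1, h2⟩ := ih h
      exact ⟨j :: A, k, B, by rw [h1]; rfl, h2⟩

/-- Some letter turns the image of `x` from positive to negative, and a simple reflection does this
only to its own simple root. Reducedness is not needed for this inclusion. -/
lemma IsReflSystem.mem_rootList_of (h : IsReflSystem neg Pos s a) {L : List S} {x : X}
    (hx : Pos x) (hL : ¬ Pos (listProd s L • x)) : x ∈ rootList s a L := by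
  induction L with
  | nil => simp [hx] at hL
  | cons j L ih =>
    rw [rootList, List.mem_cons]
    by_cases h1 : Pos (listProd s L • x)
    · left
      rw [listProd_cons, mul_smul] at hL
      rw [eq_inv_smul_iff]
      by_contra h2
      exact hL (h.smul_pos j _ h1 h2)
    · exact Or.inr (ih h1)

/-- The exchange condition. -/
lemma IsReflSystem.head_pos (h : IsReflSystem neg Pos s a) {j : S} {L : List S}
    (hr : IsReducedWord s (j :: L)) : Pos ((listProd s L)⁻¹ • a j) := by
  -- If this root were negative, its opposite would be an inversion of the tail, hence attached to a
  -- letter `k` in `L = A k B`. Transporting simple roots then identifies `s j` with a conjugate of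
  -- `s k`, so `j L` and `A B` have the same product, and the latter is shorter by two letters.
  by_contra hneg
  have h1 : neg ((listProd s L)⁻¹ • a j) ∈ rootList s a L := by
    refine h.mem_rootList_of ((h.pos_neg _).mpr hneg) ?_
    rw [h.smul_neg, smul_inv_smul, h.pos_neg, not_not]
    exact h.simple_pos j
  obtain ⟨A, k, B, hL, hB⟩ := exists_append_of_mem_rootList h1
  have h2 : (listProd s B * (listProd s L)⁻¹ * s j) • a j = a k := by
    rw [mul_smul, h.smul_simple, h.smul_neg, mul_smul, ← h.smul_neg, ← smul_inv_smul
      (listProd s B) (a k), ← hB, h.smul_neg]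
  have h3 := h.conj _ _ _ h2
  have h4 : listProd s L = listProd s A * s k * listProd s B := by
    rw [hL, listProd_append, listProd_cons, mul_assoc]
  have h5 : s k * listProd s B = listProd s B * (listProd s L)⁻¹ * s j * listProd s L := by
    rw [h3]
    simp only [mul_inv_rev, inv_inv, mul_assoc, mul_inv_cancel_left, inv_mul_cancel, mul_one]
  have h6 : s j * listProd s L = listProd s (A ++ B) := by
    have h7 : (s k * s k) * listProd s B
        = s k * (listProd s B * (listProd s L)⁻¹ * s j * listProd s L) := by
      rw [mul_assoc, h5]
    rw [h.mul_self, one_mul] at h7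
    rw [listProd_append]
    rw [h7, h4]
    simp only [mul_inv_rev, mul_assoc, mul_inv_cancel_left]
  have h8 := hr (A ++ B) (by rw [listProd_cons, h6])
  rw [hL] at h8
  simp only [List.length_cons, List.length_append] at h8
  omega

lemma IsReducedWord.tail {j : S} {L : List S} (h : IsReducedWord s (j :: L)) :
    IsReducedWord s L :=
  IsReducedWord.of_append (A := [j]) (C := []) (by simpa using h)

/-- The roots of a reduced word are the inversions of its product. -/
lemma IsReflSystem.mem_rootList_iff (h : IsReflSystem neg Pos s a) {L : List S}
    (hr : IsReducedWord s L) (x : X) :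
    x ∈ rootList s a L ↔ Pos x ∧ ¬ Pos (listProd s L • x) := by
  refine ⟨?_, fun hx => h.mem_rootList_of hx.1 hx.2⟩
  induction L with
  | nil => simp [rootList]
  | cons j L ih =>
    have hp := h.head_pos hr
    intro hx
    rw [rootList, List.mem_cons] at hx
    rw [listProd_cons, mul_smul]
    rcases hx with rfl | hx
    · refine ⟨hp, ?_⟩
      rw [smul_inv_smul, h.smul_simple, h.pos_neg, not_not]
      exact h.simple_pos j
    · obtain ⟨h1, h2⟩ := ih hr.tail hx
      refine ⟨h1, ?_⟩
      rw [← h.pos_neg, ← h.smul_neg]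
      refine h.smul_pos j _ ((h.pos_neg _).mpr h2) fun h3 => ?_
      rw [← h3, h.smul_neg, inv_smul_smul, h.pos_neg] at hp
      exact hp h1

lemma descProd_eq (s : S → G) (j : ℕ → S) (p r : ℕ) :
    descProd (fun i => s (j i)) p r = listProd s ((List.range' r (p + 1 - r)).reverse.map j) := by
  rw [descProd, listProd, List.map_map]
  rfl

lemma ascProd_eq (s : S → G) (j : ℕ → S) (r p : ℕ) :
    ascProd (fun i => s (j i)) r p = listProd s ((List.range' r (p + 1 - r)).map j) := by
  rw [ascProd, listProd, List.map_map]
  rfl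

lemma IsReducedDecomposition.isReducedWord {g : G} {j : ℕ → S} {l : ℕ}
    (h : IsReducedDecomposition s g j l) :
    IsReducedWord s ((List.range' 1 l).reverse.map j) := by
  intro M hM
  obtain ⟨h1, h2⟩ := h
  rw [wordProd, descProd_eq, Nat.add_sub_cancel, ← hM] at h1
  -- The definition of a reduced decomposition uses letters indexed by all of `ℕ`, starting at `1`.
  -- The default `j 0` is never read in this range.
  have h3 : (List.range' 1 M.length).reverse.map (fun i => M.reverse.getD (i - 1) (j 0)) = M := by
    rw [List.map_reverse, List.reverse_eq_iff]
    refine List.ext_getElem (by simp) fun n h4 h5 => ?_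
    simp only [List.getElem_map, List.getElem_range', one_mul, Nat.add_sub_cancel_left]
    exact List.getD_eq_getElem _ _ h5
  have h4 := h2 (fun i => M.reverse.getD (i - 1) (j 0)) M.length (by
    rw [h1, wordProd, descProd_eq, Nat.add_sub_cancel, h3])
  simpa using h4

lemma IsReducedDecomposition.isReducedWord_range' {g : G} {j : ℕ → S} {l : ℕ}
    (h : IsReducedDecomposition s g j l) {r n : ℕ} (hr : 1 ≤ r) (hn : r + n ≤ l + 1) :
    IsReducedWord s ((List.range' r n).reverse.map j) := by
  refine IsReducedWord.of_append (A := (List.range' (r + n) (l + 1 - (r + n))).reverse.map j)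
    (C := (List.range' 1 (r - 1)).reverse.map j) ?_
  have h1 : List.range' 1 l
      = List.range' 1 (r - 1) ++ (List.range' r n ++ List.range' (r + n) (l + 1 - (r + n))) := by
    rw [List.range'_append_1]
    have h2 := List.range'_append_1 (s := 1) (m := r - 1) (n := n + (l + 1 - (r + n)))
    rw [Nat.add_sub_cancel' hr] at h2
    rw [h2]
    congr 1
    omega
  have h3 := h.isReducedWord
  rw [h1] at h3
  simpa only [List.reverse_append, List.map_append] using h3

/-- The `λ`-sequence is based at the first letter of the whole word, `rootList` at the first letter
of the segment; they differ by the common factor `s_{j_1} ⋯ s_{j_{r-1}}`. -/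
lemma map_lambdaSeq_reverse (hs : ∀ j, s j * s j = 1) (j : ℕ → S) {r : ℕ} (hr : 1 ≤ r) (n : ℕ) :
    (List.range' r n).reverse.map (lambdaSeq s a j)
      = (rootList s a ((List.range' r n).reverse.map j)).map
        (fun x => listProd s ((List.range' 1 (r - 1)).map j) • x) := by
  induction n with
  | zero => rfl
  | succ n ih =>
    have h1 := List.range'_append_1 (s := 1) (m := r - 1) (n := n)
    rw [Nat.add_sub_cancel' hr] at h1
    rw [List.range'_1_concat, List.reverse_append, List.reverse_singleton, List.singleton_append,
      List.map_cons, List.map_cons, rootList, List.map_cons, ih, lambdaSeq, ascProd_eq,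
      List.map_reverse, listProd_reverse hs, inv_inv, ← mul_smul, ← listProd_append,
      ← List.map_append, h1]
    congr 6
    omega

/-- The same roots seen from the other end of the segment. The base point now lies beyond the
segment, so each letter acts on its own simple root, which is where the sign comes from. -/
lemma IsReflSystem.map_lambdaSeq (h : IsReflSystem neg Pos s a) (j : ℕ → S) {r : ℕ} (hr : 1 ≤ r)
    (n : ℕ) :
    (List.range' r n).map (lambdaSeq s a j)
      = (rootList s a ((List.range' r n).map j)).map
        (fun x => neg (listProd s ((List.range' 1 (r + n - 1)).map j) • x)) := by
  induction n generalizing r with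
  | zero => rfl
  | succ n ih =>
    have h1 := List.range'_append_1 (s := 1) (m := r - 1) (n := n + 1)
    rw [Nat.add_sub_cancel' hr, List.range'_succ] at h1
    have h2 : r + (n + 1) - 1 = r - 1 + (n + 1) := by omega
    have h3 : r + 1 + n - 1 = r - 1 + (n + 1) := by omega
    rw [List.range'_succ, List.map_cons, List.map_cons, rootList, List.map_cons, ih (by omega),
      h2, h3]
    congr 1
    rw [← h1, List.map_append, listProd_append, List.map_cons, listProd_cons, ← mul_smul,
      lambdaSeq, ascProd_eq]
    simp only [mul_assoc, mul_inv_cancel, mul_one]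
    rw [mul_smul, h.smul_simple, h.smul_neg, h.neg_neg]
    congr 5
    omega

end Words

/-! ### Costs of choices, and the minimality of the choice of `f` everywhere. -/

section Paths

variable {ι V N : Type*} [Fintype ι] [NormedAddCommGroup V] [InnerProductSpace ℝ V]
  [AddCommGroup N] [Module ℝ N] {P : RootPairing ι ℝ V N} [P.IsCrystallographic]
  [NormalizedForm P] (Δ : P.Base)

/-- Twice the order of a product of the terms of the operators `G̈`, chosen by the Boolean values,
in terms of the roots and of the symmetry by which the spinor component acts on them. -/
def pathCost (ν : NuR P) : Equiv.Perm ι → List (AffRoot P × Bool) → ℤ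
  | _, [] => 0
  | θ, (a, false) :: l => 2 * (nuInd ν a.idx * (1 - posInd Δ (θ a.idx))) + pathCost ν θ l
  | θ, (a, true) :: l => max 0 (-rhoRoot Δ ν (θ a.idx)) - a.lvl * rhoRoot Δ ν (θ a.idx)
      + pathCost ν (θ * P.reflectionPerm a.idx) l

/-- Lists of positive affine roots whose tails are sets of inversions that are extended by the
preceding member. -/
def IsConvexList : List (AffRoot P) → Prop
  | [] => True
  | a :: l => Δ.IsPos a.idx ∧ 0 ≤ a.lvl ∧ (∃ u : ExtAffWeyl P, IsAffSimple Δ (u • a) ∧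
      ∀ x, x ∈ l ↔ AffPos Δ x ∧ ¬ AffPos Δ (u • x)) ∧ IsConvexList l

variable {Δ}

lemma pathCost_false (ν : NuR P) (θ : Equiv.Perm ι) {l : List (AffRoot P)}
    (h : IsConvexList Δ l) :
    pathCost Δ ν θ (l.map fun a => (a, false)) = 2 * negCount Δ ν θ l.toFinset := by
  induction l with
  | nil => simp [pathCost, negCount]
  | cons a l ih =>
    obtain ⟨-, -, ⟨u, hu, hl⟩, h⟩ := h
    -- The head is not an inversion of `u`, as `u a` is positive; thus the list has no repetitions
    -- and sums over it are sums over a set.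
    have ha : a ∉ l.toFinset := by
      rw [List.mem_toFinset, hl]
      exact fun h1 => h1.2 hu.1
    rw [List.map_cons, pathCost, ih h, List.toFinset_cons, negCount, negCount,
      Finset.sum_insert ha]
    ring

/-- The choice of the functions `f` in all factors minimizes the order. -/
lemma pathCost_false_le [P.IsRootSystem] (ν : NuR P) {θ : Equiv.Perm ι} (hθ : IsRootSymm P θ)
    {l : List (AffRoot P × Bool)} (h : IsConvexList Δ (l.map Prod.fst)) :
    pathCost Δ ν θ (l.map fun a => (a.1, false)) ≤ pathCost Δ ν θ l := by
  induction l generalizing θ with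
  | nil => simp [pathCost]
  | cons a l ih =>
    obtain ⟨a, c⟩ := a
    have h0 := h
    obtain ⟨hp, hl, ⟨u, hu, hL⟩, h⟩ := h
    cases c with
    | false =>
      simp only [List.map_cons, pathCost]
      linarith [ih hθ h]
    | true =>
      have hs := hθ.mul (isRootSymm_reflectionPerm (P := P) a.idx)
      -- Applied with the reflected symmetry, induction replaces all later choices by `f`. Two pure
      -- products of `f` remain, and `negCount_step` compares them.
      have h1 := ih hs h
      have hm : ∀ m : List (AffRoot P × Bool), (m.map fun a => (a.1, false))
          = (m.map Prod.fst).map fun a => (a, false) := fun m => by simp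
      rw [hm, pathCost_false ν _ h] at h1
      rw [hm, List.map_cons, List.map_cons]
      simp only [pathCost]
      rw [pathCost_false ν _ h]
      have h2 := negCount_step Δ ν hθ (L := (l.map Prod.fst).toFinset)
        (fun x => by rw [List.mem_toFinset]; exact hL x) hu hp hl
      linarith

/-- The image of an affine root under a symmetry of the nonaffine components. -/
def mapIdx (η : Equiv.Perm ι) (a : AffRoot P) : AffRoot P := ⟨η a.idx, a.lvl⟩

@[simp] lemma mapIdx_idx (η : Equiv.Perm ι) (a : AffRoot P) : (mapIdx η a).idx = η a.idx := rfl

@[simp] lemma mapIdx_lvl (η : Equiv.Perm ι) (a : AffRoot P) : (mapIdx η a).lvl = a.lvl := rfl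

/-- A symmetry of the roots in the list is absorbed into `θ`. Since minimality holds for every `θ`,
it suffices to treat lists of inversions up to symmetry. -/
lemma pathCost_mapIdx (ν : NuR P) (θ : Equiv.Perm ι) {η : Equiv.Perm ι} (hη : IsRootSymm P η)
    (l : List (AffRoot P × Bool)) :
    pathCost Δ ν θ (l.map fun a => (mapIdx η a.1, a.2)) = pathCost Δ ν (θ * η) l := by
  induction l generalizing θ with
  | nil => rfl
  | cons a l ih =>
    obtain ⟨a, c⟩ := a
    cases c with
    | false =>
      simp only [List.map_cons, pathCost, ih, mapIdx_idx, hη.nuInd, Equiv.Perm.mul_apply]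
    | true =>
      simp only [List.map_cons, pathCost, ih, mapIdx_idx, mapIdx_lvl, Equiv.Perm.mul_apply]
      congr 2
      ext i
      simp [hη.reflection]

end Paths

/-! ### The finite Weyl group as a reflection system. -/

section ReflectionSystems

variable {ι V N : Type*} [Fintype ι] [NormedAddCommGroup V] [InnerProductSpace ℝ V]
  [AddCommGroup N] [Module ℝ N] {P : RootPairing ι ℝ V N} [P.IsRootSystem] [P.IsCrystallographic]
  [P.IsReduced] [NormalizedForm P] (Δ : P.Base)

lemma isReflSystem_weyl :
    IsReflSystem (negIdx P) Δ.IsPos (simpleRefl Δ) (fun k : Δ.support => (k : ι)) where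
  neg_neg := negIdx_negIdx
  smul_neg := weyl_smul_negIdx
  pos_neg := isPos_negIdx Δ
  simple_pos j := RootPairing.Base.isPos_of_mem_support j.2
  smul_simple j := refl_smul _ _
  smul_pos j x hx hne := by
    rw [simpleRefl, refl_smul]
    exact hx.reflectionPerm j.2 hne
  conj g j k h := by
    rw [simpleRefl, simpleRefl, ← h, refl_weyl_smul]
  mul_self j := refl_mul_self _

lemma isAffSimple_ofRoot {i : ι} (hi : i ∈ Δ.support) :
    IsAffSimple Δ (AffRoot.ofRoot P i) := by
  refine ⟨Or.inr ⟨rfl, RootPairing.Base.isPos_of_mem_support hi⟩, fun x hx hne => ?_⟩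
  have hl : (affRefl P (AffRoot.ofRoot P i) • x).lvl = x.lvl := by
    rw [affRefl_smul_lvl]
    simp [AffRoot.ofRoot]
  rcases hx with hx | ⟨h1, h2⟩
  · exact Or.inl (hl ▸ hx)
  · refine Or.inr ⟨hl.trans h1, ?_⟩
    rw [affRefl_smul_idx]
    exact h2.reflectionPerm hi fun h => hne (AffRoot.ext h h1)

/-- Elements of `W` preserve levels, so their affine inversions all have level `0` and coincide with
the finite ones. -/
lemma isConvexList_ofRoot {L : List Δ.support} (hr : IsReducedWord (simpleRefl Δ) L) :
    IsConvexList Δ ((rootList (simpleRefl Δ) (fun k : Δ.support => (k : ι)) L).map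
      (AffRoot.ofRoot P)) := by
  induction L with
  | nil => exact trivial
  | cons j L ih =>
    have h := isReflSystem_weyl Δ
    refine ⟨h.head_pos hr, le_rfl, ⟨⟨0, listProd (simpleRefl Δ) L⟩, ?_, fun x => ?_⟩, ih hr.tail⟩
    · have h1 : (⟨0, listProd (simpleRefl Δ) L⟩ : ExtAffWeyl P) •
          AffRoot.ofRoot P ((listProd (simpleRefl Δ) L)⁻¹ • (j : ι)) = AffRoot.ofRoot P j := by
        apply AffRoot.ext
        · exact smul_inv_smul _ _
        · rw [smul_lvl]
          change (0 : ℤ) - coPair P 0 _ = 0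
          rw [coPair_zero, sub_zero]
      rw [h1]
      exact isAffSimple_ofRoot Δ j.2
    · have h1 : ((⟨0, listProd (simpleRefl Δ) L⟩ : ExtAffWeyl P) • x).lvl = x.lvl := by
        rw [smul_lvl]
        change x.lvl - coPair P 0 _ = _
        rw [coPair_zero, sub_zero]
      rw [List.mem_map]
      simp only [h.mem_rootList_iff hr.tail, AffPos, h1, smul_idx]
      constructor
      · rintro ⟨i, ⟨h2, h3⟩, rfl⟩
        refine ⟨Or.inr ⟨rfl, h2⟩, ?_⟩
        simpa [AffRoot.ofRoot] using h3
      · rintro ⟨h2, h3⟩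
        push Not at h3
        rcases h2 with h2 | h2
        · exact absurd h2 (not_lt.mpr h3.1)
        · exact ⟨x.idx, ⟨h2.2, h3.2 h2.1⟩, AffRoot.ext rfl h2.1.symm⟩

end ReflectionSystems

/-! ### The affine Weyl group: the root `α_0`, the group `Π`, and dominant weights. -/

section MaximalShortRoot

variable {ι V N : Type*} [Fintype ι] [NormedAddCommGroup V] [InnerProductSpace ℝ V]
  [AddCommGroup N] [Module ℝ N] {P : RootPairing ι ℝ V N} [P.IsRootSystem] [P.IsCrystallographic]
  [P.IsReduced] [NormalizedForm P] (Δ : P.Base)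

/-- The height extends to a linear function equal to `1` on the simple roots, hence nonnegative on
their sums. -/
lemma height_le_of_sub_mem {i k : ι}
    (h : P.root i - P.root k ∈ AddSubmonoid.closure (P.root '' Δ.support)) :
    Δ.height k ≤ Δ.height i := by
  let ht : V →ₗ[ℝ] ℝ := Δ.toWeightBasis.constr ℝ fun _ => (1 : ℝ)
  have hs : ∀ j ∈ Δ.support, ht (P.root j) = 1 := by
    intro j hj
    have h1 := Δ.toWeightBasis.constr_basis ℝ (fun _ => (1 : ℝ)) ⟨j, hj⟩
    rwa [Δ.toWeightBasis_apply] at h1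
  have hr : ∀ i, ht (P.root i) = Δ.height i := by
    intro i
    obtain ⟨f, -, -, hf⟩ := Δ.exists_root_eq_sum_int i
    rw [RootPairing.Base.height_eq_sum hf, hf, map_sum]
    push_cast
    refine Finset.sum_congr rfl fun j hj => ?_
    rw [map_zsmul, hs j hj]
    simp
  have hc : ∀ x ∈ AddSubmonoid.closure (P.root '' Δ.support), 0 ≤ ht x := by
    intro x hx
    induction hx using AddSubmonoid.closure_induction with
    | mem x hx =>
      obtain ⟨j, hj, rfl⟩ := hx
      rw [hs j hj]
      exact zero_le_one
    | zero => simp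
    | add x y _ _ hx hy => rw [map_add]; exact add_nonneg hx hy
  have h1 := hc _ h
  rw [map_sub, hr, hr, sub_nonneg] at h1
  exact_mod_cast h1

variable {Δ} {ϑ : ι}

lemma IsMaximalShortRoot.isPos (hϑ : IsMaximalShortRoot Δ ϑ) : Δ.IsPos ϑ := by
  have h1 := height_le_of_sub_mem Δ (hϑ.2 (negIdx P ϑ) (by
    rw [negIdx, nu_reflectionPerm]; exact hϑ.1))
  have h2 : Δ.height (negIdx P ϑ) = -Δ.height ϑ := Δ.height_reflectionPerm_self ϑ
  rw [RootPairing.Base.isPos_iff']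
  omega

/-- The short root `s_i ϑ` cannot be higher than `ϑ`. -/
lemma IsMaximalShortRoot.pairing_nonneg (hϑ : IsMaximalShortRoot Δ ϑ) {i : ι} (hi : Δ.IsPos i) :
    0 ≤ P.pairingIn ℤ ϑ i := by
  have h1 := height_le_of_sub_mem Δ (hϑ.2 (P.reflectionPerm i ϑ) (by
    rw [nu_reflectionPerm]; exact hϑ.1))
  rw [height_reflectionPerm] at h1
  rw [RootPairing.Base.isPos_iff] at hi
  by_contra h
  nlinarith

lemma IsMaximalShortRoot.pairing_nonpos (hϑ : IsMaximalShortRoot Δ ϑ) {i : ι}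
    (hi : ¬ Δ.IsPos i) : P.pairingIn ℤ ϑ i ≤ 0 := by
  have h1 := hϑ.pairing_nonneg ((isPos_negIdx Δ i).mpr hi)
  rw [pairingIn_negIdx_right] at h1
  omega

lemma IsMaximalShortRoot.neg_one_le_pairing (hϑ : IsMaximalShortRoot Δ ϑ) {i : ι}
    (hi : i ≠ negIdx P ϑ) : -1 ≤ P.pairingIn ℤ ϑ i := by
  by_contra h
  have h1 : P.pairingIn ℤ ϑ i ≤ -2 := by omega
  have h2 : (P.pairingIn ℤ ϑ i : ℝ) ≤ -2 := by exact_mod_cast h1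
  have h3 : 1 ≤ nu P i := by
    have := NormalizedForm.two_le (P := P) i
    rw [nu]
    linarith
  -- The square of the length of `ϑ + α` is `2 + 2 ν_α (1 + (ϑ, α^∨)) ≤ 2 - 2 ν_α ≤ 0`, so a pairing
  -- below `-1` forces `α = -ϑ`.
  have h4 : inner ℝ (P.root ϑ + P.root i) (P.root ϑ + P.root i) ≤ (0 : ℝ) := by
    rw [real_inner_add_add_self, two_inner_root ϑ i]
    have h5 : inner ℝ (P.root ϑ) (P.root ϑ) = 2 * nu P ϑ := by rw [nu]; ring
    have h6 : inner ℝ (P.root i) (P.root i) = 2 * nu P i := by rw [nu]; ring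
    rw [h5, h6, hϑ.1]
    nlinarith
  have h5 : P.root ϑ + P.root i = 0 := by
    rw [← inner_self_eq_zero (𝕜 := ℝ)]
    exact le_antisymm h4 real_inner_self_nonneg
  apply hi
  apply P.root.injective
  rw [root_negIdx]
  exact eq_neg_of_add_eq_zero_right h5

/-- The reflection `s_0` adds `(ϑ, α^∨)` to the level. This is nonnegative for positive `α`, and at
least `-1` for negative `α` except for `α = -ϑ`, where it is `-2`. If a positive level drops to `0`,
the reflected nonaffine part is positive. -/
lemma IsMaximalShortRoot.isAffSimple (hϑ : IsMaximalShortRoot Δ ϑ) :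
    IsAffSimple Δ (⟨negIdx P ϑ, 1⟩ : AffRoot P) := by
  refine ⟨Or.inl one_pos, fun x hx hne => ?_⟩
  have hl : (affRefl P (⟨negIdx P ϑ, 1⟩ : AffRoot P) • x).lvl
      = x.lvl + P.pairingIn ℤ ϑ x.idx := by
    rw [affRefl_smul_lvl, pairingIn_negIdx_left]
    ring
  have hi : (affRefl P (⟨negIdx P ϑ, 1⟩ : AffRoot P) • x).idx = P.reflectionPerm ϑ x.idx := by
    rw [affRefl_smul_idx, reflectionPerm_negIdx_left]
  rw [AffPos, hl, hi]
  have hl0 := hx.lvl_nonneg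
  by_cases hp : Δ.IsPos x.idx
  · have h1 := hϑ.pairing_nonneg hp
    by_cases h0 : P.pairingIn ℤ ϑ x.idx = 0
    · have h2 : P.reflectionPerm ϑ x.idx = x.idx := by
        apply P.root.injective
        rw [root_reflectionPerm_eq]
        have h3 : P.pairingIn ℤ x.idx ϑ = 0 := by
          rwa [P.pairingIn_eq_zero_iff]
        simp [h3]
      rw [h0, h2, add_zero]
      exact hx
    · left; omega
  · have hx1 : 0 < x.lvl := by
      rcases hx with hx | hx
      · exact hx
      · exact absurd hx.2 hp
    by_cases h0 : x.idx = negIdx P ϑ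
    · have h1 : x.lvl ≠ 1 := fun h => hne (AffRoot.ext h0 h)
      have h2 : P.pairingIn ℤ ϑ x.idx = -2 := by
        rw [h0, pairingIn_negIdx_right, P.pairingIn_same]
      have h3 : Δ.IsPos (P.reflectionPerm ϑ x.idx) := by
        rw [h0, reflectionPerm_negIdx_right]
        change Δ.IsPos (negIdx P (negIdx P ϑ))
        rw [negIdx_negIdx]
        exact hϑ.isPos
      have h4 : x.lvl + P.pairingIn ℤ ϑ x.idx = 0 ∨ 0 < x.lvl + P.pairingIn ℤ ϑ x.idx := by omega
      tauto
    · have h1 := hϑ.neg_one_le_pairing h0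
      by_cases h2 : x.lvl + P.pairingIn ℤ ϑ x.idx = 0
      · refine Or.inr ⟨h2, ?_⟩
        by_contra h3
        have h4 := hϑ.pairing_nonpos h3
        rw [pairingIn_reflectionPerm_right] at h4
        omega
      · left; omega

lemma IsMaximalShortRoot.isAffSimple_affSimple (hϑ : IsMaximalShortRoot Δ ϑ)
    (j : Option Δ.support) : IsAffSimple Δ (affSimple Δ ϑ j) := by
  cases j with
  | none => exact hϑ.isAffSimple
  | some i => exact isAffSimple_ofRoot Δ i.2

lemma IsMaximalShortRoot.isReflSystem (hϑ : IsMaximalShortRoot Δ ϑ) :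
    IsReflSystem AffRoot.neg (AffPos Δ) (affSimpleRefl Δ ϑ) (affSimple Δ ϑ) where
  neg_neg := neg_neg_affRoot
  smul_neg := smul_neg_affRoot
  pos_neg _ := affPos_neg
  simple_pos j := (hϑ.isAffSimple_affSimple j).1
  smul_simple j := affRefl_smul_self _
  smul_pos j := (hϑ.isAffSimple_affSimple j).2
  conj g j k h := by
    rw [affSimpleRefl, affSimpleRefl, ← h, affRefl_smul]
  mul_self j := affRefl_mul_self _

lemma isConvexList_rootList (hϑ : IsMaximalShortRoot Δ ϑ) {L : List (Option Δ.support)}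
    (hr : IsReducedWord (affSimpleRefl Δ ϑ) L)
    (hL : ∀ x ∈ rootList (affSimpleRefl Δ ϑ) (affSimple Δ ϑ) L, Δ.IsPos x.idx) :
    IsConvexList Δ (rootList (affSimpleRefl Δ ϑ) (affSimple Δ ϑ) L) := by
  induction L with
  | nil => exact trivial
  | cons j L ih =>
    have h := hϑ.isReflSystem
    refine ⟨hL _ (List.mem_cons_self ..), (h.head_pos hr).lvl_nonneg,
      ⟨listProd (affSimpleRefl Δ ϑ) L, ?_, fun x => h.mem_rootList_iff hr.tail x⟩,
      ih hr.tail fun x hx => hL x (List.mem_cons_of_mem _ hx)⟩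
    rw [smul_inv_smul]
    exact hϑ.isAffSimple_affSimple j

/-- By irreducibility the orbit of `ϑ` spans the space, so no root is orthogonal to all of it. -/
lemma exists_weyl_pairing_ne_zero [P.IsIrreducible] (ϑ i : ι) :
    ∃ w : P.weylGroup, P.pairingIn ℤ ϑ (w • i) ≠ 0 := by
  by_contra! h
  have h1 : ∀ v ∈ MulAction.orbit P.weylGroup (P.root ϑ), inner ℝ (P.root i) v = 0 := by
    rintro - ⟨w, rfl⟩
    change inner ℝ (P.root i) (w • P.root ϑ) = 0
    have h2 := inner_weyl P w (P.root (w⁻¹ • i)) (P.root ϑ)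
    rw [weyl_root, smul_inv_smul] at h2
    rw [h2, real_inner_comm, two_inner_root, h w⁻¹, Int.cast_zero, zero_mul]
  have h2 : Submodule.span ℝ (MulAction.orbit P.weylGroup (P.root ϑ))
      ≤ LinearMap.ker (innerₛₗ ℝ (P.root i)) :=
    Submodule.span_le.mpr fun v hv => h1 v hv
  rw [P.span_orbit_eq_top] at h2
  have h3 : inner ℝ (P.root i) (P.root i) = (0 : ℝ) := h2 (Submodule.mem_top (x := P.root i))
  have h4 := NormalizedForm.two_le (P := P) i
  linarith

lemma smul_mem_range_affSimple {π : ExtAffWeyl P} (hπ : π ∈ diagramGroup Δ ϑ)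
    (j : Option Δ.support) : ∃ k, π • affSimple Δ ϑ j = affSimple Δ ϑ k := by
  have h : π • affSimple Δ ϑ j ∈ Set.range (affSimple Δ ϑ) := by
    rw [← (show (fun a => π • a) '' Set.range (affSimple Δ ϑ) = _ from hπ)]
    exact ⟨_, ⟨j, rfl⟩, rfl⟩
  obtain ⟨k, hk⟩ := h
  exact ⟨k, hk.symm⟩

lemma inv_mem_diagramGroup {π : ExtAffWeyl P} (hπ : π ∈ diagramGroup Δ ϑ) :
    π⁻¹ ∈ diagramGroup Δ ϑ := by
  change (fun a => π⁻¹ • a) '' Set.range (affSimple Δ ϑ) = Set.range (affSimple Δ ϑ)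
  nth_rw 1 [← (show (fun a => π • a) '' Set.range (affSimple Δ ϑ) = _ from hπ)]
  rw [Set.image_image]
  simp

lemma affRefl_ofRoot (i : ι) : affRefl P (AffRoot.ofRoot P i) = ⟨0, refl P i⟩ := by
  apply ExtAffWeyl.ext
  · change -((0 : ℤ) • rootWt P i) = 0
    rw [zero_smul, neg_zero]
  · rfl

/-- The elements that permute the affine simple roots preserve positivity. -/
lemma IsMaximalShortRoot.affPos_smul [P.IsIrreducible] (hϑ : IsMaximalShortRoot Δ ϑ)
    {π : ExtAffWeyl P} (hπ : π ∈ diagramGroup Δ ϑ) {x : AffRoot P} (hx : AffPos Δ x) :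
    AffPos Δ (π • x) := by
  by_contra hneg
  -- No length function is used. As `π` conjugates simple reflections to simple reflections and
  -- preserves the positivity of simple roots, the set `B` of its inversions is stable under all
  -- `s_j`. Stability under translations then contradicts the bound on levels in `B`.
  set B : Set (AffRoot P) := {x | AffPos Δ x ∧ ¬ AffPos Δ (π • x)} with hB
  have h := hϑ.isReflSystem
  have hs : ∀ j, ∀ x ∈ B, affSimpleRefl Δ ϑ j • x ∈ B := by
    rintro j x ⟨h1, h2⟩
    obtain ⟨k, hk⟩ := smul_mem_range_affSimple hπ j
    refine ⟨h.smul_pos j x h1 ?_, ?_⟩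
    · rintro rfl
      rw [hk] at h2
      exact h2 (h.simple_pos k)
    · have h3 : π • affSimpleRefl Δ ϑ j • x = affSimpleRefl Δ ϑ k • π • x := by
        rw [h.conj π j k hk, ← mul_smul, ← mul_smul, inv_mul_cancel_right]
      rw [h3, ← affPos_neg, ← smul_neg_affRoot]
      refine h.smul_pos k _ (affPos_neg.mpr h2) fun h4 => ?_
      rw [← hk, ← smul_neg_affRoot] at h4
      have h5 := smul_left_cancel π h4
      have h6 := h.simple_pos j
      rw [← h5, affPos_neg] at h6
      exact h6 h1
  have hr : ∀ i : ι, ∀ x ∈ B, affRefl P (AffRoot.ofRoot P i) • x ∈ B := by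
    intro i
    refine Δ.induction_reflect i
      (p := fun i => ∀ x ∈ B, affRefl P (AffRoot.ofRoot P i) • x ∈ B) ?_ ?_ ?_
    · intro i hi x hx
      have h1 : AffRoot.ofRoot P (P.reflectionPerm i i) = (AffRoot.ofRoot P i).neg :=
        AffRoot.ext rfl neg_zero.symm
      rw [h1, affRefl_neg]
      exact hi x hx
    · intro i hi x hx
      exact hs (some ⟨i, hi⟩) x hx
    · intro i j hi hj x hx
      have h1 : AffRoot.ofRoot P (P.reflectionPerm j i)
          = affRefl P (AffRoot.ofRoot P j) • AffRoot.ofRoot P i := by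
        apply AffRoot.ext
        · rw [affRefl_smul_idx]; rfl
        · rw [affRefl_smul_lvl]; simp [AffRoot.ofRoot]
      rw [h1, affRefl_smul, mul_smul, mul_smul, inv_eq_of_mul_eq_one_left (affRefl_mul_self _)]
      exact hs (some ⟨j, hj⟩) _ (hi _ (hs (some ⟨j, hj⟩) x hx))
  have hw : ∀ w : P.weylGroup, ∀ x ∈ B, (⟨0, w⟩ : ExtAffWeyl P) • x ∈ B := by
    rintro ⟨w, hw⟩
    induction hw using RootPairing.weylGroup.induction with
    | mem i =>
      intro x hx
      have h1 := hr i x hx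
      rwa [affRefl_ofRoot] at h1
    | one => intro x hx; exact (one_smul (ExtAffWeyl P) x).symm ▸ hx
    | mul w₁ w₂ h₁ h₂ ih₁ ih₂ =>
      intro x hx
      have h1 : (⟨0, ⟨w₁ * w₂, mul_mem h₁ h₂⟩⟩ : ExtAffWeyl P)
          = ⟨0, ⟨w₁, h₁⟩⟩ * ⟨0, ⟨w₂, h₂⟩⟩ := by
        apply ExtAffWeyl.ext
        · rw [mul_trans, smul_zero, add_zero]
        · rfl
      rw [h1, mul_smul]
      exact ih₁ _ (ih₂ _ hx)
  obtain ⟨w, hwi⟩ := exists_weyl_pairing_ne_zero (P := P) ϑ x.idx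
  set y : AffRoot P := (⟨0, w⟩ : ExtAffWeyl P) • x with hy
  have hyB : y ∈ B := hw w x ⟨hx, hneg⟩
  set n : ℤ := P.pairingIn ℤ ϑ y.idx with hn
  have hn0 : n ≠ 0 := hwi
  -- The product `s_ϑ s_0` is a translation: it fixes the nonaffine part and shifts the level by
  -- `(ϑ, α^∨)`.
  have hup : ∀ m : ℤ, (⟨y.idx, m⟩ : AffRoot P) ∈ B → (⟨y.idx, m + n⟩ : AffRoot P) ∈ B := by
    intro m hm
    have h1 := hr ϑ _ (hs none _ hm)
    convert h1 using 1
    apply AffRoot.ext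
    · rw [affSimpleRefl, affSimple, affRefl_smul_idx, affRefl_smul_idx,
        reflectionPerm_negIdx_left]
      exact (P.reflectionPerm_self ϑ y.idx).symm
    · simp only [affSimpleRefl, affSimple, AffRoot.ofRoot, affRefl_smul_lvl, affRefl_smul_idx,
        pairingIn_negIdx_left, hn]
      ring
  have hdown : ∀ m : ℤ, (⟨y.idx, m⟩ : AffRoot P) ∈ B → (⟨y.idx, m - n⟩ : AffRoot P) ∈ B := by
    intro m hm
    have h1 := hs none _ (hr ϑ _ hm)
    convert h1 using 1
    apply AffRoot.ext
    · rw [affSimpleRefl, affSimple, affRefl_smul_idx, affRefl_smul_idx,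
        reflectionPerm_negIdx_left]
      exact (P.reflectionPerm_self ϑ y.idx).symm
    · simp only [affSimpleRefl, affSimple, AffRoot.ofRoot, affRefl_smul_lvl, affRefl_smul_idx,
        pairingIn_negIdx_left, pairingIn_reflectionPerm_right, hn]
      ring
  have hnn : ∀ m : ℤ, (⟨y.idx, m⟩ : AffRoot P) ∈ B → 0 ≤ m := fun m hm => hm.1.lvl_nonneg
  have hall : ∀ k : ℕ, (⟨y.idx, y.lvl + k * n⟩ : AffRoot P) ∈ B ∧
      (⟨y.idx, y.lvl - k * n⟩ : AffRoot P) ∈ B := by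
    intro k
    induction k with
    | zero => simpa using hyB
    | succ k ih =>
      have h1 := hup _ ih.1
      have h2 := hdown _ ih.2
      push_cast
      rw [add_mul, one_mul, ← add_assoc, ← sub_sub]
      exact ⟨h1, h2⟩
  -- One more shift than the level itself makes the level negative in one of the two directions, as
  -- `n` is a nonzero integer.
  obtain ⟨h1, h2⟩ := hall (y.lvl.toNat + 1)
  have h3 := hnn _ h1
  have h4 := hnn _ h2
  push_cast at h3 h4
  have h5 : 0 ≤ y.lvl := hyB.1.lvl_nonneg
  rw [Int.toNat_of_nonneg h5] at h3 h4
  rcases lt_or_gt_of_ne hn0 with h6 | h6 <;> nlinarith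

/-- The pairing with coroots is not additive in the root, so the induction over sums of simple roots
uses the form `(b, α)`, which has the same sign. -/
lemma IsDominant.coPair_nonneg {b : weightLattice P} (hb : IsDominant Δ b) {i : ι}
    (hi : Δ.IsPos i) : 0 ≤ coPair P b i := by
  have hiff : ∀ i, 0 ≤ coPair P b i ↔ 0 ≤ inner ℝ (b : V) (P.root i) := by
    intro i
    have h0 := NormalizedForm.two_le (P := P) i
    have h1 := coPair_spec P b i
    rw [div_eq_iff (by linarith)] at h1
    rw [← Int.cast_nonneg_iff (R := ℝ)]
    constructor <;> intro h2 <;> nlinarith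
  rw [hiff]
  refine hi.induction_on_add (p := fun i => 0 ≤ inner ℝ (b : V) (P.root i)) ?_ ?_
  · exact fun i hi => (hiff i).mp (hb i hi)
  · intro i j k hk h1 h2
    rw [hk, inner_add_right]
    exact add_nonneg h1 ((hiff j).mp (hb j h2))

/-- The inversions of a dominant weight have positive nonaffine components. -/
lemma IsDominant.isPos_idx [P.IsIrreducible] (hϑ : IsMaximalShortRoot Δ ϑ)
    {b : weightLattice P} (hb : IsDominant Δ b) {π v : ExtAffWeyl P}
    (hπ : π ∈ diagramGroup Δ ϑ) (hv : (⟨b, 1⟩ : ExtAffWeyl P) = π * v) {x : AffRoot P}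
    (hx : AffPos Δ x) (hvx : ¬ AffPos Δ (v • x)) : Δ.IsPos x.idx := by
  by_contra hneg
  apply hvx
  have h1 : v • x = π⁻¹ • (⟨b, 1⟩ : ExtAffWeyl P) • x := by
    rw [hv, mul_smul, inv_smul_smul]
  rw [h1]
  -- A positive affine root over a negative `α` has level at least `1`, and `b` only raises it, as
  -- `(b, α^∨) ≤ 0`.
  refine hϑ.affPos_smul (inv_mem_diagramGroup hπ) (Or.inl ?_)
  rw [smul_lvl]
  change 0 < x.lvl - coPair P b ((1 : P.weylGroup) • x.idx)
  rw [one_smul]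
  have h2 := hb.coPair_nonneg ((isPos_negIdx Δ x.idx).mpr hneg)
  rw [coPair_negIdx] at h2
  rcases hx with hx | hx
  · omega
  · exact absurd hx.2 hneg

end MaximalShortRoot

/-! ### The order at `t_ν = 0` as a valuation. -/

section Orders

variable {ι V N : Type*} [NormedAddCommGroup V] [InnerProductSpace ℝ V]
  [AddCommGroup N] [Module ℝ N] {P : RootPairing ι ℝ V N}

/-- `n` is the lowest exponent of `t_ν^{1/2}` in the nonzero Laurent polynomial `p`. -/
def IsLowest (ν : NuR P) (p : Laurent P) (n : ℤ) : Prop :=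
  (∀ e ∈ p.coeff.support, n ≤ e.2.1 ν) ∧ ∃ e ∈ p.coeff.support, e.2.1 ν = n

variable {ν : NuR P}

lemma IsLowest.laurentOrd_eq {p : Laurent P} {n : ℤ} (h : IsLowest ν p n) :
    laurentOrd ν p = n := by
  obtain ⟨h1, e, he, hn⟩ := h
  have h2 : (p.coeff.support.inf fun e => ((e.2.1 ν : ℤ) : WithTop ℤ)) = (n : WithTop ℤ) := by
    apply le_antisymm
    · rw [← hn]
      exact Finset.inf_le (f := fun e : Expo P => ((e.2.1 ν : ℤ) : WithTop ℤ)) he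
    · exact Finset.le_inf fun e he => WithTop.coe_le_coe.mpr (h1 e he)
  rw [laurentOrd, h2, WithTop.untopD_coe]

lemma exists_isLowest (ν : NuR P) {p : Laurent P} (hp : p ≠ 0) : ∃ n, IsLowest ν p n := by
  have hne : p.coeff.support.Nonempty := by
    rw [Finsupp.support_nonempty_iff]
    exact fun h => hp (AddMonoidAlgebra.coeff_eq_zero.mp h)
  obtain ⟨e, he, h⟩ := p.coeff.support.exists_min_image (fun e => e.2.1 ν) hne
  exact ⟨e.2.1 ν, h, e, he, rfl⟩

lemma IsLowest.ne_zero {p : Laurent P} {n : ℤ} (h : IsLowest ν p n) : p ≠ 0 := by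
  rintro rfl
  obtain ⟨-, e, he, -⟩ := h
  simp at he

lemma IsLowest.unique {p : Laurent P} {m n : ℤ} (h : IsLowest ν p m) (h' : IsLowest ν p n) :
    m = n := by rw [← h.laurentOrd_eq, h'.laurentOrd_eq]

lemma IsLowest.mul {p q : Laurent P} {m n : ℤ} (hp : IsLowest ν p m) (hq : IsLowest ν q n) :
    IsLowest ν (p * q) (m + n) := by
  constructor
  · intro e he
    have h1 := AddMonoidAlgebra.support_coeff_mul_subset p q he
    rw [Finset.mem_add] at h1
    obtain ⟨a, ha, b, hb, rfl⟩ := h1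
    exact add_le_add (hp.1 a ha) (hq.1 b hb)
  · obtain ⟨a, ha, ham⟩ := hp.2
    obtain ⟨b, hb, hbn⟩ := hq.2
    -- A sum attained only once within the lowest layers of `p` and `q` is attained only once
    -- overall, so the corresponding monomial of `p * q` does not cancel.
    obtain ⟨a₀, ha₀, b₀, hb₀, hu⟩ := UniqueSums.uniqueAdd_of_nonempty
      (A := p.coeff.support.filter fun e => e.2.1 ν = m)
      (B := q.coeff.support.filter fun e => e.2.1 ν = n)
      ⟨a, Finset.mem_filter.mpr ⟨ha, ham⟩⟩ ⟨b, Finset.mem_filter.mpr ⟨hb, hbn⟩⟩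
    rw [Finset.mem_filter] at ha₀ hb₀
    have hu' : UniqueAdd p.coeff.support q.coeff.support a₀ b₀ := by
      intro c d hc hd hcd
      have h1 := hp.1 c hc
      have h2 := hq.1 d hd
      have h3 : c.2.1 ν + d.2.1 ν = a₀.2.1 ν + b₀.2.1 ν :=
        congrArg (fun e : Expo P => e.2.1 ν) hcd
      rw [ha₀.2, hb₀.2] at h3
      exact hu (Finset.mem_filter.mpr ⟨hc, by omega⟩) (Finset.mem_filter.mpr ⟨hd, by omega⟩) hcd
    refine ⟨a₀ + b₀, ?_, ?_⟩
    · rw [Finsupp.mem_support_iff, AddMonoidAlgebra.coeff_mul_add_of_uniqueAdd hu']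
      exact mul_ne_zero (Finsupp.mem_support_iff.mp ha₀.1) (Finsupp.mem_support_iff.mp hb₀.1)
    · change a₀.2.1 ν + b₀.2.1 ν = _
      rw [ha₀.2, hb₀.2]

lemma isLowest_single (e : Expo P) :
    IsLowest ν (AddMonoidAlgebra.single e 1) (e.2.1 ν) := by
  rw [IsLowest, AddMonoidAlgebra.coeff_single, Finsupp.support_single e one_ne_zero]
  simp

lemma isLowest_single_sub {e f : Expo P} (h : e ≠ f) :
    IsLowest ν (AddMonoidAlgebra.single e 1 - AddMonoidAlgebra.single f 1 : Laurent P)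
      (min (e.2.1 ν) (f.2.1 ν)) := by
  have hs : (AddMonoidAlgebra.single e 1 - AddMonoidAlgebra.single f 1 : Laurent P).coeff.support
      = {e, f} := by
    ext g
    rw [Finsupp.mem_support_iff, AddMonoidAlgebra.coeff_sub, AddMonoidAlgebra.coeff_single,
      AddMonoidAlgebra.coeff_single, Finsupp.sub_apply, Finsupp.single_apply,
      Finsupp.single_apply, Finset.mem_insert, Finset.mem_singleton]
    by_cases h1 : e = g <;> by_cases h2 : f = g
    · exact absurd (h1.trans h2.symm) h
    · simp [h1, h2]
    · simp [h1, h2]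
    · simp [h1, h2, Ne.symm h1, Ne.symm h2]
  rw [IsLowest, hs]
  refine ⟨by simp, ?_⟩
  rcases min_choice (e.2.1 ν) (f.2.1 ν) with h1 | h1 <;> rw [h1]
  · exact ⟨e, by simp, rfl⟩
  · exact ⟨f, by simp, rfl⟩

/-- `x` is a nonzero rational function of order `n` with respect to `t_ν^{1/2}`. -/
def HasOrd (ν : NuR P) (x : RatField P) (n : ℤ) : Prop :=
  ∃ (p q : Laurent P) (a b : ℤ), IsLowest ν p a ∧ IsLowest ν q b ∧
    x * algebraMap (Laurent P) (RatField P) q = algebraMap (Laurent P) (RatField P) p ∧ n = a - b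

lemma algebraMap_ne_zero {p : Laurent P} (hp : p ≠ 0) :
    algebraMap (Laurent P) (RatField P) p ≠ 0 := by
  rw [Ne, ← map_zero (algebraMap (Laurent P) (RatField P))]
  exact fun h => hp (IsFractionRing.injective (Laurent P) (RatField P) h)

lemma HasOrd.ne_zero {x : RatField P} {n : ℤ} (h : HasOrd ν x n) : x ≠ 0 := by
  obtain ⟨p, q, a, b, hp, hq, hx, rfl⟩ := h
  rintro rfl
  rw [zero_mul] at hx
  exact algebraMap_ne_zero hp.ne_zero hx.symm

/-- Cross-multiplication with the fraction chosen in `tOrd` shows independence of the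
representative. The division by `2` passes from `t_ν^{1/2}` to `t_ν`. -/
lemma HasOrd.tOrd_eq {x : RatField P} {n : ℤ} (h : HasOrd ν x n) :
    tOrd ν x = (((n : ℚ) / 2 : ℚ) : WithTop ℚ) := by
  have hx0 := h.ne_zero
  obtain ⟨p, q, a, b, hp, hq, hx, rfl⟩ := h
  rw [tOrd, if_neg hx0]
  set y := IsLocalization.sec (nonZeroDivisors (Laurent P)) x with hy
  have h1 : x * algebraMap (Laurent P) (RatField P) y.2 = algebraMap (Laurent P) (RatField P) y.1 :=
    IsLocalization.sec_spec (nonZeroDivisors (Laurent P)) x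
  have hy2 : (y.2 : Laurent P) ≠ 0 := nonZeroDivisors.coe_ne_zero y.2
  have hy1 : y.1 ≠ 0 := by
    intro h2
    rw [h2, map_zero, mul_eq_zero] at h1
    rcases h1 with h1 | h1
    · exact hx0 h1
    · exact algebraMap_ne_zero hy2 h1
  obtain ⟨c, hc⟩ := exists_isLowest ν hy1
  obtain ⟨d, hd⟩ := exists_isLowest ν hy2
  have h2 : y.1 * q = p * y.2 := by
    apply IsFractionRing.injective (Laurent P) (RatField P)
    rw [map_mul, map_mul, ← h1, ← hx]
    ring
  have h3 := hc.mul hq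
  rw [h2] at h3
  have h4 := h3.unique (hp.mul hd)
  rw [hc.laurentOrd_eq, hd.laurentOrd_eq]
  have h5 : c - d = a - b := by omega
  rw [h5]

lemma HasOrd.mul {x y : RatField P} {m n : ℤ} (hx : HasOrd ν x m) (hy : HasOrd ν y n) :
    HasOrd ν (x * y) (m + n) := by
  obtain ⟨p, q, a, b, hp, hq, h, rfl⟩ := hx
  obtain ⟨p', q', a', b', hp', hq', h', rfl⟩ := hy
  refine ⟨p * p', q * q', a + a', b + b', hp.mul hp', hq.mul hq', ?_, by ring⟩
  rw [map_mul, map_mul, ← h, ← h']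
  ring

lemma HasOrd.inv {x : RatField P} {n : ℤ} (hx : HasOrd ν x n) : HasOrd ν x⁻¹ (-n) := by
  have hx0 := hx.ne_zero
  obtain ⟨p, q, a, b, hp, hq, h, rfl⟩ := hx
  refine ⟨q, p, b, a, hq, hp, ?_, by ring⟩
  rw [← h, inv_mul_cancel_left₀ hx0]

lemma HasOrd.div {x y : RatField P} {m n : ℤ} (hx : HasOrd ν x m) (hy : HasOrd ν y n) :
    HasOrd ν (x / y) (m - n) := by
  rw [div_eq_mul_inv, sub_eq_add_neg]
  exact hx.mul hy.inv

lemma HasOrd.neg {x : RatField P} {n : ℤ} (hx : HasOrd ν x n) : HasOrd ν (-x) n := by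
  obtain ⟨p, q, a, b, hp, hq, h, rfl⟩ := hx
  refine ⟨-p, q, a, b, ?_, hq, ?_, rfl⟩
  · rw [IsLowest, AddMonoidAlgebra.coeff_neg, Finsupp.support_neg]
    exact hp
  · rw [neg_mul, h, map_neg]

lemma isLowest_one : IsLowest ν (1 : Laurent P) 0 := isLowest_single 0

lemma hasOrd_monomial (e : Expo P) : HasOrd ν (monomial P e) (e.2.1 ν) :=
  ⟨_, 1, _, 0, isLowest_single e, isLowest_one, by rw [map_one, mul_one]; rfl, by ring⟩

lemma hasOrd_monomial_sub {e f : Expo P} (h : e ≠ f) :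
    HasOrd ν (monomial P e - monomial P f) (min (e.2.1 ν) (f.2.1 ν)) :=
  ⟨_, 1, _, 0, isLowest_single_sub h, isLowest_one,
    by rw [map_one, mul_one, map_sub]; rfl, by ring⟩

lemma monAut_monomial (σ : Expo P ≃+ Expo P) (e : Expo P) :
    monAut P σ (monomial P e) = monomial P (σ e) := by
  change IsFractionRing.ringEquivOfRingEquiv _ (algebraMap _ _ _) = _
  rw [IsFractionRing.ringEquivOfRingEquiv_algebraMap, AddMonoidAlgebra.mapDomainRingEquiv_single]
  rfl

lemma IsLowest.mapDomain {σ : Expo P ≃+ Expo P} (hσ : ∀ e, (σ e).2.1 ν = e.2.1 ν)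
    {p : Laurent P} {n : ℤ} (h : IsLowest ν p n) :
    IsLowest ν (AddMonoidAlgebra.mapDomainRingEquiv ℚ σ p) n := by
  have hc : ∀ e, (AddMonoidAlgebra.mapDomainRingEquiv ℚ σ p).coeff e = p.coeff (σ.symm e) := by
    intro e
    rw [AddMonoidAlgebra.coeff_mapDomainRingEquiv]
    rfl
  constructor
  · intro e he
    rw [Finsupp.mem_support_iff, hc, ← Finsupp.mem_support_iff] at he
    have h1 := h.1 _ he
    rwa [← hσ, σ.apply_symm_apply] at h1
  · obtain ⟨e, he, hn⟩ := h.2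
    refine ⟨σ e, ?_, by rw [hσ, hn]⟩
    rw [Finsupp.mem_support_iff, hc, σ.symm_apply_apply]
    exact Finsupp.mem_support_iff.mp he

lemma HasOrd.monAut {σ : Expo P ≃+ Expo P} (hσ : ∀ e, (σ e).2.1 ν = e.2.1 ν)
    {x : RatField P} {n : ℤ} (h : HasOrd ν x n) : HasOrd ν (monAut P σ x) n := by
  obtain ⟨p, q, a, b, hp, hq, h, rfl⟩ := h
  refine ⟨_, _, a, b, hp.mapDomain hσ, hq.mapDomain hσ, ?_, rfl⟩
  have h1 : ∀ p, algebraMap (Laurent P) (RatField P) (AddMonoidAlgebra.mapDomainRingEquiv ℚ σ p)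
      = TodaDunkl.monAut P σ (algebraMap (Laurent P) (RatField P) p) := fun p =>
    (IsFractionRing.ringEquivOfRingEquiv_algebraMap _ p).symm
  rw [h1, h1, ← map_mul, h]

end Orders

/-! ### Spinor components of functions and their orders. -/

section Components

variable {ι V N : Type*} [Fintype ι] [NormedAddCommGroup V] [InnerProductSpace ℝ V]
  [AddCommGroup N] [Module ℝ N] {P : RootPairing ι ℝ V N} [P.IsRootSystem] [P.IsCrystallographic]
  [NormalizedForm P] (Δ : P.Base)

/-- The `w`-component of the spinor `ϱ(x)` after the conjugation. -/
def component (w : P.weylGroup) (x : RatField P) : RatField P :=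
  monAut P (rhoShift Δ) ((⟨0, w⁻¹⟩ : ExtAffWeyl P) • x)

lemma component_mul (w : P.weylGroup) (x y : RatField P) :
    component Δ w (x * y) = component Δ w x * component Δ w y := by
  rw [component, smul_mul', map_mul]
  rfl

lemma component_sub (w : P.weylGroup) (x y : RatField P) :
    component Δ w (x - y) = component Δ w x - component Δ w y := by
  rw [component, smul_sub, map_sub]
  rfl

lemma component_div (w : P.weylGroup) (x y : RatField P) :
    component Δ w (x / y) = component Δ w x / component Δ w y := by
  rw [component, div_eq_mul_inv, smul_mul', smul_inv'', map_mul, map_inv₀, ← div_eq_mul_inv]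
  rfl

lemma component_neg (w : P.weylGroup) (x : RatField P) :
    component Δ w (-x) = -component Δ w x := by
  rw [component, smul_neg, map_neg]
  rfl

lemma component_one (w : P.weylGroup) : component Δ w 1 = 1 := by
  rw [component, smul_one, map_one]

lemma component_monomial (w : P.weylGroup) (e : Expo P) :
    component Δ w (monomial P e) = monomial P (e.1, fun ν => e.2.1 ν - twoRho Δ ν (w⁻¹ • e.2.2),
      w⁻¹ • e.2.2) := by
  rw [component, smul_monomial, monAut_monomial]
  congr 1
  refine Prod.ext (Subtype.ext ?_) rfl
  change (e.1 : ℝ) - inner ℝ (w⁻¹ • (e.2.2 : V)) (0 : V) = e.1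
  rw [inner_zero_right, sub_zero]

/-- Translations do not change the orders. -/
lemma hasOrd_component_smul {ν : NuR P} {w : P.weylGroup} {g : ExtAffWeyl P} {x : RatField P}
    {n : ℤ} (h : HasOrd ν (component Δ (g.lin⁻¹ * w) x) n) :
    HasOrd ν (component Δ w (g • x)) n := by
  set b : weightLattice P := w⁻¹ • g.trans with hb
  -- The remaining translation multiplies monomials by powers of `q` only; it commutes with the
  -- conjugation and preserves the exponents of `t_ν`.
  have h1 : (⟨0, w⁻¹⟩ : ExtAffWeyl P) * g = ⟨b, 1⟩ * ⟨0, (g.lin⁻¹ * w)⁻¹⟩ := by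
    apply ExtAffWeyl.ext
    · simp [hb]
    · simp
  have h2 : component Δ w (g • x)
      = monAut P (DistribMulAction.toAddEquiv (Expo P) (⟨b, 1⟩ : ExtAffWeyl P))
        (component Δ (g.lin⁻¹ * w) x) := by
    rw [component, component, ← mul_smul, h1, mul_smul, ← monAut_trans]
    generalize (⟨0, (g.lin⁻¹ * w)⁻¹⟩ : ExtAffWeyl P) • x = y
    change monAut P _ (monAut P (DistribMulAction.toAddEquiv (Expo P) (⟨b, 1⟩ : ExtAffWeyl P)) y)
      = _
    rw [← monAut_trans]
    congr 2
    apply AddEquiv.ext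
    intro e
    refine Prod.ext rfl (Prod.ext ?_ rfl)
    funext μ
    change e.2.1 μ - twoRho Δ μ ((1 : P.weylGroup) • e.2.2) = e.2.1 μ - twoRho Δ μ e.2.2
    rw [one_smul]
  rw [h2]
  exact h.monAut fun e => rfl

lemma component_tvar (w : P.weylGroup) (i : ι) : component Δ w (tvar i) = tvar i := by
  have h0 : ∀ ν : NuR P, twoRho Δ ν 0 = 0 := fun ν => by simp [twoRho, coPair_zero]
  rw [tvar, component_monomial]
  congr 1
  refine Prod.ext rfl (Prod.ext ?_ (smul_zero _))
  funext ν
  change Pi.single (M := fun _ => ℤ) (nuR P i) 2 ν - twoRho Δ ν (w⁻¹ • 0) = _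
  rw [smul_zero, h0, sub_zero]

/-- The exponent of the `w`-component of `X_α̃`. -/
def expoX (w : P.weylGroup) (a : AffRoot P) : Expo P :=
  (a.lvl • ⟨nu P a.idx, nu_mem_qExp P a.idx⟩, fun ν => -rhoRoot Δ ν (w⁻¹ • a.idx),
    rootWt P (w⁻¹ • a.idx))

lemma component_Xvar (w : P.weylGroup) (a : AffRoot P) :
    component Δ w (Xvar a) = monomial P (expoX Δ w a) := by
  rw [Xvar, component_monomial]
  congr 1
  refine Prod.ext rfl (Prod.ext ?_ (weyl_smul_rootWt _ _))
  funext ν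
  change (0 : ℤ) - twoRho Δ ν (w⁻¹ • rootWt P a.idx) = _
  rw [weyl_smul_rootWt, zero_sub]
  rfl

lemma rootWt_ne_zero (i : ι) : rootWt P i ≠ 0 := by
  intro h
  have h1 : P.root i = 0 := congrArg Subtype.val h
  have h2 := NormalizedForm.two_le (P := P) i
  rw [h1, inner_zero_left] at h2
  linarith

lemma single_two_eq (ν : NuR P) (i : ι) :
    Pi.single (M := fun _ => ℤ) (nuR P i) 2 ν = 2 * nuInd ν i := by
  rw [nuInd]
  split_ifs with h
  · subst h; simp
  · simp [Pi.single_eq_of_ne' h]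

lemma hasOrd_tvar_sub_one (ν : NuR P) (i : ι) : HasOrd ν (tvar i - 1 : RatField P) 0 := by
  have h := hasOrd_monomial_sub (P := P) (ν := ν) (e := (0, Pi.single (nuR P i) 2, 0)) (f := 0) (by
    intro h
    have h1 := congrArg (fun e : Expo P => e.2.1 (nuR P i)) h
    simp at h1)
  rw [monomial_zero] at h
  have h0 : (0 : ℤ) = min (Pi.single (M := fun _ => ℤ) (nuR P i) 2 ν) 0 := by
    have h1 := nuInd_nonneg ν i
    rw [single_two_eq]
    omega
  rw [h0]
  exact h

lemma hasOrd_one_sub_X (ν : NuR P) (w : P.weylGroup) (a : AffRoot P) :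
    HasOrd ν (1 - monomial P (expoX Δ w a)) (min 0 (-rhoRoot Δ ν (w⁻¹ • a.idx))) := by
  have h := hasOrd_monomial_sub (P := P) (ν := ν) (e := 0) (f := expoX Δ w a) (by
    intro h
    have h1 := congrArg (fun e : Expo P => e.2.2) h
    exact rootWt_ne_zero _ h1.symm)
  rwa [monomial_zero] at h

lemma hasOrd_tvar_sub_X (ν : NuR P) (w : P.weylGroup) (a : AffRoot P) :
    HasOrd ν (tvar a.idx - monomial P (expoX Δ w a))
      (min (2 * nuInd ν a.idx) (-rhoRoot Δ ν (w⁻¹ • a.idx))) := by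
  have h := hasOrd_monomial_sub (P := P) (ν := ν) (e := (0, Pi.single (nuR P a.idx) 2, 0))
    (f := expoX Δ w a) (by
      intro h
      have h1 := congrArg (fun e : Expo P => e.2.2) h
      exact rootWt_ne_zero _ h1.symm)
  rw [← single_two_eq]
  exact h

lemma fFun_eq (a : AffRoot P) : fFun a = (tvar a.idx - Xvar a) / (1 - Xvar a) := by
  have h0 := Xvar_ne_zero a
  have h1 : 1 - Xvar a ≠ 0 := sub_ne_zero.mpr (Xvar_ne_one a).symm
  have h2 : (Xvar a)⁻¹ - 1 ≠ 0 := by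
    rw [sub_ne_zero]
    exact fun h => Xvar_ne_one a (inv_eq_one.mp h)
  rw [fFun, div_eq_div_iff h2 h1]
  field_simp

lemma gFun_eq (a : AffRoot P) : gFun a = -((tvar a.idx - 1) * Xvar a / (1 - Xvar a)) := by
  have h0 := Xvar_ne_zero a
  have h1 : 1 - Xvar a ≠ 0 := sub_ne_zero.mpr (Xvar_ne_one a).symm
  have h3 : 1 - (Xvar a)⁻¹ ≠ 0 := by
    rw [sub_ne_zero]
    exact fun h => Xvar_ne_one a (inv_eq_one.mp h.symm)
  rw [gFun, ← neg_div, div_eq_div_iff h3 h1]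
  field_simp
  ring

/-- In `(t - X)/(1 - X)` the bound `2 nuInd ≤ (2ρ_ν^∨, γ)` for positive `γ` decides both minima: `X`
dominates numerator and denominator if `w⁻¹ α` is positive; if it is negative, the quotient has the
order of `t`. -/
lemma hasOrd_component_fFun (ν : NuR P) (w : P.weylGroup) (a : AffRoot P) :
    HasOrd ν (component Δ w (fFun a))
      (2 * (nuInd ν a.idx * (1 - posInd Δ (w⁻¹ • a.idx)))) := by
  rw [fFun_eq, component_div, component_sub, component_sub, component_one, component_tvar,
    component_Xvar]
  convert (hasOrd_tvar_sub_X Δ ν w a).div (hasOrd_one_sub_X Δ ν w a) using 1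
  have h0 : nuInd ν (w⁻¹ • a.idx) = nuInd ν a.idx := (isRootSymm_weyl w⁻¹).nuInd ν a.idx
  have h1 := nuInd_nonneg ν a.idx
  by_cases hp : Δ.IsPos (w⁻¹ • a.idx)
  · have h2 := two_mul_nuInd_le_rhoRoot Δ ν hp
    rw [h0] at h2
    rw [posInd, if_pos hp, min_eq_right (by linarith), min_eq_right (by linarith)]
    ring
  · have h2 := two_mul_nuInd_le_rhoRoot Δ ν ((isPos_negIdx Δ _).mpr hp)
    rw [rhoRoot_negIdx, nuInd_negIdx, h0] at h2
    rw [posInd, if_neg hp, min_eq_left (by linarith), min_eq_left (by linarith)]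
    ring

lemma hasOrd_component_gFun (ν : NuR P) (w : P.weylGroup) (a : AffRoot P) :
    HasOrd ν (component Δ w (gFun a)) (max 0 (-rhoRoot Δ ν (w⁻¹ • a.idx))) := by
  rw [gFun_eq, component_neg, component_div, component_mul, component_sub, component_sub,
    component_one, component_tvar, component_Xvar]
  convert (((hasOrd_tvar_sub_one ν a.idx).mul (hasOrd_monomial (expoX Δ w a))).div
    (hasOrd_one_sub_X Δ ν w a)).neg using 1
  change _ = 0 + -rhoRoot Δ ν (w⁻¹ • a.idx) - min 0 (-rhoRoot Δ ν (w⁻¹ • a.idx))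
  omega

end Components

/-! ### Orders of products of terms, expressed as costs of paths. -/

section OperatorOrders

variable {ι V N : Type*} [Fintype ι] [NormedAddCommGroup V] [InnerProductSpace ℝ V]
  [AddCommGroup N] [Module ℝ N] {P : RootPairing ι ℝ V N} [P.IsRootSystem] [P.IsCrystallographic]
  [NormalizedForm P] (Δ : P.Base)

lemma shiftSpin_zero (b : weightLattice P) : shiftSpin Δ b (0 : Spin P) = 0 := by
  funext u
  change _ * monAut P _ 0 = 0
  rw [map_zero, mul_zero]

lemma shiftSpin_apply (b : weightLattice P) (f : Spin P) (u : P.weylGroup) :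
    shiftSpin Δ b f u
      = monomial P (0, fun ν => -twoRho Δ ν b, 0) * monAut P (rhoShift Δ) (f u) := rfl

lemma coeff_finset_sum {k G α : Type*} [AddCommMonoid k] (s : Finset α)
    (F : α → SkewMonoidAlgebra k G) (x : G) : (∑ i ∈ s, F i).coeff x = ∑ i ∈ s, (F i).coeff x := by
  induction s using Finset.induction_on with
  | empty => rfl
  | insert i s hi ih =>
    rw [Finset.sum_insert hi, Finset.sum_insert hi, ← ih, SkewMonoidAlgebra.coeff_add]
    rfl

lemma coeff_conjRho (A : SpinDiffRefl P) (x : SpinGrp P) :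
    (conjRho Δ A).coeff x = shiftSpin Δ x.1.toAdd (A.coeff x) := by
  rw [conjRho, SkewMonoidAlgebra.sum_def', coeff_finset_sum]
  simp only [SkewMonoidAlgebra.coeff_single, Finsupp.single_apply]
  rw [Finset.sum_ite_eq' A.support x]
  split_ifs with h
  · rfl
  · rw [SkewMonoidAlgebra.notMem_support_iff.mp h, shiftSpin_zero]

lemma spin_mul_apply (f g : Spin P) (u : P.weylGroup) : (f * g) u = f u * g u := rfl

lemma phi_single (g : ExtAffWeyl P) (h : RatField P) :
    phi (SkewMonoidAlgebra.single g h : DiffRefl P) = ∑ u : P.weylGroup,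
      SkewMonoidAlgebra.single (Multiplicative.ofAdd (u⁻¹ • -g.trans), g.lin)
        (rhoSpin h * zeta u) := by
  rw [phi, SkewMonoidAlgebra.sum_single_index]
  · rw [rhoGamma, Finset.mul_sum, Finset.sum_mul]
    refine Finset.sum_congr rfl fun u _ => ?_
    rw [rhoFun, deltaW, SkewMonoidAlgebra.single_mul_single, SkewMonoidAlgebra.single_mul_single,
      one_smul, one_mul, smul_one, mul_one]
    congr 1
    exact Prod.ext (mul_one _) (one_mul _)
  · have h0 : rhoSpin (0 : RatField P) = (0 : Spin P) := by
      funext u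
      exact smul_zero _
    rw [rhoFun, h0, SkewMonoidAlgebra.single_zero, zero_mul, zero_mul]

lemma coeff_phi_single (g : ExtAffWeyl P) (h : RatField P) (x : SpinGrp P) (u : P.weylGroup) :
    (phi (SkewMonoidAlgebra.single g h : DiffRefl P)).coeff x u
      = if x = (Multiplicative.ofAdd (u⁻¹ • -g.trans), g.lin)
        then (⟨0, u⁻¹⟩ : ExtAffWeyl P) • h else 0 := by
  have hsum : ∀ (s : Finset P.weylGroup) (F : P.weylGroup → Spin P),
      (∑ v ∈ s, F v) u = ∑ v ∈ s, F v u := by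
    intro s F
    exact Finset.sum_apply (M := fun _ : P.weylGroup => RatField P) u s F
  rw [phi_single, coeff_finset_sum, hsum,
    Finset.sum_eq_single u]
  · rw [SkewMonoidAlgebra.coeff_single, Finsupp.single_apply]
    by_cases hx : x = (Multiplicative.ofAdd (u⁻¹ • -g.trans), g.lin)
    · rw [if_pos hx.symm, if_pos hx, spin_mul_apply, zeta, if_pos rfl, mul_one]
      rfl
    · rw [if_neg (Ne.symm hx), if_neg hx]
      rfl
  · intro v _ hv
    rw [SkewMonoidAlgebra.coeff_single, Finsupp.single_apply]
    split_ifs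
    · rw [spin_mul_apply, zeta, if_neg (Ne.symm hv), mul_zero]
    · rfl
  · exact fun h => absurd (Finset.mem_univ u) h

/-- In the `u`-component only one difference operator survives, the one with the translation moved
by `u⁻¹`; the minimum in the order is therefore over one coefficient. -/
lemma coeff_aeDelta_single (g : ExtAffWeyl P) (h : RatField P) (x : SpinGrp P)
    (u : P.weylGroup) :
    (aeDelta Δ (SkewMonoidAlgebra.single g h : DiffRefl P)).coeff x u
      = if x = (Multiplicative.ofAdd (u⁻¹ • -g.trans), g.lin)
        then monomial P (0, fun ν => -twoRho Δ ν (u⁻¹ • -g.trans), 0) * component Δ u h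
        else 0 := by
  rw [aeDelta, coeff_conjRho, shiftSpin_apply, coeff_phi_single]
  split_ifs with hx
  · rw [hx]
    rfl
  · rw [map_zero, mul_zero]

lemma twoRho_neg (ν : NuR P) (b : weightLattice P) : twoRho Δ ν (-b) = -twoRho Δ ν b := by
  simp only [twoRho, coPair_neg, Finset.sum_neg_distrib]

lemma twoRho_zsmul (ν : NuR P) (n : ℤ) (b : weightLattice P) :
    twoRho Δ ν (n • b) = n * twoRho Δ ν b := by
  simp only [twoRho, coPair_zsmul, Finset.mul_sum]

/-- `A` is a function times an element of `Ŵ` with linear part `v`, and `n` is the order of the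
`w`-component of the coefficient of `æ^δ(A)` with respect to `t_ν^{1/2}`. -/
def HasTermOrd (ν : NuR P) (w : P.weylGroup) (A : DiffRefl P) (v : P.weylGroup) (n : ℤ) : Prop :=
  ∃ (g : ExtAffWeyl P) (h : RatField P) (m : ℤ), A = SkewMonoidAlgebra.single g h ∧ g.lin = v ∧
    HasOrd ν (component Δ w h) m ∧ n = twoRho Δ ν (w⁻¹ • g.trans) + m

variable {Δ} {ν : NuR P} {w v v' : P.weylGroup} {A A' : DiffRefl P} {n n' : ℤ}

/-- Moving `δ(v)` past the second factor shifts spinor components, so the second factor is evaluated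
at `v⁻¹ w`. -/
lemma HasTermOrd.mul (h : HasTermOrd Δ ν w A v n) (h' : HasTermOrd Δ ν (v⁻¹ * w) A' v' n') :
    HasTermOrd Δ ν w (A * A') (v * v') (n + n') := by
  obtain ⟨g, x, m, rfl, rfl, hx, rfl⟩ := h
  obtain ⟨g', x', m', rfl, rfl, hx', rfl⟩ := h'
  refine ⟨g * g', x * g • x', m + m', SkewMonoidAlgebra.single_mul_single, rfl, ?_, ?_⟩
  · rw [component_mul]
    exact hx.mul (hasOrd_component_smul Δ hx')
  · rw [mul_trans, smul_add, twoRho_add, mul_inv_rev, inv_inv, mul_smul]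
    ring

lemma HasTermOrd.coeff_ord (h : HasTermOrd Δ ν w A v n) : ∃ x₀ : SpinGrp P, x₀.2 = v ∧
    tOrd ν ((aeDelta Δ A).coeff x₀ w) = (((n : ℚ) / 2 : ℚ) : WithTop ℚ) ∧
    x₀ ∈ (aeDelta Δ A).support ∧ (∀ x ≠ x₀, (aeDelta Δ A).coeff x w = 0) ∧
    ∀ x ∈ (aeDelta Δ A).support, x.2 = v := by
  obtain ⟨g, y, m, rfl, rfl, hy, rfl⟩ := h
  have h1 : HasOrd ν (monomial P (0, fun ν => -twoRho Δ ν (w⁻¹ • -g.trans), 0)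
      * component Δ w y) (twoRho Δ ν (w⁻¹ • g.trans) + m) := by
    have h2 := (hasOrd_monomial (P := P) (ν := ν)
      (0, fun ν => -twoRho Δ ν (w⁻¹ • -g.trans), 0)).mul hy
    convert h2 using 2
    simp only [smul_neg, twoRho_neg, neg_neg]
  have h0 : (aeDelta Δ (SkewMonoidAlgebra.single g y : DiffRefl P)).coeff
      (Multiplicative.ofAdd (w⁻¹ • -g.trans), g.lin) w
      = monomial P (0, fun ν => -twoRho Δ ν (w⁻¹ • -g.trans), 0) * component Δ w y := by
    rw [coeff_aeDelta_single, if_pos rfl]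
  refine ⟨(Multiplicative.ofAdd (w⁻¹ • -g.trans), g.lin), rfl, ?_, ?_, ?_, ?_⟩
  · rw [h0]
    exact h1.tOrd_eq
  · rw [SkewMonoidAlgebra.mem_support_iff]
    intro h2
    rw [h2] at h0
    exact h1.ne_zero h0.symm
  · intro x hx
    rw [coeff_aeDelta_single, if_neg hx]
  · intro x hx
    rw [SkewMonoidAlgebra.mem_support_iff] at hx
    by_contra h2
    apply hx
    funext u
    rw [coeff_aeDelta_single, if_neg]
    · rfl
    · rintro rfl
      exact h2 rfl

lemma HasTermOrd.ordW_eq (h : HasTermOrd Δ ν w A v n) :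
    ordW w ν (aeDelta Δ A) = (((n : ℚ) / 2 : ℚ) : WithTop ℚ) := by
  obtain ⟨x₀, -, h1, h2, h3, -⟩ := h.coeff_ord
  apply le_antisymm
  · rw [← h1]
    exact Finset.inf_le (f := fun x => tOrd ν ((aeDelta Δ A).coeff x w)) h2
  · refine Finset.le_inf fun x _ => ?_
    by_cases hx : x = x₀
    · rw [hx, h1]
    · rw [h3 x hx, tOrd, if_pos rfl]
      exact le_top

lemma HasTermOrd.dagOrdW_eq (h : HasTermOrd Δ ν (v * w) A v n) :
    dagOrdW w ν (aeDelta Δ A) = (((n : ℚ) / 2 : ℚ) : WithTop ℚ) := by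
  rw [← h.ordW_eq, dagOrdW, ordW]
  obtain ⟨x₀, -, -, -, -, h1⟩ := h.coeff_ord
  refine Finset.inf_congr rfl fun x hx => ?_
  rw [h1 x hx]

lemma hasTermOrd_one (w : P.weylGroup) : HasTermOrd Δ ν w (1 : DiffRefl P) 1 0 := by
  refine ⟨1, 1, 0, SkewMonoidAlgebra.one_def, rfl, ?_, ?_⟩
  · rw [component_one, ← monomial_zero]
    exact hasOrd_monomial 0
  · rw [one_trans, smul_zero]
    simp [twoRho, coPair_zero]

lemma hasTermOrd_fFun (w : P.weylGroup) (a : AffRoot P) :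
    HasTermOrd Δ ν w (func (fFun a)) 1
      (2 * (nuInd ν a.idx * (1 - posInd Δ (w⁻¹ • a.idx)))) := by
  refine ⟨1, _, _, rfl, rfl, hasOrd_component_fFun Δ ν w a, ?_⟩
  rw [one_trans, smul_zero]
  simp [twoRho, coPair_zero]

lemma twoRho_affRefl (w : P.weylGroup) (a : AffRoot P) :
    twoRho Δ ν (w⁻¹ • (affRefl P a).trans) = -(a.lvl * rhoRoot Δ ν (w⁻¹ • a.idx)) := by
  change twoRho Δ ν (w⁻¹ • -(a.lvl • rootWt P a.idx)) = _
  rw [smul_neg, twoRho_neg, weyl_smul_zsmul, twoRho_zsmul, weyl_smul_rootWt]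
  rfl

lemma hasTermOrd_plusTerm (w : P.weylGroup) (a : AffRoot P) :
    HasTermOrd Δ ν w (plusTerm a true) (refl P a.idx)
      (max 0 (-rhoRoot Δ ν (w⁻¹ • a.idx)) - a.lvl * rhoRoot Δ ν (w⁻¹ • a.idx)) := by
  refine ⟨affRefl P a, gFun a, _, func_mul_grp _ _, rfl, hasOrd_component_gFun Δ ν w a, ?_⟩
  rw [twoRho_affRefl]
  ring

/-- At `s_α w` the reflection to the left of `g` brings the function back to its `w`-component. The
translation is also evaluated at `s_α w`, which reverses the sign of the level term. -/
lemma hasTermOrd_minusTerm (w : P.weylGroup) (a : AffRoot P) :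
    HasTermOrd Δ ν (refl P a.idx * w) (minusTerm a true) (refl P a.idx)
      (max 0 (-rhoRoot Δ ν (w⁻¹ • a.idx)) + a.lvl * rhoRoot Δ ν (w⁻¹ • a.idx)) := by
  refine ⟨affRefl P a, -(affRefl P a • gFun a), max 0 (-rhoRoot Δ ν (w⁻¹ • a.idx)), ?_, rfl, ?_, ?_⟩
  · rw [minusTerm, grp_mul_func, SkewMonoidAlgebra.single_neg]
  · rw [component_neg]
    refine (hasOrd_component_smul Δ ?_).neg
    change HasOrd ν (component Δ ((refl P a.idx)⁻¹ * (refl P a.idx * w)) (gFun a)) _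
    rw [inv_mul_cancel_left]
    exact hasOrd_component_gFun Δ ν w a
  · rw [twoRho_affRefl, mul_inv_rev, inv_eq_of_mul_eq_one_left (refl_mul_self a.idx), mul_smul,
      refl_smul]
    have h1 : w⁻¹ • P.reflectionPerm a.idx a.idx = negIdx P (w⁻¹ • a.idx) :=
      weyl_smul_negIdx w⁻¹ a.idx
    rw [h1, rhoRoot_negIdx]
    ring

lemma toPerm_inv_refl_mul (w : P.weylGroup) (i : ι) :
    MulAction.toPerm (α := P.weylGroup) (β := ι) w⁻¹ * P.reflectionPerm i
      = MulAction.toPerm (refl P i * w)⁻¹ := by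
  ext k
  rw [mul_inv_rev, inv_eq_of_mul_eq_one_left (refl_mul_self i), Equiv.Perm.mul_apply,
    MulAction.toPerm_apply, MulAction.toPerm_apply, mul_smul, refl_smul]

lemma exists_hasTermOrd_plus (w : P.weylGroup) (l : List (AffRoot P × Bool)) :
    ∃ v, HasTermOrd Δ ν w (l.map fun x => plusTerm x.1 x.2).prod v
      (pathCost Δ ν (MulAction.toPerm w⁻¹) l) := by
  induction l generalizing w with
  | nil => exact ⟨1, hasTermOrd_one w⟩
  | cons x l ih =>
    obtain ⟨a, c⟩ := x
    rw [List.map_cons, List.prod_cons]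
    cases c with
    | false =>
      obtain ⟨v, hv⟩ := ih w
      exact ⟨1 * v, (hasTermOrd_fFun w a).mul (by rwa [inv_one, one_mul])⟩
    | true =>
      obtain ⟨v, hv⟩ := ih (refl P a.idx * w)
      refine ⟨refl P a.idx * v, ?_⟩
      rw [pathCost, toPerm_inv_refl_mul]
      refine (hasTermOrd_plusTerm w a).mul ?_
      rwa [inv_eq_of_mul_eq_one_left (refl_mul_self a.idx)]

/-- The affine root `[α, -ν_α j]` for `[α, ν_α j]`. -/
def negLvl (a : AffRoot P) : AffRoot P := ⟨a.idx, -a.lvl⟩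

/-- The `†`-order fixes the component on the right, so the rightmost factor is seen first. This
explains both the reversed list and the evaluation at `v * w`. -/
lemma exists_hasTermOrd_minus (w : P.weylGroup) (l : List (AffRoot P × Bool)) :
    ∃ v, HasTermOrd Δ ν (v * w) (l.reverse.map fun x => minusTerm x.1 x.2).prod v
      (pathCost Δ ν (MulAction.toPerm w⁻¹) (l.map fun x => (negLvl x.1, x.2))) := by
  induction l generalizing w with
  | nil => exact ⟨1, hasTermOrd_one _⟩
  | cons x l ih =>
    obtain ⟨a, c⟩ := x
    rw [List.reverse_cons, List.map_append, List.prod_append, List.map_singleton,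
      List.prod_singleton, List.map_cons]
    cases c with
    | false =>
      obtain ⟨v, hv⟩ := ih w
      refine ⟨v * 1, ?_⟩
      rw [pathCost, add_comm]
      rw [← mul_one v] at hv
      refine HasTermOrd.mul (mul_one v ▸ hv) ?_
      rw [mul_one, inv_mul_cancel_left]
      exact hasTermOrd_fFun w a
    | true =>
      obtain ⟨v, hv⟩ := ih (refl P a.idx * w)
      refine ⟨v * refl P a.idx, ?_⟩
      rw [pathCost, add_comm, mul_assoc]
      change HasTermOrd Δ ν _ _ _ (pathCost Δ ν (MulAction.toPerm w⁻¹ * P.reflectionPerm a.idx) _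
        + (max 0 (-rhoRoot Δ ν (w⁻¹ • a.idx)) - (-a.lvl) * rhoRoot Δ ν (w⁻¹ • a.idx)))
      rw [toPerm_inv_refl_mul]
      refine hv.mul ?_
      rw [inv_mul_cancel_left, neg_mul, sub_neg_eq_add]
      exact hasTermOrd_minusTerm w a

lemma ordW_plus_eq (w : P.weylGroup) (l : List (AffRoot P × Bool)) :
    ordW w ν (aeDelta Δ (l.map fun x => plusTerm x.1 x.2).prod)
      = (((pathCost Δ ν (MulAction.toPerm w⁻¹) l : ℚ) / 2 : ℚ) : WithTop ℚ) := by
  obtain ⟨v, hv⟩ := exists_hasTermOrd_plus (Δ := Δ) (ν := ν) w l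
  exact hv.ordW_eq

lemma dagOrdW_minus_eq (w : P.weylGroup) (l : List (AffRoot P × Bool)) :
    dagOrdW w ν (aeDelta Δ (l.reverse.map fun x => minusTerm x.1 x.2).prod)
      = (((pathCost Δ ν (MulAction.toPerm w⁻¹) (l.map fun x => (negLvl x.1, x.2)) : ℚ) / 2 : ℚ) :
        WithTop ℚ) := by
  obtain ⟨v, hv⟩ := exists_hasTermOrd_minus (Δ := Δ) (ν := ν) w l
  exact hv.dagOrdW_eq

lemma half_le_half {m n : ℤ} (h : m ≤ n) :
    (((m : ℚ) / 2 : ℚ) : WithTop ℚ) ≤ (((n : ℚ) / 2 : ℚ) : WithTop ℚ) := by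
  rw [WithTop.coe_le_coe]
  have h1 : (m : ℚ) ≤ n := by exact_mod_cast h
  linarith

/-- Products of functions do not depend on the order of the factors. -/
lemma prod_func_reverse {X : Type*} (F : X → RatField P) (l : List X) :
    (l.reverse.map fun x => func (F x)).prod = (l.map fun x => func (F x)).prod := by
  have h : ∀ l : List X, (l.map fun x => (func (F x) : DiffRefl P)).prod
      = func (l.map F).prod := by
    intro l
    induction l with
    | nil => rfl
    | cons x l ih =>
      rw [List.map_cons, List.prod_cons, ih, List.map_cons, List.prod_cons, func, func, func,
        SkewMonoidAlgebra.single_mul_single, one_mul, one_smul]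
  rw [h, h, List.map_reverse, List.prod_reverse]

lemma pathCost_le_of_map {X : Type*} {θ : Equiv.Perm ι} (hθ : IsRootSymm P θ) (l : List X)
    (α : X → AffRoot P) (c : X → Bool) {η : Equiv.Perm ι} (hη : IsRootSymm P η)
    {β : List (AffRoot P)} (hβ : IsConvexList Δ β) (hl : l.map α = β.map (mapIdx η)) :
    pathCost Δ ν θ (l.map fun x => (α x, false)) ≤ pathCost Δ ν θ (l.map fun x => (α x, c x)) := by
  have hinv : ∀ a : AffRoot P, mapIdx η⁻¹ (mapIdx η a) = a := fun a =>
    AffRoot.ext (Equiv.symm_apply_apply η _) rfl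
  have hinv' : ∀ a : AffRoot P, mapIdx η (mapIdx η⁻¹ a) = a := fun a =>
    AffRoot.ext (Equiv.apply_symm_apply η _) rfl
  have h1 : β = (l.map fun x => (mapIdx η⁻¹ (α x), c x)).map Prod.fst := by
    have h2 := congrArg (List.map (mapIdx η⁻¹)) hl
    simpa only [List.map_map, Function.comp_def, hinv, List.map_id'] using h2.symm
  rw [h1] at hβ
  have h3 := pathCost_false_le ν (hθ.mul hη) hβ
  rw [← pathCost_mapIdx ν θ hη, ← pathCost_mapIdx ν θ hη] at h3
  simpa only [List.map_map, Function.comp_def, hinv'] using h3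

/-- Levels enter the cost only through the translations in reflections, so the pure product of `f`
is a common lower bound for both signs of the level. -/
lemma pathCost_false_negLvl {X : Type*} (θ : Equiv.Perm ι) (l : List X) (α : X → AffRoot P) :
    pathCost Δ ν θ (l.map fun x => (negLvl (α x), false))
      = pathCost Δ ν θ (l.map fun x => (α x, false)) := by
  induction l with
  | nil => rfl
  | cons x l ih =>
    rw [List.map_cons, List.map_cons, pathCost, ih]
    rfl

lemma ordW_func_eq {X : Type*} (w : P.weylGroup) (l : List X) (α : X → AffRoot P) :
    ordW w ν (aeDelta Δ (l.map fun x => func (fFun (α x))).prod)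
      = (((pathCost Δ ν (MulAction.toPerm w⁻¹) (l.map fun x => (α x, false)) : ℚ) / 2 : ℚ) :
        WithTop ℚ) := by
  rw [← ordW_plus_eq, List.map_map]
  rfl

/-- The inequality for the terms of `G̈^+`, for a list of roots that becomes convex after a symmetry
of the nonaffine components. -/
lemma ordW_func_le_plus {X : Type*} (w : P.weylGroup) (l : List X) (α : X → AffRoot P)
    (c : X → Bool) {η : Equiv.Perm ι} (hη : IsRootSymm P η) {β : List (AffRoot P)}
    (hβ : IsConvexList Δ β) (hl : l.map α = β.map (mapIdx η)) :
    ordW w ν (aeDelta Δ (l.map fun x => func (fFun (α x))).prod)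
      ≤ ordW w ν (aeDelta Δ (l.map fun x => plusTerm (α x) (c x)).prod) := by
  have h1 := ordW_plus_eq (Δ := Δ) (ν := ν) w (l.map fun x => (α x, c x))
  rw [List.map_map] at h1
  change ordW w ν (aeDelta Δ (l.map fun x => plusTerm (α x) (c x)).prod) = _ at h1
  rw [h1, ordW_func_eq]
  exact half_le_half (pathCost_le_of_map (isRootSymm_weyl _) l α c hη hβ hl)

/-- The inequality for the terms of `G̈^-`. -/
lemma ordW_func_le_minus {X : Type*} (w : P.weylGroup) (l : List X) (α : X → AffRoot P)
    (c : X → Bool) {η : Equiv.Perm ι} (hη : IsRootSymm P η) {β : List (AffRoot P)}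
    (hβ : IsConvexList Δ β) (hl : l.map (fun x => negLvl (α x)) = β.map (mapIdx η)) :
    ordW w ν (aeDelta Δ (l.reverse.map fun x => func (fFun (α x))).prod)
      ≤ dagOrdW w ν (aeDelta Δ (l.reverse.map fun x => minusTerm (α x) (c x)).prod) := by
  have h1 := dagOrdW_minus_eq (Δ := Δ) (ν := ν) w (l.map fun x => (α x, c x))
  rw [← List.map_reverse, List.map_map, List.map_map] at h1
  change dagOrdW w ν (aeDelta Δ (l.reverse.map fun x => minusTerm (α x) (c x)).prod) = _ at h1
  rw [h1, prod_func_reverse, ordW_func_eq, ← pathCost_false_negLvl]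
  exact half_le_half
    (pathCost_le_of_map (isRootSymm_weyl _) l (fun x => negLvl (α x)) c hη hβ hl)

end OperatorOrders

/-! ### The sequences of the theorem as symmetric images of convex lists. -/

section Comparison

variable {ι V N : Type*} [Fintype ι] [NormedAddCommGroup V] [InnerProductSpace ℝ V]
  [AddCommGroup N] [Module ℝ N] {P : RootPairing ι ℝ V N} [P.IsRootSystem] [P.IsCrystallographic]
  [NormalizedForm P]

lemma negLvl_ofRoot (i : ι) : negLvl (AffRoot.ofRoot P i) = AffRoot.ofRoot P i :=
  AffRoot.ext rfl neg_zero

lemma neg_ofRoot (i : ι) : (AffRoot.ofRoot P i).neg = AffRoot.ofRoot P (negIdx P i) :=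
  AffRoot.ext rfl neg_zero

lemma negLvl_neg (a : AffRoot P) : negLvl a.neg = mapIdx (negPerm P) a :=
  AffRoot.ext rfl (neg_neg a.lvl)

lemma rootList_append {S G X : Type*} [Group G] [MulAction G X] (s : S → G) (a : S → X)
    (A B : List S) {x : X} (hx : x ∈ rootList s a B) : x ∈ rootList s a (A ++ B) := by
  induction A with
  | nil => exact hx
  | cons j A ih => exact List.mem_cons_of_mem _ ih

variable [P.IsReduced] {Δ : P.Base}

lemma le_of_isReducedDecomposition_weyl (ν : NuR P) (w : P.weylGroup) {u : P.weylGroup}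
    {j : ℕ → Δ.support} {l : ℕ} (h : IsReducedDecomposition (simpleRefl Δ) u j l)
    {α : ℕ → AffRoot P} (hα : α = fun i =>
        AffRoot.ofRoot P (lambdaSeq (simpleRefl Δ) (fun k : Δ.support => (k : ι)) j i))
    {r p : ℕ} (hr : 1 ≤ r) (hrp : r ≤ p) (hp : p ≤ l) (c : ℕ → Bool) :
    ordW w ν (aeDelta Δ (descProd (fun i => func (fFun (α i))) p r))
        ≤ ordW w ν (aeDelta Δ (descProd (fun i => plusTerm (α i) (c i)) p r)) ∧
      ordW w ν (aeDelta Δ (ascProd (fun i => func (fFun (α i).neg)) r p))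
        ≤ ordW w ν (aeDelta Δ (ascProd (fun i => plusTerm (α i).neg (c i)) r p)) ∧
      ordW w ν (aeDelta Δ (descProd (fun i => func (fFun (α i))) p r))
        ≤ dagOrdW w ν (aeDelta Δ (descProd (fun i => minusTerm (α i) (c i)) p r)) ∧
      ordW w ν (aeDelta Δ (ascProd (fun i => func (fFun (α i).neg)) r p))
        ≤ dagOrdW w ν (aeDelta Δ (ascProd (fun i => minusTerm (α i).neg (c i)) r p)) := by
  subst hα
  have hS := isReflSystem_weyl Δ
  have hw := h.isReducedWord_range' hr (n := p + 1 - r) (by omega)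
  have hw' := hw.reverse hS.mul_self
  rw [← List.map_reverse, List.reverse_reverse] at hw'
  have hβ := isConvexList_ofRoot Δ hw
  have hβ' := isConvexList_ofRoot Δ hw'
  have hl := congrArg (List.map (AffRoot.ofRoot P))
    (map_lambdaSeq_reverse (a := fun k : Δ.support => (k : ι)) hS.mul_self j hr (p + 1 - r))
  have hl' := congrArg (List.map (AffRoot.ofRoot P)) (hS.map_lambdaSeq j hr (p + 1 - r))
  rw [List.map_map, List.map_map] at hl hl'
  simp only [descProd, ascProd]
  have hrr := List.reverse_reverse (List.range' r (p + 1 - r))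
  set x := listProd (simpleRefl Δ) ((List.range' 1 (r - 1)).map j)
  set z := listProd (simpleRefl Δ) ((List.range' 1 (r + (p + 1 - r) - 1)).map j)
  refine ⟨?_, ?_, ?_, ?_⟩
  -- Each of the four cases needs a reading direction and a sign. Descending `G̈^+` and ascending
  -- `G̈^-` products use the word itself; the other two use the reversed word.
  · refine ordW_func_le_plus w _ _ c (isRootSymm_weyl x) hβ ?_
    rw [List.map_map]
    exact hl
  -- The sign of the roots cancels the sign produced by reversing the word, so the symmetry is in
  -- `W`.
  · refine ordW_func_le_plus w _ (fun i => (AffRoot.ofRoot P (lambdaSeq (simpleRefl Δ)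
      (fun k : Δ.support => (k : ι)) j i)).neg) c (isRootSymm_weyl z) hβ' ?_
    have h1 := congrArg (List.map AffRoot.neg) hl'
    rw [List.map_map, List.map_map] at h1
    rw [List.map_map]
    refine h1.trans (List.map_congr_left fun y _ => ?_)
    simp only [Function.comp_apply]
    rw [neg_ofRoot, hS.neg_neg]
    rfl
  -- Here the sign from reversing the word is not cancelled, and the symmetry contains `-1`.
  · refine ordW_func_le_minus w _ _ c (isRootSymm_neg.mul (isRootSymm_weyl z)) hβ' ?_
    simp only [negLvl_ofRoot]
    rw [List.map_map]
    exact hl'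
  · rw [← hrr]
    refine ordW_func_le_minus w _ (fun i => (AffRoot.ofRoot P (lambdaSeq (simpleRefl Δ)
      (fun k : Δ.support => (k : ι)) j i)).neg) c (isRootSymm_neg.mul (isRootSymm_weyl x)) hβ ?_
    simp only [neg_ofRoot, negLvl_ofRoot]
    have h1 := congrArg (List.map AffRoot.neg) hl
    rw [List.map_map, List.map_map] at h1
    rw [List.map_map]
    simp only [Function.comp_def, neg_ofRoot] at h1
    exact h1

lemma le_of_isReducedDecomposition_aff [P.IsIrreducible] {ϑ : ι} (hϑ : IsMaximalShortRoot Δ ϑ)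
    (ν : NuR P) (w : P.weylGroup) {b : weightLattice P} (hb : IsDominant Δ b)
    {π v : ExtAffWeyl P} (hπ : π ∈ diagramGroup Δ ϑ) (hv : (⟨b, 1⟩ : ExtAffWeyl P) = π * v)
    {j : ℕ → Option Δ.support} {l : ℕ} (h : IsReducedDecomposition (affSimpleRefl Δ ϑ) v j l)
    {α : ℕ → AffRoot P} (hα : α = lambdaSeq (affSimpleRefl Δ ϑ) (affSimple Δ ϑ) j)
    {p : ℕ} (hp : p ≤ l) (c : ℕ → Bool) :
    ordW w ν (aeDelta Δ (descProd (fun i => func (fFun (α i))) p 1))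
        ≤ ordW w ν (aeDelta Δ (descProd (fun i => plusTerm (α i) (c i)) p 1)) ∧
      ordW w ν (aeDelta Δ (ascProd (fun i => func (fFun (α i).neg)) 1 p))
        ≤ dagOrdW w ν (aeDelta Δ (ascProd (fun i => minusTerm (α i).neg (c i)) 1 p)) := by
  subst hα
  have hS := hϑ.isReflSystem
  have hw := h.isReducedWord_range' le_rfl (n := p) (by omega)
  have hβ : IsConvexList Δ (rootList (affSimpleRefl Δ ϑ) (affSimple Δ ϑ)
      ((List.range' 1 p).reverse.map j)) := by
    -- The roots of the first `p` letters are among the inversions of the whole element, to which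
    -- dominance applies.
    refine isConvexList_rootList hϑ hw fun x hx => ?_
    have h1 : (List.range' 1 l).reverse.map j
        = (List.range' (1 + p) (l - p)).reverse.map j ++ (List.range' 1 p).reverse.map j := by
      rw [← List.map_append, ← List.reverse_append, List.range'_append_1]
      congr 3
      omega
    have h2 := rootList_append _ _ ((List.range' (1 + p) (l - p)).reverse.map j) _ hx
    rw [← h1, hS.mem_rootList_iff h.isReducedWord] at h2
    have h3 : listProd (affSimpleRefl Δ ϑ) ((List.range' 1 l).reverse.map j) = v := by
      rw [h.1, wordProd, descProd_eq, Nat.add_sub_cancel]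
    rw [h3] at h2
    exact hb.isPos_idx hϑ hπ hv h2.1 h2.2
  have hl := map_lambdaSeq_reverse (a := affSimple Δ ϑ) hS.mul_self j le_rfl p
  simp only [Nat.sub_self, List.range'_zero, List.map_nil, listProd_nil, one_smul,
    List.map_id'] at hl
  simp only [descProd, ascProd, Nat.add_sub_cancel]
  constructor
  · refine ordW_func_le_plus w _ _ c (isRootSymm_weyl 1) hβ ?_
    rw [hl]
    refine (List.map_id'' (fun a => ?_) _).symm
    exact AffRoot.ext (one_smul P.weylGroup a.idx) rfl
  · rw [← List.reverse_reverse (List.range' 1 p)]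
    -- Reversing the level of `-α̃` gives back the level of `α̃` with nonaffine part `-α`. Thus `-1`
    -- on nonaffine parts alone is the required symmetry.
    refine ordW_func_le_minus w _
      (fun i => (lambdaSeq (affSimpleRefl Δ ϑ) (affSimple Δ ϑ) j i).neg) c isRootSymm_neg hβ ?_
    simp only [negLvl_neg]
    rw [← hl, List.map_map]
    rfl

end Comparison

end TodaDunkl
end

theorem proposition5p1 {ι V N : Type*} [Fintype ι] [NormedAddCommGroup V] [InnerProductSpace ℝ V]
    [AddCommGroup N] [Module ℝ N] (P : RootPairing ι ℝ V N) [P.IsRootSystem] [P.IsCrystallographic]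
    [P.IsReduced] [P.IsIrreducible] [NormalizedForm P] (Δ : P.Base) (ϑ : ι)
    (hϑ : IsMaximalShortRoot Δ ϑ) (ν : NuR P) (w : P.weylGroup) :
    -- Part A
    (∀ (u : P.weylGroup) (j : ℕ → Δ.support) (l : ℕ), IsReducedDecomposition (simpleRefl Δ) u j l →
      let α : ℕ → AffRoot P := fun i =>
        AffRoot.ofRoot P (lambdaSeq (simpleRefl Δ) (fun k : Δ.support => (k : ι)) j i)
      ∀ r p : ℕ, 1 ≤ r → r ≤ p → p ≤ l → ∀ c : ℕ → Bool,
        ordW w ν (aeDelta Δ (descProd (fun i => func (fFun (α i))) p r))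
          ≤ ordW w ν (aeDelta Δ (descProd (fun i => plusTerm (α i) (c i)) p r)) ∧
        ordW w ν (aeDelta Δ (ascProd (fun i => func (fFun (α i).neg)) r p))
          ≤ ordW w ν (aeDelta Δ (ascProd (fun i => plusTerm (α i).neg (c i)) r p)) ∧
        ordW w ν (aeDelta Δ (descProd (fun i => func (fFun (α i))) p r))
          ≤ dagOrdW w ν (aeDelta Δ (descProd (fun i => minusTerm (α i) (c i)) p r)) ∧
        ordW w ν (aeDelta Δ (ascProd (fun i => func (fFun (α i).neg)) r p))
          ≤ dagOrdW w ν (aeDelta Δ (ascProd (fun i => minusTerm (α i).neg (c i)) r p))) ∧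
    -- Part B
    (∀ b : weightLattice P, IsDominant Δ b → ∀ π ∈ diagramGroup Δ ϑ,
      ∀ (v : ExtAffWeyl P) (j : ℕ → Option Δ.support) (l : ℕ),
      (⟨b, 1⟩ : ExtAffWeyl P) = π * v → IsReducedDecomposition (affSimpleRefl Δ ϑ) v j l →
      let α : ℕ → AffRoot P := lambdaSeq (affSimpleRefl Δ ϑ) (affSimple Δ ϑ) j
      ∀ p : ℕ, 1 ≤ p → p ≤ l → ∀ c : ℕ → Bool,
        ordW w ν (aeDelta Δ (descProd (fun i => func (fFun (α i))) p 1))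
          ≤ ordW w ν (aeDelta Δ (descProd (fun i => plusTerm (α i) (c i)) p 1)) ∧
        ordW w ν (aeDelta Δ (ascProd (fun i => func (fFun (α i).neg)) 1 p))
          ≤ dagOrdW w ν (aeDelta Δ (ascProd (fun i => minusTerm (α i).neg (c i)) 1 p))) := by
  refine ⟨fun u j l h r p hr hrp hp c =>
    le_of_isReducedDecomposition_weyl ν w h rfl hr hrp hp c, ?_⟩
  intro b hb π hπ v j l hv h α p _ hp c
  exact le_of_isReducedDecomposition_aff hϑ ν w hb hπ hv h rfl hp c
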